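/- Let $V$ be a finite set and let $K\colon V^2\to[0,1]$ be a sub-stochastic matrix ($\sum_y K(x,y)\le 1$ for all $x$) that is non-degenerate, i.e. no principal submatrix of $K$ is stochastic. A $K$-walk is a killed random walk which from $x$ jumps to $y$ with probability $K(x,y)$ and is killed with probability $1-\sum_y K(x,y)$; a $(K,\nu)$-walk is a $K$-walk with initial law $\nu$. Let $\lambda\in(0,\infty)$ and let $\nu$ be a probability distribution on $V$ such that every site can be reached by a $K$-walk started from $\nu$. *The $\mathrm{ARW}(K,\lambda,\nu)$ chain.* In a configuration $\eta\in\{0,\mathrm{s},1,2,\dots\}^V$ each site is empty, occupied by one sleeping particle ($\mathrm{s}$), or occupied by $k\ge1$ active particles. In continuous time, active particles independently jump from $x$ to $y$ at rate $K(x,y)$ and die at $x$ at rate $1-\sum_yK(x,y)$, and an active particle alone on its site falls asleep at rate $\lambda$; a sleeping particle does not move and becomes active when another particle arrives at its site. Running this dynamics until no active particle remains is called stabilization. The $\mathrm{ARW}(K,\lambda,\nu)$ chain is the discrete-time Markov chain on $\mathcal X=\{0,\mathrm{s}\}^V$ which at each step adds one active particle at a $\nu$-distributed site (waking up a sleeping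 particle there) and then stabilizes. Let $P$ be its transition matrix. *IDLA.* Let $W_1,W_2,\dots$ be i.i.d. $(K,\nu)$-walks. Set $\mathcal S_0=\emptyset$, and let $\mathcal S_t$ be obtained from $\mathcal S_{t-1}$ by adding the first site outside $\mathcal S_{t-1}$ visited by $W_t$ before it is killed, if there is one ($\mathcal S_t=\mathcal S_{t-1}$ otherwise). The filling time is $T=\min\{t\in\mathbb N\colon \mathcal S_t=V\}$. Then $P$ has a unique invariant law $\pi$, and $\pi(\eta)>0$ for all $\eta\in\mathcal X$. Moreover, for every $t\in\mathbb N$, $$ d_{\mathrm{sep}}(t):=\max_{\eta,\eta'\in\mathcal X}\Bigl(1-\frac{P^t(\eta,\eta')}{\pi(\eta')}\Bigr)=\mathbb P(T>t).$$ Finally, $T$ is a strong stationary time for the chain (an optimal one, by the above equality), in the following sense: for every $\eta\in\mathcal X$ there are a probability space with a filtration $(\mathcal F_t)_{t\in\mathbb N}$, a Markov chain $(\xi_t)_{t\in\mathbb N}$ relative to this filtration with transition matrix $P$ and $\xi_0=\eta$, and i.i.d. $(K,\nu)$-walks $W_1,W_2,\dots$ on the same probability space, whose filling time $T$ is an almost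 surely finite $(\mathcal F_t)$-stopping time such that $$\mathbb P(T=t,\ \xi_t=\eta')=\mathbb P(T=t)\,\pi(\eta')\qquad\text{for all } t\in\mathbb N,\ \eta'\in\mathcal X.$$ -/

import Mathlib

open MeasureTheory ProbabilityTheory
open scoped ENNReal NNReal

universe u v

namespace ARW

/-- The law of the time-homogeneous Markov chain `X 0, X 1, …` on a discrete space `α` with initial
law `init` and one-step transition probabilities `p`. -/
noncomputable def markovChainLaw {α : Type u} [MeasurableSpace α] [DiscreteMeasurableSpace α]
    (init : PMF α) (p : α → PMF α) : Measure (ℕ → α) :=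
  let step : Kernel α α :=
    { toFun := fun a => (p a).toMeasure
      measurable' := Measurable.of_discrete }
  have : IsMarkovKernel step := ⟨fun a => inferInstanceAs (IsProbabilityMeasure (p a).toMeasure)⟩
  Kernel.trajMeasure (X := fun _ => α) init.toMeasure
    (fun n => step.comap (fun x : (i : Finset.Iic n) → α => x ⟨n, Finset.mem_Iic.2 le_rfl⟩)
      (measurable_pi_apply _))

/-- A sub-stochastic matrix on `V`. -/
structure SubstochasticMatrix (V : Type u) [Fintype V] where
  prob : V → V → ℝ
  nonneg : ∀ x y, 0 ≤ prob x y
  sum_le_one : ∀ x, ∑ y, prob x y ≤ 1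

namespace SubstochasticMatrix

variable {V : Type u} [Fintype V] (K : SubstochasticMatrix V)

/-- The probability (or rate) of being killed at `x`. -/
noncomputable def kill (x : V) : ℝ := 1 - ∑ y, K.prob x y

/-- No (non-empty) principal sub-matrix is stochastic. -/
def NonDegenerate : Prop :=
  ∀ S : Finset V, S.Nonempty → ¬ ∀ x ∈ S, ∑ y ∈ S, K.prob x y = 1

/-- Every site can be reached by a `K`-walk that starts in the support of `ν`. -/
def Reaches (ν : PMF V) : Prop :=
  ∀ x, ∃ y ∈ ν.support, Relation.ReflTransGen (fun a b => 0 < K.prob a b) y x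

end SubstochasticMatrix

/-! ### Killed walks -/

/-- A site, or the cemetery `none` of the killed walk. -/
def WalkState (V : Type u) : Type u := Option V

instance (V : Type u) : MeasurableSpace (WalkState V) := ⊤

instance (V : Type u) : DiscreteMeasurableSpace (WalkState V) := ⟨fun _ => trivial⟩

section Walks

variable {V : Type u} [Fintype V]

/-- The probability that a `K`-walk alive at `x` jumps to `y` (for `some y`) or dies (`none`). -/
noncomputable def stepProb (K : SubstochasticMatrix V) (x : V) : Option V → ℝ≥0∞
  | some y => ENNReal.ofReal (K.prob x y)
  | none => ENNReal.ofReal (K.kill x)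

theorem sum_stepProb (K : SubstochasticMatrix V) (x : V) : ∑ o, stepProb K x o = 1 := by
  rw [Fintype.sum_option]
  simp only [stepProb, SubstochasticMatrix.kill]
  rw [← ENNReal.ofReal_sum_of_nonneg (fun y _ => K.nonneg x y),
    ← ENNReal.ofReal_add (sub_nonneg.2 (K.sum_le_one x))
      (Finset.sum_nonneg fun y _ => K.nonneg x y)]
  simp

/-- One-step transitions of the `K`-walk; the cemetery is absorbing. -/
noncomputable def walkStep (K : SubstochasticMatrix V) : WalkState V → PMF (WalkState V)
  | some x => PMF.ofFintype (α := Option V) (stepProb K x) (sum_stepProb K x)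
  | none => PMF.pure (α := Option V) none

/-- The law of the trajectory of a `(K, ν)`-walk: the `K`-walk with initial law `ν`. -/
noncomputable def walkLaw (K : SubstochasticMatrix V) (ν : PMF V) : Measure (ℕ → WalkState V) :=
  markovChainLaw (ν.map (β := Option V) some) (walkStep K)

/-- `W 0, W 1, …` are i.i.d. `(K, ν)`-walks. -/
structure IsIIDWalks (K : SubstochasticMatrix V) (ν : PMF V) {Ω : Type v} [MeasurableSpace Ω]
    (P : Measure Ω) (W : ℕ → Ω → ℕ → WalkState V) : Prop where
  measurable : ∀ t, Measurable (W t)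
  indep : iIndepFun W P
  law : ∀ t, P.map (W t) = walkLaw K ν

end Walks

/-! ### IDLA -/

section IDLA

variable {V : Type u}

open Classical in
/-- The update function of IDLA: add to `S` the first site outside `S` visited by the walk `w`
before its death, if there is one. -/
noncomputable def idlaUpdate (S : Finset V) (w : ℕ → WalkState V) : Finset V :=
  if h : ∃ k : ℕ, ∃ x : V, w k = some x ∧ x ∉ S then
    insert (Nat.find_spec h).choose S
  else S

/-- The IDLA process driven by the walks `w 0, w 1, …`, from the empty set. -/
noncomputable def idla (w : ℕ → ℕ → WalkState V) : ℕ → Finset V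
  | 0 => ∅
  | t + 1 => idlaUpdate (idla w t) (w t)

/-- The filling time `min {t : S_t = V}` of IDLA, with value `⊤` if IDLA never fills `V`. -/
noncomputable def fillingTime [Fintype V] (w : ℕ → ℕ → WalkState V) : ℕ∞ :=
  sInf ((fun t : ℕ => (t : ℕ∞)) '' {t | idla w t = Finset.univ})

end IDLA

/-! ### Activated random walks -/

/-- The state of a site: `active k` means `k` active particles (so `active 0` is the empty site),
`asleep` means one sleeping particle. -/
inductive SiteState : Type
  | active (k : ℕ)
  | asleep

/-- The state after the arrival of one more (active) particle, which wakes up a sleeping one. -/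
def SiteState.arrive : SiteState → SiteState
  | active k => active (k + 1)
  | asleep => active 2

/-- The state after the departure of one active particle. -/
def SiteState.depart : SiteState → SiteState
  | active k => active (k - 1)
  | asleep => asleep

/-- The number of active particles. -/
def SiteState.numActive : SiteState → ℕ
  | active k => k
  | asleep => 0

/-- Configurations of particles on `V`. -/
def Config (V : Type u) : Type u := V → SiteState

instance (V : Type u) : MeasurableSpace (Config V) := ⊤

instance (V : Type u) : DiscreteMeasurableSpace (Config V) := ⟨fun _ => trivial⟩

/-- The stable configurations: each site is empty (`false`) or carries a sleeping particle
(`true`). -/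
abbrev StableConfig (V : Type u) : Type u := V → Bool

/-- A stable configuration, seen as a configuration. -/
def StableConfig.toConfig {V : Type u} (η : StableConfig V) : Config V :=
  fun x => if η x then SiteState.asleep else SiteState.active 0

/-- The possible events of the ARW dynamics at a site. -/
inductive Action (V : Type u) : Type u
  /-- an active particle jumps to `y` -/
  | jump (y : V)
  /-- an active particle is killed -/
  | die
  /-- the only particle, active, falls asleep -/
  | sleep

section Moves

variable {V : Type u} [DecidableEq V]

/-- The configuration obtained by adding one active particle at `x`. -/
def Config.add (η : Config V) (x : V) : Config V :=
  Function.update (β := fun _ => SiteState) η x (η x).arrive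

/-- The configuration obtained by removing one active particle at `x`. -/
def Config.remove (η : Config V) (x : V) : Config V :=
  Function.update (β := fun _ => SiteState) η x (η x).depart

/-- The configuration after the action `a` at the site `x`. -/
def Config.act (η : Config V) (x : V) : Action V → Config V
  | .jump y => (η.remove x).add y
  | .die => η.remove x
  | .sleep => Function.update (β := fun _ => SiteState) η x SiteState.asleep

end Moves

section Dynamics

variable {V : Type u} [Fintype V]

/-- The rate of the action `a` at the site `x` in the configuration `η`. -/
noncomputable def actionRate (K : SubstochasticMatrix V) (lam : ℝ) (η : Config V) (x : V) :
    Action V → ℝ≥0∞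
  | .jump y => (η x).numActive * ENNReal.ofReal (K.prob x y)
  | .die => (η x).numActive * ENNReal.ofReal (K.kill x)
  | .sleep => if (η x).numActive = 1 then ENNReal.ofReal lam else 0

/-- The actions at a fixed site form a finite type. -/
def actionEquiv (V : Type u) : Action V ≃ Option (Option V) where
  toFun
    | .jump y => some (some y)
    | .die => some none
    | .sleep => none
  invFun
    | some (some y) => .jump y
    | some none => .die
    | none => .sleep
  left_inv a := by cases a <;> rfl
  right_inv o := by rcases o with _ | _ | _ <;> rfl

instance : Fintype (Action V) := Fintype.ofEquiv _ (actionEquiv V).symm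

/-- The rate of the event "action `e.2` at site `e.1`" in the configuration `η`. -/
noncomputable def eventRate (K : SubstochasticMatrix V) (lam : ℝ) (η : Config V)
    (e : V × Action V) : ℝ≥0∞ :=
  actionRate K lam η e.1 e.2

/-- The total rate of events in the configuration `η`. -/
noncomputable def totalRate (K : SubstochasticMatrix V) (lam : ℝ) (η : Config V) : ℝ≥0∞ :=
  ∑ e, eventRate K lam η e

theorem totalRate_ne_top (K : SubstochasticMatrix V) (lam : ℝ) (η : Config V) :
    totalRate K lam η ≠ ∞ := by
  refine (ENNReal.sum_lt_top.2 fun e _ => ?_).ne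
  obtain ⟨x, a⟩ := e
  cases a with
  | jump y => exact ENNReal.mul_lt_top (ENNReal.natCast_lt_top _) ENNReal.ofReal_lt_top
  | die => exact ENNReal.mul_lt_top (ENNReal.natCast_lt_top _) ENNReal.ofReal_lt_top
  | sleep =>
    simp only [eventRate, actionRate]
    split_ifs
    · exact ENNReal.ofReal_lt_top
    · exact ENNReal.zero_lt_top

variable [DecidableEq V]

open Classical in
/-- The jump chain of the ARW dynamics: an event is drawn with probability proportional to its
rate; a configuration without active particles, where all rates vanish, is absorbing. -/
noncomputable def jumpStep (K : SubstochasticMatrix V) (lam : ℝ) (η : Config V) :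
    PMF (Config V) :=
  if h : totalRate K lam η = 0 then PMF.pure η
  else
    (PMF.normalize (eventRate K lam η)
      (by rw [tsum_fintype]; exact h)
      (by rw [tsum_fintype]; exact totalRate_ne_top K lam η)).map fun e => η.act e.1 e.2

/-- The randomness of the continuous-time dynamics from `η`: the path of its jump chain, and
an independent sequence of i.i.d. exponential variables of mean one. -/
noncomputable def dynamicsLaw (K : SubstochasticMatrix V) (lam : ℝ) (η : Config V) :
    Measure ((ℕ → Config V) × (ℕ → ℝ)) :=
  (markovChainLaw (PMF.pure η) (jumpStep K lam)).prod (Measure.infinitePi fun _ => expMeasure 1)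

/-- The time of the `n`-th event: the holding time in the `i`-th configuration `ω.1 i` is
exponential of parameter its total rate (and infinite if the total rate vanishes). -/
noncomputable def eventTime (K : SubstochasticMatrix V) (lam : ℝ)
    (ω : (ℕ → Config V) × (ℕ → ℝ)) (n : ℕ) : ℝ≥0∞ :=
  ∑ i ∈ Finset.range n, ENNReal.ofReal (ω.2 i) / totalRate K lam (ω.1 i)

/-- The continuous-time process is in the configuration `ξ` at time `s`. -/
def StateAt (K : SubstochasticMatrix V) (lam : ℝ) (ω : (ℕ → Config V) × (ℕ → ℝ))
    (s : ℝ≥0) (ξ : Config V) : Prop :=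
  ∃ n, eventTime K lam ω n ≤ s ∧ s < eventTime K lam ω (n + 1) ∧ ω.1 n = ξ

/-- The probability that the stabilization of `η` produces `ξ`, i.e. that the continuous-time
dynamics from `η` eventually stays in `ξ` forever. -/
noncomputable def stabilizationProb (K : SubstochasticMatrix V) (lam : ℝ) (η ξ : Config V) : ℝ :=
  (dynamicsLaw K lam η).real {ω | ∃ s₀ : ℝ≥0, ∀ s ≥ s₀, StateAt K lam ω s ξ}

/-- The transition matrix of the `ARW(K, lam, ν)` chain: add an active particle at a
`ν`-distributed site, then stabilize. -/
noncomputable def transitionMatrix (K : SubstochasticMatrix V) (lam : ℝ) (ν : PMF V) :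
    Matrix (StableConfig V) (StableConfig V) ℝ :=
  fun η ξ => ∑ x, (ν x).toReal * stabilizationProb K lam (η.toConfig.add x) ξ.toConfig

end Dynamics

/-! ### Finite Markov chains -/

section MarkovChains

variable {X : Type u} [Fintype X]

/-- `π` is a probability vector with `π M = π`. -/
def IsInvariantLaw (M : Matrix X X ℝ) (π : X → ℝ) : Prop :=
  (∀ a, 0 ≤ π a) ∧ ∑ a, π a = 1 ∧ Matrix.vecMul π M = π

/-- The separation distance at time `t`: the maximum of `1 - M^t(a, b) / π(b)`. -/
noncomputable def separationDistance [DecidableEq X] (M : Matrix X X ℝ) (π : X → ℝ) (t : ℕ) : ℝ :=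
  ⨆ p : X × X, (1 - (M ^ t) p.1 p.2 / π p.2)

variable {Ω : Type v} [mΩ : MeasurableSpace Ω]

/-- `ξ` is a Markov chain relative to the filtration `ℱ`, with transition matrix `M` and
starting point `a`. -/
structure IsMarkovChainFrom (P : Measure Ω) (ℱ : Filtration ℕ mΩ) (M : Matrix X X ℝ) (a : X)
    (ξ : ℕ → Ω → X) : Prop where
  start : ∀ᵐ ω ∂P, ξ 0 ω = a
  adapted : ∀ t b, MeasurableSet[ℱ t] {ω | ξ t ω = b}
  markov : ∀ t, ∀ A : Set Ω, MeasurableSet[ℱ t] A → ∀ b c,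
    P.real (A ∩ {ω | ξ t ω = b ∧ ξ (t + 1) ω = c}) = P.real (A ∩ {ω | ξ t ω = b}) * M b c

/-- `τ` is a strong stationary time for the process `ξ`, with stationary law `π`: an almost surely
finite stopping time such that `ξ τ` has law `π` and is independent of `τ`. -/
structure IsStrongStationaryTime (P : Measure Ω) (ℱ : Filtration ℕ mΩ) (π : X → ℝ)
    (ξ : ℕ → Ω → X) (τ : Ω → ℕ∞) : Prop where
  stopping : IsStoppingTime ℱ τ
  finite : ∀ᵐ ω ∂P, τ ω ≠ ⊤
  stationary : ∀ (t : ℕ) b,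
    P.real {ω | τ ω = t ∧ ξ t ω = b} = P.real {ω | τ ω = t} * π b

end MarkovChains

end ARW

/-!
The jump chain of the continuous-time dynamics is replaced by successive random topplings: at an
active site, with probability `lam / (1 + lam)` a sleep instruction is used, which has no effect
unless the particle is alone, and otherwise one particle makes a step of the killed walk. Topplings
at distinct active sites commute (`Config.topple_comm`), so the law `stab K lam η` of the stable
configuration that is reached does not depend on the order of the topplings
(`stabWithin_succ_of_active`). A Lyapunov function shows that the jump chain is absorbed almost
surely (`ae_eventually_stable`), and bounded functions that are harmonic for topplings are then
determined by their values at stable configurations. Hence `stab` is also the stabilization law of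
the continuous-time dynamics (`stabilizationProb_eq_stab`), and a particle may as well be added
before a stabilization as after it (`sum_stab_mul_stab_add`).

The bridge to IDLA is that a particle on top of an active one makes a step of the killed walk
(`stab_add_of_active`). If each site of `S` has received an additional active particle, a further
one may therefore first walk until it leaves `S` or dies, which is one step of IDLA. This gives an
intertwining of the two chains (`sum_stab_addSet_mul_transitionMatrix`), whence
`P ^ t (η, ξ) = ∑ S, ℙ(S_t = S) * stab (η.addSet S) ξ` (`transitionMatrix_pow_apply`). When IDLA
has filled `V`, the initial configuration is forgotten (`stab_addSet_univ`): the result has the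
law `π = stab (fullConfig V)`, which is invariant since a particle added to an everywhere active
configuration walks to its death. So `P ^ t (η, ξ) ≥ ℙ(T ≤ t) * π ξ`, which bounds the separation
distance by `ℙ(T > t)` and, as `T` is almost surely finite, shows that `π` is the only invariant
law. The bound is attained from the empty to the fully occupied configuration, which needs
as many particles as sites (`transitionMatrix_pow_empty_full`).

The same inequality allows one to stop the chain from `η` by external randomization at a time that
has the law of `T`, in such a way that the stopped chain is at `π` whatever the value of the time:
at time `t`, the chain is stopped at `x` with the conditional probability
`ℙ(T = t) * π x / (P ^ t (η, x) - ℙ(T < t) * π x)`. To make the walks' own filling time play the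
role of this time, the walks are sampled first, and then the path of the chain is drawn from its
conditional law given the value of the randomized stopping time (`StoppingData.jointLaw`).
-/

namespace ARW

/-! ### Laws of Markov chains -/

section MarkovChainLaw

variable {α : Type u} [MeasurableSpace α] [DiscreteMeasurableSpace α]
  (init : PMF α) (p : α → PMF α)

/-- The Markov kernel with transition probabilities `p`. -/
noncomputable def stepKernel : Kernel α α where
  toFun a := (p a).toMeasure
  measurable' := Measurable.of_discrete

instance : IsMarkovKernel (stepKernel p) :=
  ⟨fun a => inferInstanceAs (IsProbabilityMeasure (p a).toMeasure)⟩

theorem markovChainLaw_eq_trajMeasure :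
    markovChainLaw init p = Kernel.trajMeasure (X := fun _ => α) init.toMeasure
      (fun n => (stepKernel p).comap
        (fun x : (i : Finset.Iic n) → α => x ⟨n, Finset.mem_Iic.2 le_rfl⟩)
        (measurable_pi_apply _)) := rfl

instance isProbabilityMeasure_markovChainLaw : IsProbabilityMeasure (markovChainLaw init p) := by
  rw [markovChainLaw_eq_trajMeasure]
  infer_instance

theorem markovChainLaw_map_eval_zero :
    (markovChainLaw init p).map (fun X => X 0) = init.toMeasure := by
  have h : (fun X : ℕ → α => X 0) =
      (MeasurableEquiv.piUnique fun _ : Finset.Iic 0 => α) ∘ Preorder.frestrictLe 0 := by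
    funext X; rfl
  rw [h, ← Measure.map_map (by fun_prop) (by fun_prop)]
  rw [markovChainLaw_eq_trajMeasure, Kernel.trajMeasure]
  rw [Measure.map_comp _ _ (by fun_prop), Kernel.traj_map_frestrictLe, Kernel.partialTraj_self,
    Measure.id_comp, MeasurableEquiv.map_map_symm]

omit init p in
theorem measurable_comp_eval {β : Type*} [MeasurableSpace β] (g : α → β) (n : ℕ) :
    Measurable fun X : ℕ → α => g (X n) :=
  Measurable.of_discrete.comp (measurable_pi_apply n)

omit init p in
theorem measurableSet_eval_mem (A : Set α) (n : ℕ) : MeasurableSet {X : ℕ → α | X n ∈ A} :=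
  measurable_pi_apply n (MeasurableSet.of_discrete (s := A))

omit init p in
theorem measurableSet_eval_eq (a : α) (n : ℕ) : MeasurableSet {X : ℕ → α | X n = a} :=
  measurableSet_eval_mem {a} n

theorem lintegral_markovChainLaw_zero (g : α → ℝ≥0∞) :
    ∫⁻ X, g (X 0) ∂markovChainLaw init p = ∫⁻ a, g a ∂init.toMeasure := by
  rw [← markovChainLaw_map_eval_zero init p,
    lintegral_map Measurable.of_discrete (measurable_pi_apply 0)]

/-- The Markov property, tested against a function of the past and a function of the next state. -/
theorem lintegral_markovChainLaw_succ (n : ℕ) {F : (Finset.Iic n → α) → ℝ≥0∞} (hF : Measurable F)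
    (g : α → ℝ≥0∞) :
    ∫⁻ X, F (Preorder.frestrictLe n X) * g (X (n + 1)) ∂markovChainLaw init p =
      ∫⁻ X, F (Preorder.frestrictLe n X) * ∫⁻ b, g b ∂(p (X n)).toMeasure
        ∂markovChainLaw init p := by
  have hg : Measurable g := Measurable.of_discrete
  have hG : Measurable fun q : (Finset.Iic n → α) × α => F q.1 * g q.2 := by fun_prop
  have key : ∫⁻ X, F (Preorder.frestrictLe n X) * g (X (n + 1)) ∂markovChainLaw init p =
      ∫⁻ q, F q.1 * g q.2 ∂((markovChainLaw init p).map
        fun X => (Preorder.frestrictLe n X, X (n + 1))) := by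
    rw [lintegral_map hG (by fun_prop)]
  rw [key]
  rw [markovChainLaw_eq_trajMeasure, ← Kernel.map_frestrictLe_trajMeasure_compProd_eq_map_trajMeasure,
    Measure.lintegral_compProd hG, lintegral_map hG.lintegral_kernel_prod_right' (by fun_prop)]
  exact lintegral_congr fun X =>
    lintegral_const_mul (μ := (p (X n)).toMeasure) (F (Preorder.frestrictLe n X)) hg

/-- The Markov property at a single time. -/
theorem lintegral_markovChainLaw_eval_succ (n : ℕ) (g : α → ℝ≥0∞) :
    ∫⁻ X, g (X (n + 1)) ∂markovChainLaw init p =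
      ∫⁻ X, ∫⁻ b, g b ∂(p (X n)).toMeasure ∂markovChainLaw init p := by
  simpa using lintegral_markovChainLaw_succ init p n (F := fun _ => 1) measurable_const g

/-- A chain with a nonnegative Lyapunov function that decreases in mean by at least one on `A`
spends a finite mean time in `A`. -/
theorem ae_eventually_notMem_of_lyapunov (A : Set α) (g : α → ℝ≥0∞)
    (hg : ∀ a, ∫⁻ b, g b ∂(p a).toMeasure + A.indicator 1 a ≤ g a)
    (h0 : ∫⁻ a, g a ∂init.toMeasure ≠ ∞) :
    ∀ᵐ X ∂markovChainLaw init p, ∀ᶠ n in Filter.atTop, X n ∉ A := by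
  set μ := markovChainLaw init p
  have hmeas : ∀ n, MeasurableSet {X : ℕ → α | X n ∈ A} := measurableSet_eval_mem A
  have hstep : ∀ n, ∫⁻ X, g (X (n + 1)) ∂μ + μ {X | X n ∈ A} ≤ ∫⁻ X, g (X n) ∂μ := fun n => by
    have hm : Measurable fun X : ℕ → α => ∫⁻ b, g b ∂(p (X n)).toMeasure :=
      measurable_comp_eval (fun a => ∫⁻ b, g b ∂(p a).toMeasure) n
    rw [lintegral_markovChainLaw_eval_succ, ← lintegral_indicator_one (hmeas n),
      ← lintegral_add_left hm]
    exact lintegral_mono fun X => hg (X n)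
  have hsum : ∀ n, ∫⁻ X, g (X n) ∂μ + ∑ i ∈ Finset.range n, μ {X | X i ∈ A} ≤
      ∫⁻ a, g a ∂init.toMeasure := fun n => by
    induction n with
    | zero => simp [μ, lintegral_markovChainLaw_zero]
    | succ n ih =>
      rw [Finset.sum_range_succ_comm, ← add_assoc]
      exact (add_le_add_left (hstep n) _).trans ih
  have hfin : ∑' n, μ {X | X n ∈ A} ≠ ∞ := by
    refine ne_top_of_le_ne_top h0 (ENNReal.tsum_le_of_sum_range_le fun n => ?_)
    exact le_add_self.trans (hsum n)
  exact ae_eventually_notMem hfin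

end MarkovChainLaw

/-! ### Potential theory of the killed walk -/

namespace SubstochasticMatrix

variable {V : Type u} [Fintype V] (K : SubstochasticMatrix V)

theorem kill_nonneg (x : V) : 0 ≤ K.kill x := sub_nonneg.2 (K.sum_le_one x)

theorem sum_add_kill (x : V) : ∑ y, K.prob x y + K.kill x = 1 := by
  simp [kill]

variable {K}

/-- The maximum principle: a function that is subharmonic where it is positive is nonpositive. -/
theorem NonDegenerate.nonpos_of_subharmonic (hK : K.NonDegenerate) {f : V → ℝ}
    (hf : ∀ x, 0 < f x → f x ≤ ∑ y, K.prob x y * f y) (x : V) : f x ≤ 0 := by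
  by_contra hx
  push Not at hx
  obtain ⟨z, -, hz⟩ := Finset.exists_max_image Finset.univ f ⟨x, Finset.mem_univ x⟩
  have hpos : 0 < f z := hx.trans_le (hz x (Finset.mem_univ x))
  -- the walk cannot leave the set of maximizers, nor be killed there
  refine hK (Finset.univ.filter fun y => f y = f z) ⟨z, by simp⟩ fun a ha => ?_
  have ha : f a = f z := by simpa using ha
  have h1 : f z ≤ ∑ y, K.prob a y * f y := ha ▸ hf a (ha ▸ hpos)
  have h2 : ∀ y ∈ Finset.univ, 0 ≤ K.prob a y * (f z - f y) := fun y hy =>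
    mul_nonneg (K.nonneg a y) (sub_nonneg.2 (hz y hy))
  have h3 : ∑ y, K.prob a y * (f z - f y) = f z * ∑ y, K.prob a y - ∑ y, K.prob a y * f y := by
    simp only [mul_sub, Finset.sum_sub_distrib, ← Finset.sum_mul, mul_comm (f z)]
  have h4 : f z * ∑ y, K.prob a y ≤ f z := mul_le_of_le_one_right hpos.le (K.sum_le_one a)
  have h5 : ∑ y, K.prob a y * (f z - f y) = 0 :=
    le_antisymm (by linarith) (Finset.sum_nonneg h2)
  have h6 : ∑ y, K.prob a y = 1 := by
    refine mul_left_cancel₀ hpos.ne' ?_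
    linarith
  rw [Finset.sum_filter, ← h6]
  refine Finset.sum_congr rfl fun y hy => ?_
  split_ifs with h
  · rfl
  · have := (Finset.sum_eq_zero_iff_of_nonneg h2).1 h5 y hy
    exact ((mul_eq_zero.1 this).resolve_right (sub_ne_zero.2 (Ne.symm h))).symm

/-- Uniqueness for the Dirichlet problem with zero exterior values. -/
theorem NonDegenerate.eq_zero_of_harmonic (hK : K.NonDegenerate) {S : Finset V} {d : V → ℝ}
    (h0 : ∀ x ∉ S, d x = 0) (h : ∀ x ∈ S, d x = ∑ y, K.prob x y * d y) (x : V) : d x = 0 := by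
  refine abs_nonpos_iff.1 (hK.nonpos_of_subharmonic (f := fun x => |d x|) (fun x hx => ?_) x)
  have hx : x ∈ S := by
    by_contra hxS
    simp [h0 x hxS] at hx
  calc |d x| = |∑ y, K.prob x y * d y| := by rw [← h x hx]
    _ ≤ ∑ y, |K.prob x y * d y| := Finset.abs_sum_le_sum_abs _ _
    _ = ∑ y, K.prob x y * |d y| := by simp [abs_mul, abs_of_nonneg (K.nonneg _ _)]

/-- A nonnegative function bounded below by a multiple of its `K`-mean plus a reward for being
killed is positive, since the walk is killed eventually. -/
theorem NonDegenerate.pos_of_superharmonic (hK : K.NonDegenerate) {w : V → ℝ} {θ c : ℝ}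
    (hθ : 0 < θ) (hc : 0 < c) (h0 : ∀ x, 0 ≤ w x)
    (h : ∀ x, θ * (∑ y, K.prob x y * w y + K.kill x * c) ≤ w x) (x : V) : 0 < w x := by
  by_contra hx
  refine hK (Finset.univ.filter fun y => w y = 0) ⟨x, by simpa using (h0 x).antisymm' (not_lt.1 hx)⟩
    fun a ha => ?_
  have ha : w a = 0 := by simpa using ha
  have h2 : ∀ y ∈ Finset.univ, 0 ≤ K.prob a y * w y := fun y _ => mul_nonneg (K.nonneg a y) (h0 y)
  have h3 := Finset.sum_nonneg h2
  have h4 := mul_nonneg (K.kill_nonneg a) hc.le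
  have h5 : ∑ y, K.prob a y * w y + K.kill a * c ≤ 0 := by
    have := h a
    rw [ha] at this
    exact nonpos_of_mul_nonpos_right this hθ
  have h6 : K.kill a = 0 := (mul_eq_zero.1 (by linarith : K.kill a * c = 0)).resolve_right hc.ne'
  have h7 : ∑ y, K.prob a y = 1 := by have := K.sum_add_kill a; linarith
  rw [Finset.sum_filter, ← h7]
  refine Finset.sum_congr rfl fun y hy => ?_
  split_ifs with h
  · rfl
  · have := (Finset.sum_eq_zero_iff_of_nonneg h2).1 (by linarith) y hy
    exact ((mul_eq_zero.1 this).resolve_right h).symm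

/-- The mean lifetime of the walk, as a function of its starting point, is finite. -/
theorem NonDegenerate.exists_meanLifetime (hK : K.NonDegenerate) :
    ∃ g : V → ℝ, (∀ x, 0 ≤ g x) ∧ ∀ x, g x = 1 + ∑ y, K.prob x y * g y := by
  let L : (V → ℝ) →ₗ[ℝ] (V → ℝ) := LinearMap.id - Matrix.mulVecLin (Matrix.of K.prob)
  have hL : ∀ f x, L f x = f x - ∑ y, K.prob x y * f y := fun f x => rfl
  have hinj : Function.Injective L := by
    refine (injective_iff_map_eq_zero L).2 fun f hf => funext fun x => ?_
    refine hK.eq_zero_of_harmonic (S := Finset.univ) (by simp) (fun x _ => ?_) x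
    have := congrFun hf x
    rw [hL] at this
    exact sub_eq_zero.1 this
  obtain ⟨g, hg⟩ := LinearMap.injective_iff_surjective.1 hinj fun _ => 1
  have hg' : ∀ x, g x = 1 + ∑ y, K.prob x y * g y := fun x => by
    have := congrFun hg x
    rw [hL] at this
    linarith
  refine ⟨g, fun x => ?_, hg'⟩
  obtain ⟨z, -, hz⟩ := Finset.exists_min_image Finset.univ g ⟨x, Finset.mem_univ x⟩
  refine le_trans ?_ (hz x (Finset.mem_univ x))
  by_contra hneg
  push Not at hneg
  have h1 : g z * ∑ y, K.prob z y ≤ ∑ y, K.prob z y * g y := by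
    rw [mul_comm, Finset.sum_mul]
    exact Finset.sum_le_sum fun y hy => mul_le_mul_of_nonneg_left (hz y hy) (K.nonneg z y)
  have h2 := K.sum_le_one z
  have h3 := hg' z
  nlinarith

end SubstochasticMatrix

/-! ### Toppling a site -/

section Topple

variable {V : Type u}

/-- The effect of the instruction `a` on the site where it is used. -/
def SiteState.leave : Action V → SiteState → SiteState
  | .sleep, s => if s.numActive = 1 then .asleep else s
  | .jump _, s => s.depart
  | .die, s => s.depart

theorem SiteState.leave_arrive (a : Action V) {s : SiteState} (hs : 0 < s.numActive) :
    s.arrive.leave a = (s.leave a).arrive := by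
  rcases s with k | _
  · obtain ⟨k, rfl⟩ := Nat.exists_eq_succ_of_ne_zero hs.ne'
    cases a with
    | jump y => simp [leave, arrive, depart]
    | die => simp [leave, arrive, depart]
    | sleep =>
      rcases k <;> simp [leave, arrive, numActive]
  · simp [numActive] at hs

theorem SiteState.numActive_le_arrive (s : SiteState) : s.numActive ≤ s.arrive.numActive := by
  cases s <;> simp [arrive, numActive]

theorem SiteState.arrive_numActive_pos (s : SiteState) : 0 < s.arrive.numActive := by
  cases s <;> simp [arrive, numActive]

theorem StableConfig.toConfig_numActive (ζ : StableConfig V) (x : V) :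
    (ζ.toConfig x).numActive = 0 := by
  unfold StableConfig.toConfig
  split_ifs <;> rfl

theorem StableConfig.toConfig_injective :
    Function.Injective (StableConfig.toConfig (V := V)) := by
  intro ζ ζ' h
  funext x
  have := congrFun h x
  unfold StableConfig.toConfig at this
  split_ifs at this <;> simp_all

theorem Config.exists_eq_toConfig {η : Config V} (h : ∀ x, (η x).numActive = 0) :
    ∃ ζ : StableConfig V, η = ζ.toConfig := by
  classical
  refine ⟨fun x => decide (η x = .asleep), funext fun x => ?_⟩
  have hx := h x
  change η x = if decide (η x = .asleep) = true then _ else _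
  generalize η x = s at hx ⊢
  cases s with
  | active k =>
    have : k = 0 := hx
    simp [this]
  | asleep => simp

variable [DecidableEq V]

/-- The effect of the instruction `a`, used at another site, on the site `z`. -/
def SiteState.receive (z : V) : Action V → SiteState → SiteState
  | .jump y, s => if z = y then s.arrive else s
  | .die, s => s
  | .sleep, s => s

theorem SiteState.receive_comm (z : V) (a b : Action V) (s : SiteState) :
    (s.receive z a).receive z b = (s.receive z b).receive z a := by
  cases a <;> cases b <;> simp only [receive]
  split_ifs <;> rfl

theorem SiteState.leave_receive (z : V) (a b : Action V) {s : SiteState} (hs : 0 < s.numActive) :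
    (s.receive z b).leave a = (s.leave a).receive z b := by
  cases b <;> simp only [receive]
  split_ifs
  · exact leave_arrive a hs
  · rfl

theorem SiteState.numActive_le_receive (z : V) (a : Action V) (s : SiteState) :
    s.numActive ≤ (s.receive z a).numActive := by
  cases a <;> simp only [receive, le_refl]
  split_ifs
  · exact s.numActive_le_arrive
  · rfl

/-- Use the instruction `a` at the site `x`. A sleep instruction has no effect unless there is
exactly one active particle at `x`. -/
def Config.topple (η : Config V) (x : V) : Action V → Config V
  | .jump y => η.act x (.jump y)
  | .die => η.act x .die
  | .sleep => if (η x).numActive = 1 then η.act x .sleep else η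

theorem Config.update_apply (η : Config V) (x : V) (s : SiteState) (z : V) :
    Function.update (β := fun _ => SiteState) η x s z = if z = x then s else η z :=
  Function.update_apply (β := SiteState) η x s z

theorem Config.add_apply (η : Config V) (x z : V) :
    η.add x z = if z = x then (η z).arrive else η z := by
  rw [Config.add, update_apply]
  split_ifs with h
  · rw [h]
  · rfl

theorem Config.remove_apply (η : Config V) (x z : V) :
    η.remove x z = if z = x then (η z).depart else η z := by
  rw [Config.remove, update_apply]
  split_ifs with h
  · rw [h]
  · rfl

theorem Config.topple_apply (η : Config V) (x : V) (a : Action V) (z : V) :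
    η.topple x a z = (if z = x then (η z).leave a else η z).receive z a := by
  cases a with
  | jump y =>
    simp only [topple, act, add_apply, remove_apply, SiteState.leave, SiteState.receive]
  | die => simp only [topple, act, remove_apply, SiteState.leave, SiteState.receive]
  | sleep =>
    simp only [topple, act, SiteState.leave, SiteState.receive]
    by_cases hz : z = x
    · subst hz
      by_cases h : (η z).numActive = 1 <;> simp [h, update_apply]
    · by_cases h : (η x).numActive = 1 <;> simp [h, hz, update_apply]

/-- Topplings at distinct active sites commute. -/
theorem Config.topple_comm (η : Config V) {x y : V} (hxy : x ≠ y) (hx : 0 < (η x).numActive)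
    (hy : 0 < (η y).numActive) (a b : Action V) :
    (η.topple x a).topple y b = (η.topple y b).topple x a := by
  funext z
  simp only [topple_apply]
  by_cases hzx : z = x
  · subst hzx
    simp only [hxy, if_true, if_false]
    rw [SiteState.leave_receive _ _ _ hx, SiteState.receive_comm]
  · by_cases hzy : z = y
    · subst hzy
      simp only [hzx, if_true, if_false]
      rw [SiteState.leave_receive _ _ _ hy, SiteState.receive_comm]
    · simp only [hzx, hzy, if_false]
      rw [SiteState.receive_comm]

theorem Config.numActive_topple_pos (η : Config V) {x y : V} (hxy : x ≠ y)
    (hx : 0 < (η x).numActive) (b : Action V) : 0 < (η.topple y b x).numActive := by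
  rw [topple_apply, if_neg hxy]
  exact hx.trans_le (SiteState.numActive_le_receive _ _ _)

/-- Adding a particle commutes with toppling an active site. -/
theorem Config.add_topple (η : Config V) (x : V) {y : V} (hy : 0 < (η y).numActive)
    (a : Action V) : (η.add x).topple y a = (η.topple y a).add x := by
  funext z
  have hadd : ∀ s : SiteState, (if z = x then s.arrive else s) = s.receive z (.jump x) :=
    fun _ => rfl
  simp only [topple_apply, add_apply, hadd]
  by_cases hzy : z = y
  · subst hzy
    simp only [if_true]
    rw [SiteState.leave_receive _ _ _ hy, SiteState.receive_comm]
  · simp only [hzy, if_false]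
    rw [SiteState.receive_comm]

theorem Config.numActive_add_pos (η : Config V) (x : V) {y : V} (hy : 0 < (η y).numActive) :
    0 < (η.add x y).numActive := by
  rw [add_apply]
  split_ifs
  · exact SiteState.arrive_numActive_pos _
  · exact hy

theorem Config.numActive_add_self_pos (η : Config V) (x : V) : 0 < (η.add x x).numActive := by
  rw [add_apply, if_pos rfl]
  exact SiteState.arrive_numActive_pos _

/-- Removing a particle just added restores the configuration, unless it woke up another one. -/
theorem Config.remove_add_self (η : Config V) {x : V} (hx : η x ≠ .asleep) :
    (η.add x).remove x = η := by
  funext z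
  simp only [remove_apply, add_apply]
  split_ifs with h
  · subst h
    cases hs : η z with
    | active k => rfl
    | asleep => exact absurd hs hx
  · rfl

end Topple

/-! ### Stabilization by successive topplings -/

section Stabilization

variable {V : Type u} [Fintype V]

theorem sum_action {M : Type*} [AddCommMonoid M] (f : Action V → M) :
    ∑ a, f a = ∑ y, f (.jump y) + f .die + f .sleep := by
  rw [← (actionEquiv V).symm.sum_comp, Fintype.sum_option, Fintype.sum_option, add_comm,
    add_comm (f _)]
  rfl

/-- The law of the instruction used at `x`: asleep with probability `lam / (1 + lam)`, otherwise
one step of the killed walk. -/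
noncomputable def instrProb (K : SubstochasticMatrix V) (lam : ℝ) (x : V) : Action V → ℝ
  | .jump y => K.prob x y / (1 + lam)
  | .die => K.kill x / (1 + lam)
  | .sleep => lam / (1 + lam)

variable (K : SubstochasticMatrix V) {lam : ℝ}

theorem instrProb_nonneg (hlam : 0 < lam) (x : V) (a : Action V) : 0 ≤ instrProb K lam x a := by
  have h : 0 < 1 + lam := by linarith
  cases a with
  | jump y => exact div_nonneg (K.nonneg x y) h.le
  | die => exact div_nonneg (K.kill_nonneg x) h.le
  | sleep => exact div_nonneg hlam.le h.le

theorem sum_instrProb (hlam : 0 < lam) (x : V) : ∑ a, instrProb K lam x a = 1 := by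
  have h : 1 + lam ≠ 0 := by linarith
  rw [sum_action]
  simp only [instrProb]
  rw [← Finset.sum_div, ← add_div, ← add_div, K.sum_add_kill, div_self h]

variable [DecidableEq V]

variable (lam) in
/-- The mean of `φ` after one random instruction is used at the site `x` of `η`. -/
noncomputable def toppleMean (φ : Config V → ℝ) (η : Config V) (x : V) : ℝ :=
  ∑ a, instrProb K lam x a * φ (η.topple x a)

theorem one_add_mul_toppleMean (hlam : 0 < lam) (φ : Config V → ℝ) (η : Config V) (x : V) :
    (1 + lam) * toppleMean K lam φ η x =
      ∑ y, K.prob x y * φ (η.act x (.jump y)) + K.kill x * φ (η.act x .die) +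
        lam * φ (η.topple x .sleep) := by
  have h : 1 + lam ≠ 0 := by linarith
  rw [toppleMean, sum_action, mul_add, mul_add, Finset.mul_sum]
  simp only [instrProb, Config.topple]
  congr 1
  · congr 1
    · exact Finset.sum_congr rfl fun y _ => by field_simp
    · field_simp
  · field_simp

theorem toppleMean_mono (hlam : 0 < lam) {φ ψ : Config V → ℝ} (h : ∀ η, φ η ≤ ψ η)
    (η : Config V) (x : V) : toppleMean K lam φ η x ≤ toppleMean K lam ψ η x :=
  Finset.sum_le_sum fun a _ => mul_le_mul_of_nonneg_left (h _) (instrProb_nonneg K hlam x a)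

theorem toppleMean_const (hlam : 0 < lam) (c : ℝ) (η : Config V) (x : V) :
    toppleMean K lam (fun _ => c) η x = c := by
  rw [toppleMean, ← Finset.sum_mul, sum_instrProb K hlam, one_mul]

/-- Independent topplings at two distinct active sites may be made in either order. -/
theorem toppleMean_comm {φ φx φy : Config V → ℝ} {η : Config V} {x y : V} (hxy : x ≠ y)
    (hx : 0 < (η x).numActive) (hy : 0 < (η y).numActive)
    (h1 : ∀ a, φx (η.topple y a) = toppleMean K lam φ (η.topple y a) x)
    (h2 : ∀ a, φy (η.topple x a) = toppleMean K lam φ (η.topple x a) y) :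
    toppleMean K lam φx η y = toppleMean K lam φy η x := by
  rw [toppleMean, toppleMean]
  simp only [h1, h2, toppleMean, Finset.mul_sum]
  rw [Finset.sum_comm]
  refine Finset.sum_congr rfl fun a _ => Finset.sum_congr rfl fun b _ => ?_
  rw [Config.topple_comm η hxy hx hy]
  ring

open Classical in
variable (lam) in
/-- The probability that at most `n` successive topplings lead from a configuration to the stable
configuration `ξ`, when the sites to be toppled are chosen by `Exists.choose`. -/
noncomputable def stabWithin (ξ : StableConfig V) : ℕ → Config V → ℝ
  | 0, η => if η = ξ.toConfig then 1 else 0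
  | n + 1, η =>
    if h : ∃ x, 0 < (η x).numActive then toppleMean K lam (stabWithin ξ n) η h.choose
    else if η = ξ.toConfig then 1 else 0

variable {ξ : StableConfig V}

open Classical in
theorem stabWithin_of_stable {η : Config V} (h : ∀ x, (η x).numActive = 0) (n : ℕ) :
    stabWithin K lam ξ n η = if η = ξ.toConfig then 1 else 0 := by
  cases n with
  | zero => rfl
  | succ n =>
    have : ¬ ∃ x, 0 < (η x).numActive := fun ⟨x, hx⟩ => by simp [h x] at hx
    simp [stabWithin, this]

theorem stabWithin_zero_of_active {η : Config V} {x : V} (h : 0 < (η x).numActive) :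
    stabWithin K lam ξ 0 η = 0 := by
  refine if_neg fun hη => ?_
  rw [hη, StableConfig.toConfig_numActive] at h
  exact h.false

/-- The abelian property: the law of the number of topplings needed and of the result does not
depend on which active site is toppled first. -/
theorem stabWithin_succ_of_active (n : ℕ) {η : Config V} {x : V} (hx : 0 < (η x).numActive) :
    stabWithin K lam ξ (n + 1) η = toppleMean K lam (stabWithin K lam ξ n) η x := by
  have hex : ∃ x, 0 < (η x).numActive := ⟨x, hx⟩
  have hs : ∀ n, stabWithin K lam ξ (n + 1) η =
      toppleMean K lam (stabWithin K lam ξ n) η hex.choose := fun n => by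
    rw [stabWithin, dif_pos hex]
  rw [hs n]
  have hc := hex.choose_spec
  generalize hex.choose = s at hc
  clear hs hex
  by_cases hxs : x = s
  · rw [hxs]
  induction n generalizing η x s with
  | zero =>
    simp only [toppleMean]
    refine (Finset.sum_eq_zero fun a _ => ?_).trans (Finset.sum_eq_zero fun a _ => ?_).symm
    · rw [stabWithin_zero_of_active K (Config.numActive_topple_pos η hxs hx a), mul_zero]
    · rw [stabWithin_zero_of_active K (Config.numActive_topple_pos η (Ne.symm hxs) hc a), mul_zero]
  | succ n ih =>
    have step : ∀ {ζ : Config V} {z : V}, 0 < (ζ z).numActive →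
        stabWithin K lam ξ (n + 1) ζ = toppleMean K lam (stabWithin K lam ξ n) ζ z := by
      intro ζ z hz
      have hex : ∃ x, 0 < (ζ x).numActive := ⟨z, hz⟩
      have hs : stabWithin K lam ξ (n + 1) ζ =
          toppleMean K lam (stabWithin K lam ξ n) ζ hex.choose := by
        rw [stabWithin, dif_pos hex]
      rw [hs]
      by_cases hzs : z = hex.choose
      · rw [← hzs]
      · exact ih hz hex.choose hex.choose_spec hzs
    exact toppleMean_comm K hxs hx hc
      (fun a => step (Config.numActive_topple_pos η hxs hx a))
      (fun a => step (Config.numActive_topple_pos η (Ne.symm hxs) hc a))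

theorem stabWithin_nonneg (hlam : 0 < lam) (n : ℕ) (η : Config V) :
    0 ≤ stabWithin K lam ξ n η := by
  induction n generalizing η with
  | zero => unfold stabWithin; split_ifs <;> norm_num
  | succ n ih =>
    unfold stabWithin
    split_ifs with h
    · rw [← toppleMean_const K hlam 0 η h.choose]
      exact toppleMean_mono K hlam ih η _
    · norm_num
    · norm_num

theorem stabWithin_le_succ (hlam : 0 < lam) (n : ℕ) (η : Config V) :
    stabWithin K lam ξ n η ≤ stabWithin K lam ξ (n + 1) η := by
  induction n generalizing η with
  | zero =>
    by_cases h : ∃ x, 0 < (η x).numActive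
    · obtain ⟨x, hx⟩ := h
      rw [stabWithin_zero_of_active K hx]
      exact stabWithin_nonneg K hlam _ _
    · have h : ∀ x, (η x).numActive = 0 := by simpa using h
      rw [stabWithin_of_stable K h, stabWithin_of_stable K h]
  | succ n ih =>
    by_cases h : ∃ x, 0 < (η x).numActive
    · obtain ⟨x, hx⟩ := h
      rw [stabWithin_succ_of_active K n hx, stabWithin_succ_of_active K (n + 1) hx]
      exact toppleMean_mono K hlam ih η x
    · have h : ∀ x, (η x).numActive = 0 := by simpa using h
      rw [stabWithin_of_stable K h, stabWithin_of_stable K h]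

theorem sum_stabWithin_of_stable {η : Config V} (h : ∀ x, (η x).numActive = 0) (n : ℕ) :
    ∑ ξ, stabWithin K lam ξ n η = 1 := by
  classical
  obtain ⟨ζ, rfl⟩ := Config.exists_eq_toConfig h
  simp [stabWithin_of_stable K h, StableConfig.toConfig_injective.eq_iff]

theorem sum_stabWithin_le_one (hlam : 0 < lam) (n : ℕ) (η : Config V) :
    ∑ ξ, stabWithin K lam ξ n η ≤ 1 := by
  by_cases h : ∃ x, 0 < (η x).numActive
  swap
  · exact (sum_stabWithin_of_stable K (by simpa using h) n).le
  obtain ⟨x, hx⟩ := h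
  induction n generalizing η x with
  | zero => simp [stabWithin_zero_of_active K hx]
  | succ n ih =>
    simp only [stabWithin_succ_of_active K n hx, toppleMean]
    rw [Finset.sum_comm, ← sum_instrProb K hlam x]
    refine Finset.sum_le_sum fun a _ => ?_
    rw [← Finset.mul_sum]
    refine mul_le_of_le_one_right (instrProb_nonneg K hlam x a) ?_
    by_cases h : ∃ y, 0 < (η.topple x a y).numActive
    · obtain ⟨y, hy⟩ := h
      exact ih (η.topple x a) y hy
    · exact (sum_stabWithin_of_stable K (by simpa using h) n).le

theorem stabWithin_le_one (hlam : 0 < lam) (n : ℕ) (η : Config V) : stabWithin K lam ξ n η ≤ 1 :=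
  (Finset.single_le_sum (f := fun ξ => stabWithin K lam ξ n η)
    (fun _ _ => stabWithin_nonneg K hlam n η) (Finset.mem_univ ξ)).trans
    (sum_stabWithin_le_one K hlam n η)

variable (lam) in
/-- The probability that successive topplings lead from `η` to the stable configuration `ξ`. -/
noncomputable def stab (η : Config V) (ξ : StableConfig V) : ℝ :=
  ⨆ n, stabWithin K lam ξ n η

theorem bddAbove_stabWithin (hlam : 0 < lam) (η : Config V) :
    BddAbove (Set.range fun n => stabWithin K lam ξ n η) :=
  ⟨1, by rintro _ ⟨n, rfl⟩; exact stabWithin_le_one K hlam n η⟩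

theorem tendsto_stabWithin (hlam : 0 < lam) (η : Config V) (ξ : StableConfig V) :
    Filter.Tendsto (fun n => stabWithin K lam ξ n η) Filter.atTop (nhds (stab K lam η ξ)) :=
  tendsto_atTop_ciSup (monotone_nat_of_le_succ fun n => stabWithin_le_succ K hlam n η)
    (bddAbove_stabWithin K hlam η)

theorem stab_nonneg (hlam : 0 < lam) (η : Config V) (ξ : StableConfig V) : 0 ≤ stab K lam η ξ :=
  ge_of_tendsto' (tendsto_stabWithin K hlam η ξ) fun n => stabWithin_nonneg K hlam n η

theorem stab_le_one (hlam : 0 < lam) (η : Config V) (ξ : StableConfig V) : stab K lam η ξ ≤ 1 :=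
  le_of_tendsto' (tendsto_stabWithin K hlam η ξ) fun n => stabWithin_le_one K hlam n η

theorem stab_eq_toppleMean (hlam : 0 < lam) {η : Config V} {x : V} (hx : 0 < (η x).numActive)
    (ξ : StableConfig V) : stab K lam η ξ = toppleMean K lam (fun ζ => stab K lam ζ ξ) η x := by
  refine tendsto_nhds_unique ((tendsto_stabWithin K hlam η ξ).comp (Filter.tendsto_add_atTop_nat 1))
    ?_
  simp only [Function.comp_def, stabWithin_succ_of_active K _ hx, toppleMean]
  exact tendsto_finsetSum _ fun a _ => (tendsto_stabWithin K hlam _ ξ).const_mul _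

open Classical in
theorem stab_toConfig (hlam : 0 < lam) (ζ ξ : StableConfig V) :
    stab K lam ζ.toConfig ξ = if ζ = ξ then 1 else 0 := by
  refine tendsto_nhds_unique (tendsto_stabWithin K hlam _ ξ) ?_
  simp only [stabWithin_of_stable K ζ.toConfig_numActive, StableConfig.toConfig_injective.eq_iff]
  exact tendsto_const_nhds

theorem sum_stab_le_one (hlam : 0 < lam) (η : Config V) : ∑ ξ, stab K lam η ξ ≤ 1 :=
  le_of_tendsto' (tendsto_finsetSum _ fun ξ _ => tendsto_stabWithin K hlam η ξ)
    fun n => sum_stabWithin_le_one K hlam n η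

/-- The balance equation of `stab` at an active site, with the ineffective sleep instructions
still present. -/
theorem one_add_mul_stab (hlam : 0 < lam) {η : Config V} {x : V} (hx : 0 < (η x).numActive)
    (ξ : StableConfig V) :
    (1 + lam) * stab K lam η ξ =
      ∑ y, K.prob x y * stab K lam (η.act x (.jump y)) ξ + K.kill x * stab K lam (η.act x .die) ξ +
        lam * stab K lam (η.topple x .sleep) ξ := by
  rw [stab_eq_toppleMean K hlam hx, one_add_mul_toppleMean K hlam]

/-- At a site with several active particles, sleep instructions have no effect. -/
theorem stab_of_one_lt (hlam : 0 < lam) {η : Config V} {x : V} (hx : 1 < (η x).numActive)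
    (ξ : StableConfig V) :
    stab K lam η ξ =
      ∑ y, K.prob x y * stab K lam (η.act x (.jump y)) ξ + K.kill x * stab K lam (η.act x .die) ξ := by
  have h := one_add_mul_stab K hlam (zero_lt_one.trans hx) ξ
  have h2 : η.topple x .sleep = η := by simp [Config.topple, hx.ne']
  rw [h2] at h
  linarith

end Stabilization

/-! ### The jump chain of the continuous-time dynamics -/

section JumpChain

instance : Countable SiteState :=
  Function.Injective.countable (f := fun s : SiteState => match s with
    | .active k => some k
    | .asleep => none) (by
      rintro (k | _) (l | _) h <;> simp_all)

variable {V : Type u} [Fintype V]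

instance : Countable (Config V) := inferInstanceAs (Countable (V → SiteState))

variable (K : SubstochasticMatrix V) (lam : ℝ)

/-- `actionRate` as a real number. -/
noncomputable def realRate (η : Config V) (x : V) : Action V → ℝ
  | .jump y => (η x).numActive * K.prob x y
  | .die => (η x).numActive * K.kill x
  | .sleep => if (η x).numActive = 1 then lam else 0

variable {lam}

theorem realRate_nonneg (hlam : 0 < lam) (η : Config V) (x : V) (a : Action V) :
    0 ≤ realRate K lam η x a := by
  cases a with
  | jump y => exact mul_nonneg (Nat.cast_nonneg _) (K.nonneg x y)
  | die => exact mul_nonneg (Nat.cast_nonneg _) (K.kill_nonneg x)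
  | sleep =>
    unfold realRate
    split_ifs
    exacts [hlam.le, le_rfl]

theorem eventRate_eq_ofReal (η : Config V) (x : V) (a : Action V) :
    eventRate K lam η (x, a) = ENNReal.ofReal (realRate K lam η x a) := by
  cases a with
  | jump y =>
    simp only [eventRate, actionRate, realRate]
    rw [ENNReal.ofReal_mul (Nat.cast_nonneg _), ENNReal.ofReal_natCast]
  | die =>
    simp only [eventRate, actionRate, realRate]
    rw [ENNReal.ofReal_mul (Nat.cast_nonneg _), ENNReal.ofReal_natCast]
  | sleep =>
    simp only [eventRate, actionRate, realRate]
    split_ifs <;> simp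

theorem totalRate_eq_ofReal (hlam : 0 < lam) (η : Config V) :
    totalRate K lam η = ENNReal.ofReal (∑ x, ∑ a, realRate K lam η x a) := by
  rw [totalRate, Fintype.sum_prod_type, ENNReal.ofReal_sum_of_nonneg
    fun x _ => Finset.sum_nonneg fun a _ => realRate_nonneg K hlam η x a]
  refine Finset.sum_congr rfl fun x _ => ?_
  rw [ENNReal.ofReal_sum_of_nonneg fun a _ => realRate_nonneg K hlam η x a]
  exact Finset.sum_congr rfl fun a _ => eventRate_eq_ofReal K η x a

theorem sum_realRate (η : Config V) (x : V) :
    ∑ a, realRate K lam η x a =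
      (η x).numActive + if (η x).numActive = 1 then lam else 0 := by
  rw [sum_action]
  simp only [realRate]
  rw [← Finset.mul_sum, ← mul_add, K.sum_add_kill, mul_one]

theorem sum_realRate_pos (hlam : 0 < lam) {η : Config V} {x : V} (hx : 0 < (η x).numActive) :
    0 < ∑ x, ∑ a, realRate K lam η x a := by
  refine Finset.sum_pos' (fun x _ => Finset.sum_nonneg fun a _ => realRate_nonneg K hlam η x a)
    ⟨x, Finset.mem_univ x, ?_⟩
  rw [sum_realRate]
  have : (0 : ℝ) < (η x).numActive := by exact_mod_cast hx
  split_ifs <;> linarith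

theorem totalRate_eq_zero_iff (hlam : 0 < lam) {η : Config V} :
    totalRate K lam η = 0 ↔ ∀ x, (η x).numActive = 0 := by
  rw [totalRate_eq_ofReal K hlam, ENNReal.ofReal_eq_zero]
  constructor
  · intro h x
    by_contra hx
    exact (sum_realRate_pos K hlam (Nat.pos_of_ne_zero hx)).not_ge h
  · intro h
    refine (Finset.sum_eq_zero fun x _ => ?_).le
    rw [sum_realRate]
    simp [h x]

variable [DecidableEq V]

theorem jumpStep_of_stable (hlam : 0 < lam) {η : Config V} (h : ∀ x, (η x).numActive = 0) :
    jumpStep K lam η = PMF.pure η :=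
  dif_pos ((totalRate_eq_zero_iff K hlam).2 h)

theorem lintegral_jumpStep (hlam : 0 < lam) {η : Config V} {x : V} (hx : 0 < (η x).numActive)
    {f : Config V → ℝ} (hf : ∀ η, 0 ≤ f η) :
    ∫⁻ ζ, ENNReal.ofReal (f ζ) ∂(jumpStep K lam η).toMeasure =
      ENNReal.ofReal ((∑ x, ∑ a, realRate K lam η x a * f (η.act x a)) /
        ∑ x, ∑ a, realRate K lam η x a) := by
  have hpos := sum_realRate_pos K hlam hx
  have h0 : ¬ totalRate K lam η = 0 := by
    rw [totalRate_eq_zero_iff K hlam]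
    exact fun h => hx.ne' (h x)
  let _ : MeasurableSpace (V × Action V) := ⊤
  rw [jumpStep, dif_neg h0, ← PMF.toMeasure_map _ _ Measurable.of_discrete,
    lintegral_map Measurable.of_discrete Measurable.of_discrete, lintegral_fintype,
    ENNReal.ofReal_div_of_pos hpos, ← totalRate_eq_ofReal K hlam, div_eq_mul_inv,
    ENNReal.ofReal_sum_of_nonneg fun x _ => Finset.sum_nonneg fun a _ =>
      mul_nonneg (realRate_nonneg K hlam η x a) (hf _),
    Finset.sum_mul, Fintype.sum_prod_type]
  refine Finset.sum_congr rfl fun x _ => ?_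
  rw [ENNReal.ofReal_sum_of_nonneg fun a _ =>
      mul_nonneg (realRate_nonneg K hlam η x a) (hf _), Finset.sum_mul]
  refine Finset.sum_congr rfl fun a _ => ?_
  rw [PMF.toMeasure_apply_singleton _ _ MeasurableSet.of_discrete, PMF.normalize_apply,
    tsum_fintype, eventRate_eq_ofReal, ENNReal.ofReal_mul (realRate_nonneg K hlam η x a)]
  change _ * (_ * (totalRate K lam η)⁻¹) = _
  ring

/-- The function `φ` agrees with its mean after one toppling of any active site. -/
def IsToppleHarmonic (K : SubstochasticMatrix V) (lam : ℝ) (φ : Config V → ℝ) : Prop :=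
  ∀ η x, 0 < (η x).numActive → φ η = toppleMean K lam φ η x

variable {K}

/-- The rates of the events at `x` are proportional to the probabilities of the effective
instructions at `x`. -/
theorem IsToppleHarmonic.sum_realRate_mul {φ : Config V → ℝ} (hφ : IsToppleHarmonic K lam φ)
    (hlam : 0 < lam) (η : Config V) (x : V) :
    ∑ a, realRate K lam η x a * φ (η.act x a) = (∑ a, realRate K lam η x a) * φ η := by
  rw [sum_realRate, sum_action]
  simp only [realRate]
  rcases Nat.eq_zero_or_pos (η x).numActive with hx | hx
  · simp [hx]
  have h := one_add_mul_toppleMean K hlam φ η x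
  rw [← hφ η x hx, Config.topple] at h
  simp only [mul_assoc]
  rw [← Finset.mul_sum, ← mul_add]
  split_ifs at h ⊢ with h1
  · rw [h1]
    push_cast
    linarith
  · have h2 : φ η = ∑ y, K.prob x y * φ (η.act x (.jump y)) + K.kill x * φ (η.act x .die) := by
      linarith
    rw [← h2]
    ring

theorem IsToppleHarmonic.lintegral_jumpStep {φ : Config V → ℝ} (hφ : IsToppleHarmonic K lam φ)
    (hlam : 0 < lam) (h0 : ∀ η, 0 ≤ φ η) (η : Config V) :
    ∫⁻ ζ, ENNReal.ofReal (φ ζ) ∂(jumpStep K lam η).toMeasure = ENNReal.ofReal (φ η) := by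
  by_cases h : ∃ x, 0 < (η x).numActive
  · obtain ⟨x, hx⟩ := h
    rw [ARW.lintegral_jumpStep K hlam hx h0]
    simp only [hφ.sum_realRate_mul hlam]
    rw [← Finset.sum_mul, mul_div_cancel_left₀ _ (sum_realRate_pos K hlam hx).ne']
  · rw [jumpStep_of_stable K hlam (by simpa using h), PMF.toMeasure_pure, lintegral_dirac]

/-! ### Almost sure stabilization -/

/-- The number of particles at a site. -/
def SiteState.count : SiteState → ℕ
  | active k => k
  | asleep => 1

theorem sum_update {M : Type*} [AddCommGroup M] (h : V → SiteState → M) (η : Config V) (x : V)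
    (s : SiteState) :
    ∑ z, h z (Function.update (β := fun _ => SiteState) η x s z) =
      ∑ z, h z (η z) - h x (η x) + h x s := by
  rw [← Finset.add_sum_erase _ _ (Finset.mem_univ x),
    ← Finset.add_sum_erase _ (fun z => h z (η z)) (Finset.mem_univ x)]
  have : ∑ z ∈ Finset.univ.erase x,
      h z (Function.update (β := fun _ => SiteState) η x s z) =
      ∑ z ∈ Finset.univ.erase x, h z (η z) := by
    refine Finset.sum_congr rfl fun z hz => ?_
    rw [Config.update_apply, if_neg (Finset.ne_of_mem_erase hz)]
  rw [this, Config.update_apply, if_pos rfl]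
  abel

/-- The Lyapunov function: twice the mean remaining number of steps of all particles, were they
never to sleep, plus the number of active particles. A jump may wake up at most one particle. -/
noncomputable def potential (g : V → ℝ) (η : Config V) : ℝ :=
  ∑ x, (2 * g x * (η x).count + (η x).numActive)

variable {g : V → ℝ}

omit [DecidableEq V] in
theorem potential_nonneg (hg : ∀ x, 0 ≤ g x) (η : Config V) : 0 ≤ potential g η :=
  Finset.sum_nonneg fun x _ => add_nonneg
    (mul_nonneg (mul_nonneg zero_le_two (hg x)) (Nat.cast_nonneg _)) (Nat.cast_nonneg _)

theorem potential_add_le (g : V → ℝ) (η : Config V) (x : V) :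
    potential g (η.add x) ≤ potential g η + 2 * g x + 2 := by
  unfold potential Config.add
  rw [sum_update fun z s => 2 * g z * (s.count : ℝ) + (s.numActive : ℝ)]
  cases η x <;> simp only [SiteState.arrive, SiteState.count, SiteState.numActive] <;>
    push_cast <;> linarith

theorem potential_remove (g : V → ℝ) {η : Config V} {x : V} (hx : 0 < (η x).numActive) :
    potential g (η.remove x) = potential g η - 2 * g x - 1 := by
  unfold potential Config.remove
  rw [sum_update fun z s => 2 * g z * (s.count : ℝ) + (s.numActive : ℝ)]
  generalize η x = s at hx ⊢
  rcases s with k | _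
  · obtain ⟨k, rfl⟩ := Nat.exists_eq_succ_of_ne_zero hx.ne'
    simp only [SiteState.depart, SiteState.count, SiteState.numActive, Nat.succ_sub_one]
    push_cast
    ring
  · simp [SiteState.numActive] at hx

theorem potential_sleep (g : V → ℝ) {η : Config V} {x : V} (hx : (η x).numActive = 1) :
    potential g (η.act x .sleep) = potential g η - 1 := by
  unfold potential Config.act
  rw [sum_update fun z s => 2 * g z * (s.count : ℝ) + (s.numActive : ℝ)]
  generalize η x = s at hx ⊢
  rcases s with k | _
  · have : k = 1 := hx
    simp [SiteState.count, SiteState.numActive, this]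
    ring
  · simp [SiteState.numActive] at hx

theorem sum_realRate_mul_potential_le
    (hg : ∀ x, g x = 1 + ∑ y, K.prob x y * g y) (η : Config V) (x : V) :
    ∑ a, realRate K lam η x a * potential g (η.act x a) ≤
      (∑ a, realRate K lam η x a) * (potential g η - 1) := by
  rw [sum_realRate, sum_action]
  simp only [realRate]
  rcases Nat.eq_zero_or_pos (η x).numActive with hx | hx
  · simp [hx]
  simp only [mul_assoc]
  rw [← Finset.mul_sum, ← mul_add, add_mul]
  refine add_le_add (mul_le_mul_of_nonneg_left ?_ (Nat.cast_nonneg _)) ?_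
  · have hdie : potential g (η.act x .die) ≤ potential g η - 2 * g x + 1 := by
      rw [Config.act, potential_remove g hx]
      linarith
    have hjump : ∀ y, potential g (η.act x (.jump y)) ≤
        (potential g η - 2 * g x + 1) + 2 * g y := fun y => by
      have := potential_add_le g (η.remove x) y
      rw [potential_remove g hx] at this
      rw [Config.act]
      linarith
    calc ∑ y, K.prob x y * potential g (η.act x (.jump y)) +
          K.kill x * potential g (η.act x .die)
        ≤ ∑ y, K.prob x y * ((potential g η - 2 * g x + 1) + 2 * g y) +
          K.kill x * (potential g η - 2 * g x + 1) :=
          add_le_add (Finset.sum_le_sum fun y _ =>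
            mul_le_mul_of_nonneg_left (hjump y) (K.nonneg x y))
            (mul_le_mul_of_nonneg_left hdie (K.kill_nonneg x))
      _ = (∑ y, K.prob x y + K.kill x) * (potential g η - 2 * g x + 1) +
          2 * ∑ y, K.prob x y * g y := by
          simp only [mul_add, Finset.sum_add_distrib, add_mul, Finset.sum_mul, Finset.mul_sum,
            mul_left_comm (2 : ℝ)]
          ring
      _ = potential g η - 1 := by
          rw [K.sum_add_kill]
          linarith [hg x]
  · split_ifs with h1
    · rw [potential_sleep g h1]
    · simp

/-- The jump chain almost surely reaches a configuration without active particles. -/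
theorem ae_eventually_stable (hK : K.NonDegenerate) (hlam : 0 < lam) (η : Config V) :
    ∀ᵐ X ∂markovChainLaw (PMF.pure η) (jumpStep K lam),
      ∀ᶠ n in Filter.atTop, ∀ x, (X n x).numActive = 0 := by
  obtain ⟨g, hg0, hg⟩ := hK.exists_meanLifetime
  have key := ae_eventually_notMem_of_lyapunov (PMF.pure η) (jumpStep K lam)
    {ζ | ∃ x, 0 < (ζ x).numActive} (fun ζ => ENNReal.ofReal (potential g ζ)) (fun ζ => ?_) ?_
  · simpa using key
  · have h0 := potential_nonneg hg0
    by_cases h : ∃ x, 0 < (ζ x).numActive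
    · have hmem : ζ ∈ {ζ : Config V | ∃ x, 0 < (ζ x).numActive} := h
      rw [Set.indicator_of_mem hmem]
      obtain ⟨x, hx⟩ := h
      have hR := sum_realRate_pos K hlam hx
      rw [lintegral_jumpStep K hlam hx h0, Pi.one_apply, ← ENNReal.ofReal_one,
        ← ENNReal.ofReal_add (div_nonneg (Finset.sum_nonneg fun x _ => Finset.sum_nonneg fun a _ =>
          mul_nonneg (realRate_nonneg K hlam ζ x a) (h0 _)) hR.le) zero_le_one]
      refine ENNReal.ofReal_le_ofReal ?_
      rw [← le_sub_iff_add_le, div_le_iff₀ hR, mul_comm, Finset.sum_mul]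
      exact Finset.sum_le_sum fun x _ => sum_realRate_mul_potential_le hg ζ x
    · have hmem : ζ ∉ {ζ : Config V | ∃ x, 0 < (ζ x).numActive} := h
      rw [Set.indicator_of_notMem hmem, jumpStep_of_stable K hlam (by simpa using h),
        PMF.toMeasure_pure, lintegral_dirac, add_zero]
  · rw [PMF.toMeasure_pure, lintegral_dirac]
    exact ENNReal.ofReal_ne_top

/-- Stable configurations are absorbing for the jump chain. -/
theorem ae_stable_absorbing (hlam : 0 < lam) (η : Config V) :
    ∀ᵐ X ∂markovChainLaw (PMF.pure η) (jumpStep K lam),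
      ∀ n, (∀ x, (X n x).numActive = 0) → X (n + 1) = X n := by
  set μ := markovChainLaw (PMF.pure η) (jumpStep K lam)
  refine ae_all_iff.2 fun n => ?_
  have key : ∀ ζ : StableConfig V, ∀ᵐ X ∂μ, X n = ζ.toConfig → X (n + 1) = ζ.toConfig := fun ζ => by
    classical
    let F : (Finset.Iic n → Config V) → ℝ≥0∞ := fun x =>
      ({ζ.toConfig} : Set (Config V)).indicator 1 (x ⟨n, Finset.mem_Iic.2 le_rfl⟩)
    have hF : Measurable F :=
      Measurable.comp (g := ({ζ.toConfig} : Set (Config V)).indicator 1) Measurable.of_discrete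
        (measurable_pi_apply _)
    have h := lintegral_markovChainLaw_succ (PMF.pure η) (jumpStep K lam) n hF
      (({ζ.toConfig}ᶜ : Set (Config V)).indicator 1)
    have h0 : ∫⁻ X, F (Preorder.frestrictLe n X) *
        ∫⁻ b, ({ζ.toConfig}ᶜ : Set (Config V)).indicator 1 b ∂(jumpStep K lam (X n)).toMeasure ∂μ
          = 0 := by
      rw [← lintegral_zero (μ := μ)]
      refine lintegral_congr fun X => ?_
      by_cases hX : X n = ζ.toConfig
      · rw [hX, jumpStep_of_stable K hlam ζ.toConfig_numActive, PMF.toMeasure_pure,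
          lintegral_dirac]
        simp
      · have : F (Preorder.frestrictLe n X) = 0 :=
          Set.indicator_of_notMem (s := {ζ.toConfig}) (a := X n) hX _
        rw [this, zero_mul]
    have hG : Measurable fun X : ℕ → Config V => F (Preorder.frestrictLe n X) *
        ({ζ.toConfig}ᶜ : Set (Config V)).indicator (1 : Config V → ℝ≥0∞) (X (n + 1)) :=
      (hF.comp (by fun_prop)).mul (measurable_comp_eval _ (n + 1))
    rw [h0, lintegral_eq_zero_iff hG] at h
    filter_upwards [h] with X hX hXn
    by_contra hne
    have h1 : F (Preorder.frestrictLe n X) = 1 :=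
      Set.indicator_of_mem (s := {ζ.toConfig}) (a := X n) hXn _
    have h2 : ({ζ.toConfig}ᶜ : Set (Config V)).indicator (1 : Config V → ℝ≥0∞) (X (n + 1)) = 1 :=
      Set.indicator_of_mem (s := {ζ.toConfig}ᶜ) (a := X (n + 1)) hne _
    simp [h1, h2] at hX
  filter_upwards [ae_all_iff.2 key] with X hX hstab
  obtain ⟨ζ, hζ⟩ := Config.exists_eq_toConfig hstab
  rw [hX ζ hζ, hζ]

/-- The jump chain is almost surely eventually constant, with a stable value. -/
theorem ae_eventually_eq_toConfig (hK : K.NonDegenerate) (hlam : 0 < lam) (η : Config V) :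
    ∀ᵐ X ∂markovChainLaw (PMF.pure η) (jumpStep K lam),
      ∃ ζ : StableConfig V, ∀ᶠ n in Filter.atTop, X n = ζ.toConfig := by
  filter_upwards [ae_eventually_stable hK hlam η, ae_stable_absorbing hlam η] with X h1 h2
  obtain ⟨N, hN⟩ := Filter.eventually_atTop.1 h1
  obtain ⟨ζ, hζ⟩ := Config.exists_eq_toConfig (hN N le_rfl)
  refine ⟨ζ, Filter.eventually_atTop.2 ⟨N, fun n hn => ?_⟩⟩
  induction n, hn using Nat.le_induction with
  | base => exact hζ
  | succ n hn ih => rw [h2 n (hN n hn), ih]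

/-- A bounded harmonic function is the mean of its eventual value along the jump chain. -/
theorem IsToppleHarmonic.lintegral_eventual {φ : Config V → ℝ} (hφ : IsToppleHarmonic K lam φ)
    (hlam : 0 < lam) (h0 : ∀ η, 0 ≤ φ η) (h1 : ∀ η, φ η ≤ 1) (η : Config V)
    {L : (ℕ → Config V) → ℝ≥0∞}
    (hL : ∀ᵐ X ∂markovChainLaw (PMF.pure η) (jumpStep K lam),
      ∀ᶠ n in Filter.atTop, ENNReal.ofReal (φ (X n)) = L X) :
    ∫⁻ X, L X ∂markovChainLaw (PMF.pure η) (jumpStep K lam) = ENNReal.ofReal (φ η) := by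
  set μ := markovChainLaw (PMF.pure η) (jumpStep K lam)
  have hconst : ∀ n, ∫⁻ X, ENNReal.ofReal (φ (X n)) ∂μ = ENNReal.ofReal (φ η) := fun n => by
    induction n with
    | zero =>
      rw [lintegral_markovChainLaw_zero _ _ fun ζ => ENNReal.ofReal (φ ζ), PMF.toMeasure_pure,
        lintegral_dirac]
    | succ n ih =>
      rw [lintegral_markovChainLaw_eval_succ _ _ n fun ζ => ENNReal.ofReal (φ ζ)]
      simp only [hφ.lintegral_jumpStep hlam h0]
      exact ih
  have hlim := tendsto_lintegral_of_dominated_convergence (μ := μ)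
    (F := fun n X => ENNReal.ofReal (φ (X n))) (f := L) (fun _ => 1)
    (fun n => measurable_comp_eval (fun ζ => ENNReal.ofReal (φ ζ)) n)
    (fun n => Filter.Eventually.of_forall fun X => ENNReal.ofReal_le_one.2 (h1 _)) (by simp)
    (hL.mono fun X hX => tendsto_const_nhds.congr' (hX.mono fun n hn => hn.symm))
  simp only [hconst] at hlim
  exact tendsto_nhds_unique hlim tendsto_const_nhds

/-- Bounded harmonic functions are determined by their values at stable configurations. -/
theorem IsToppleHarmonic.eq_of_eq_on_stable {φ ψ : Config V → ℝ} (hφ : IsToppleHarmonic K lam φ)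
    (hψ : IsToppleHarmonic K lam ψ) (hK : K.NonDegenerate) (hlam : 0 < lam)
    (hφ0 : ∀ η, 0 ≤ φ η) (hφ1 : ∀ η, φ η ≤ 1) (hψ0 : ∀ η, 0 ≤ ψ η) (hψ1 : ∀ η, ψ η ≤ 1)
    (h : ∀ ζ : StableConfig V, φ ζ.toConfig = ψ ζ.toConfig) (η : Config V) : φ η = ψ η := by
  have hlim : ∀ f : Config V → ℝ, ∀ᵐ X ∂markovChainLaw (PMF.pure η) (jumpStep K lam),
      ∀ᶠ n in Filter.atTop, ENNReal.ofReal (f (X n)) =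
        Filter.limsup (fun m => ENNReal.ofReal (f (X m))) Filter.atTop := fun f => by
    filter_upwards [ae_eventually_eq_toConfig hK hlam η] with X ⟨ζ, hζ⟩
    have : Filter.limsup (fun m => ENNReal.ofReal (f (X m))) Filter.atTop =
        ENNReal.ofReal (f ζ.toConfig) := by
      rw [Filter.limsup_congr (hζ.mono fun n hn => by rw [hn]), Filter.limsup_const]
    exact hζ.mono fun n hn => by rw [hn, this]
  have hφη := hφ.lintegral_eventual hlam hφ0 hφ1 η (hlim φ)
  refine (ENNReal.ofReal_eq_ofReal_iff (hφ0 η) (hψ0 η)).1 (hφη.symm.trans ?_)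
  refine hψ.lintegral_eventual hlam hψ0 hψ1 η ?_
  filter_upwards [ae_eventually_eq_toConfig hK hlam η, hlim φ] with X ⟨ζ, hζ⟩ h1
  filter_upwards [hζ, h1] with n hn h1n
  rw [← h1n, hn, h]

theorem isToppleHarmonic_stab (hlam : 0 < lam) (ξ : StableConfig V) :
    IsToppleHarmonic K lam fun η => stab K lam η ξ :=
  fun _ _ hx => stab_eq_toppleMean K hlam hx ξ

theorem isToppleHarmonic_sum_stab_mul (hlam : 0 < lam) (c : StableConfig V → ℝ) :
    IsToppleHarmonic K lam fun η => ∑ ξ, stab K lam η ξ * c ξ := by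
  intro η x hx
  simp only [toppleMean, Finset.mul_sum]
  rw [Finset.sum_comm]
  refine Finset.sum_congr rfl fun ξ _ => ?_
  rw [stab_eq_toppleMean K hlam hx, toppleMean, Finset.sum_mul]
  simp only [mul_assoc]

/-- A bounded harmonic function is the mean of its value at the stabilized configuration. -/
theorem IsToppleHarmonic.sum_stab_mul {φ : Config V → ℝ} (hφ : IsToppleHarmonic K lam φ)
    (hK : K.NonDegenerate) (hlam : 0 < lam) (h0 : ∀ η, 0 ≤ φ η) (h1 : ∀ η, φ η ≤ 1)
    (η : Config V) : ∑ ξ, stab K lam η ξ * φ ξ.toConfig = φ η := by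
  refine (isToppleHarmonic_sum_stab_mul hlam _).eq_of_eq_on_stable hφ hK hlam
    (fun η => Finset.sum_nonneg fun ξ _ => mul_nonneg (stab_nonneg K hlam η ξ) (h0 _))
    (fun η => ?_) h0 h1 (fun ζ => ?_) η
  · refine (Finset.sum_le_sum fun ξ _ => ?_).trans (sum_stab_le_one K hlam η)
    exact mul_le_of_le_one_right (stab_nonneg K hlam η ξ) (h1 _)
  · simp [stab_toConfig K hlam]

theorem sum_stab (hK : K.NonDegenerate) (hlam : 0 < lam) (η : Config V) :
    ∑ ξ, stab K lam η ξ = 1 := by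
  simpa using IsToppleHarmonic.sum_stab_mul (K := K) (φ := fun _ => 1)
    (fun η x _ => (toppleMean_const K hlam 1 η x).symm) hK hlam (fun _ => zero_le_one)
    (fun _ => le_rfl) η

/-- Stabilizing, adding a particle and stabilizing again has the same effect as adding the
particle first. -/
theorem sum_stab_mul_stab_add (hK : K.NonDegenerate) (hlam : 0 < lam) (η : Config V) (x : V)
    (ξ : StableConfig V) :
    ∑ ζ, stab K lam η ζ * stab K lam (ζ.toConfig.add x) ξ = stab K lam (η.add x) ξ := by
  refine IsToppleHarmonic.sum_stab_mul (φ := fun η => stab K lam (η.add x) ξ) (fun η y hy => ?_)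
    hK hlam (fun η => stab_nonneg K hlam _ ξ) (fun η => stab_le_one K hlam _ ξ) η
  refine (stab_eq_toppleMean K hlam (η.numActive_add_pos x hy) ξ).trans ?_
  simp only [toppleMean, η.add_topple x hy]

/-- The probability that the jump chain is absorbed in `ξ`. -/
theorem markovChainLaw_absorbed (hK : K.NonDegenerate) (hlam : 0 < lam) (η : Config V)
    (ξ : StableConfig V) :
    markovChainLaw (PMF.pure η) (jumpStep K lam) {X | ∀ᶠ n in Filter.atTop, X n = ξ.toConfig} =
      ENNReal.ofReal (stab K lam η ξ) := by
  classical
  have hmeas : MeasurableSet {X : ℕ → Config V | ∀ᶠ n in Filter.atTop, X n = ξ.toConfig} := by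
    simp only [Filter.eventually_atTop, Set.ofPred_exists, Set.ofPred_forall]
    refine MeasurableSet.iUnion fun N => MeasurableSet.iInter fun n => MeasurableSet.iInter fun _ =>
      measurableSet_eval_eq _ n
  rw [← lintegral_indicator_one hmeas]
  refine (isToppleHarmonic_stab hlam ξ).lintegral_eventual hlam (fun η => stab_nonneg K hlam η ξ)
    (fun η => stab_le_one K hlam η ξ) η ?_
  filter_upwards [ae_eventually_eq_toConfig hK hlam η] with X ⟨ζ, hζ⟩
  have hiff : (∀ᶠ n in Filter.atTop, X n = ξ.toConfig) ↔ ζ = ξ := by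
    constructor
    · intro h
      obtain ⟨n, h1, h2⟩ := (hζ.and h).exists
      exact StableConfig.toConfig_injective (h1.symm.trans h2)
    · rintro rfl
      exact hζ
  refine hζ.mono fun n hn => ?_
  simp only [hn, stab_toConfig K hlam, Set.indicator_apply, Set.mem_ofPred_eq, hiff]
  split_ifs <;> simp

end JumpChain

/-! ### Stabilization in continuous time -/

section ContinuousTime

theorem ae_expMeasure_pos : ∀ᵐ x ∂expMeasure 1, 0 < x := by
  have h : expMeasure 1 (Set.Iic 0) = 0 := by
    have h1 : expMeasure 1 = volume.withDensity (exponentialPDF 1) := rfl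
    rw [h1, withDensity_apply _ measurableSet_Iic, setLIntegral_congr Iio_ae_eq_Iic.symm]
    exact lintegral_exponentialPDF_of_nonpos le_rfl
  rw [ae_iff]
  simpa [Set.Iic_def] using h

variable {V : Type u} [Fintype V] [DecidableEq V] {K : SubstochasticMatrix V} {lam : ℝ}

omit [DecidableEq V] in
theorem eventTime_mono (ω : (ℕ → Config V) × (ℕ → ℝ)) : Monotone (eventTime K lam ω) :=
  monotone_nat_of_le_succ fun n => by
    rw [eventTime, eventTime, Finset.sum_range_succ]
    exact le_self_add

omit [DecidableEq V] in
theorem StateAt.unique {ω : (ℕ → Config V) × (ℕ → ℝ)} {s : ℝ≥0} {ξ ζ : Config V}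
    (h1 : StateAt K lam ω s ξ) (h2 : StateAt K lam ω s ζ) : ξ = ζ := by
  obtain ⟨n, hn1, hn2, rfl⟩ := h1
  obtain ⟨m, hm1, hm2, rfl⟩ := h2
  rcases lt_trichotomy n m with h | h | h
  · exact absurd (hn2.trans_le ((eventTime_mono ω h).trans hm1)) (lt_irrefl _)
  · rw [h]
  · exact absurd (hm2.trans_le ((eventTime_mono ω h).trans hn1)) (lt_irrefl _)

omit [DecidableEq V] in
/-- If the jump chain is absorbed in `ζ`, then the continuous-time process is in `ζ` from some
finite time on: the clock runs at positive rate before the absorption and stops afterwards. -/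
theorem exists_forall_stateAt (hlam : 0 < lam) {ω : (ℕ → Config V) × (ℕ → ℝ)}
    (hω : ∀ i, 0 < ω.2 i) {ζ : StableConfig V}
    (hζ : ∀ᶠ n in Filter.atTop, ω.1 n = ζ.toConfig)
    (habs : ∀ n, (∀ x, (ω.1 n x).numActive = 0) → ω.1 (n + 1) = ω.1 n) :
    ∃ s₀ : ℝ≥0, ∀ s ≥ s₀, StateAt K lam ω s ζ.toConfig := by
  classical
  have hex : ∃ n, ∀ x, (ω.1 n x).numActive = 0 := by
    obtain ⟨n, hn⟩ := hζ.exists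
    exact ⟨n, fun x => by rw [hn, StableConfig.toConfig_numActive]⟩
  -- the time of absorption
  set N := Nat.find hex
  have hN : ∀ x, (ω.1 N x).numActive = 0 := Nat.find_spec hex
  have hconst : ∀ n ≥ N, ω.1 n = ω.1 N := fun n hn => by
    induction n, hn using Nat.le_induction with
    | base => rfl
    | succ n hn ih => rw [habs n (by rw [ih]; exact hN), ih]
  have hNζ : ω.1 N = ζ.toConfig := by
    obtain ⟨n, h1, h2⟩ := (hζ.and (Filter.eventually_ge_atTop N)).exists
    rw [← hconst n h2, h1]
  have hfin : eventTime K lam ω N ≠ ∞ := by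
    refine ENNReal.sum_ne_top.2 fun i hi => ?_
    refine ENNReal.div_ne_top ENNReal.ofReal_ne_top fun h => ?_
    exact Nat.find_min hex (Finset.mem_range.1 hi) ((totalRate_eq_zero_iff K hlam).1 h)
  have htop : eventTime K lam ω (N + 1) = ∞ := by
    rw [eventTime, Finset.sum_range_succ, (totalRate_eq_zero_iff K hlam).2 hN,
      ENNReal.div_zero (by simpa using hω N), add_top]
  refine ⟨(eventTime K lam ω N).toNNReal, fun s hs => ⟨N, ?_, ?_, hNζ⟩⟩
  · rw [← ENNReal.coe_toNNReal hfin]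
    exact_mod_cast hs
  · rw [htop]
    exact ENNReal.coe_lt_top

/-- The continuous-time dynamics and successive topplings have the same stabilization law. -/
theorem stabilizationProb_eq_stab (hK : K.NonDegenerate) (hlam : 0 < lam) (η : Config V)
    (ξ : StableConfig V) : stabilizationProb K lam η ξ.toConfig = stab K lam η ξ := by
  have : IsProbabilityMeasure (expMeasure 1) := isProbabilityMeasure_expMeasure zero_lt_one
  set μ := markovChainLaw (PMF.pure η) (jumpStep K lam) with hμ
  set ρ : Measure (ℕ → ℝ) := Measure.infinitePi fun _ => expMeasure 1
  have hpos : ∀ᵐ e ∂ρ, ∀ i, 0 < e i := ae_all_iff.2 fun i =>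
    (measurePreserving_eval_infinitePi (fun _ => expMeasure 1) i).quasiMeasurePreserving.ae
      ae_expMeasure_pos
  have hae : {ω : (ℕ → Config V) × (ℕ → ℝ) |
      ∃ s₀ : ℝ≥0, ∀ s ≥ s₀, StateAt K lam ω s ξ.toConfig} =ᵐ[μ.prod ρ]
      {X : ℕ → Config V | ∀ᶠ n in Filter.atTop, X n = ξ.toConfig} ×ˢ Set.univ := by
    have h1 : ∀ᵐ ω ∂μ.prod ρ, (∃ ζ : StableConfig V, ∀ᶠ n in Filter.atTop, ω.1 n = ζ.toConfig) ∧
        ∀ n, (∀ x, (ω.1 n x).numActive = 0) → ω.1 (n + 1) = ω.1 n :=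
      Measure.quasiMeasurePreserving_fst.ae
        ((ae_eventually_eq_toConfig hK hlam η).and (ae_stable_absorbing hlam η))
    have h2 : ∀ᵐ ω ∂μ.prod ρ, ∀ i, 0 < ω.2 i := Measure.quasiMeasurePreserving_snd.ae hpos
    filter_upwards [h1, h2] with ω ⟨⟨ζ, hζ⟩, habs⟩ hω
    refine propext ?_
    change (∃ s₀ : ℝ≥0, ∀ s ≥ s₀, StateAt K lam ω s ξ.toConfig) ↔ _ ∧ True
    rw [and_true]
    constructor
    · rintro ⟨s₀, hs₀⟩
      obtain ⟨s₁, hs₁⟩ := exists_forall_stateAt (K := K) hlam hω hζ habs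
      have := (hs₀ (max s₀ s₁) (le_max_left _ _)).unique (hs₁ (max s₀ s₁) (le_max_right _ _))
      change ∀ᶠ n in Filter.atTop, ω.1 n = ξ.toConfig
      rwa [this]
    · intro h
      exact exists_forall_stateAt hlam hω h habs
  rw [stabilizationProb, dynamicsLaw, measureReal_def, measure_congr hae, Measure.prod_prod,
    measure_univ, mul_one, markovChainLaw_absorbed hK hlam,
    ENNReal.toReal_ofReal (stab_nonneg K hlam η ξ)]

end ContinuousTime

/-! ### Excess particles -/

section Excess

variable {V : Type u} [DecidableEq V]

/-- The configuration obtained by adding one active particle at each site of `S`. -/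
def Config.addSet (η : Config V) (S : Finset V) : Config V :=
  fun z => if z ∈ S then (η z).arrive else η z

theorem Config.addSet_empty (η : Config V) : η.addSet ∅ = η := by
  funext z
  simp [addSet]

theorem Config.addSet_insert (η : Config V) {S : Finset V} {x : V} (hx : x ∉ S) :
    η.addSet (insert x S) = (η.addSet S).add x := by
  funext z
  rw [add_apply]
  by_cases hz : z = x
  · subst hz
    simp [addSet, hx]
  · simp [addSet, hz]

/-- The configuration with exactly one active particle everywhere. -/
def fullConfig (V : Type u) : Config V := fun _ => .active 1

variable [Fintype V] {K : SubstochasticMatrix V} {lam : ℝ}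

/-- A particle added on top of an active one makes one step of the killed walk, leaving the others
as they were. -/
theorem stab_add_of_active (hlam : 0 < lam) {η : Config V} {x : V} (hx : 0 < (η x).numActive)
    (ξ : StableConfig V) :
    stab K lam (η.add x) ξ =
      ∑ y, K.prob x y * stab K lam (η.add y) ξ + K.kill x * stab K lam η ξ := by
  have hne : η x ≠ .asleep := fun h => by simp [h, SiteState.numActive] at hx
  have h1 : 1 < (η.add x x).numActive := by
    rw [Config.add_apply, if_pos rfl]
    generalize η x = s at hx
    cases s with
    | active k => exact Nat.succ_lt_succ hx
    | asleep => simp [SiteState.numActive] at hx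
  rw [stab_of_one_lt K hlam h1]
  simp only [Config.act, Config.remove_add_self η hne]

/-- When all sites are active, an additional particle walks to its death. -/
theorem stab_add_of_forall_active (hK : K.NonDegenerate) (hlam : 0 < lam) {η : Config V}
    (hη : ∀ x, 0 < (η x).numActive) (x : V) (ξ : StableConfig V) :
    stab K lam (η.add x) ξ = stab K lam η ξ := by
  refine sub_eq_zero.1 (hK.eq_zero_of_harmonic (S := Finset.univ)
    (d := fun x => stab K lam (η.add x) ξ - stab K lam η ξ) (by simp) (fun x _ => ?_) x)
  simp only [mul_sub, Finset.sum_sub_distrib, ← Finset.sum_mul]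
  rw [stab_add_of_active hlam (hη x), SubstochasticMatrix.kill]
  ring

/-- Once all sites carry an additional active particle, the initial configuration is forgotten. -/
theorem stab_addSet_univ (hK : K.NonDegenerate) (hlam : 0 < lam) (ζ ξ : StableConfig V) :
    stab K lam (ζ.toConfig.addSet Finset.univ) ξ = stab K lam (fullConfig V) ξ := by
  have h1 : ∀ A : Finset V,
      stab K lam ((fullConfig V).addSet A) ξ = stab K lam (fullConfig V) ξ := fun A => by
    induction A using Finset.induction_on with
    | empty => rw [Config.addSet_empty]
    | insert x A hx ih =>
      rw [Config.addSet_insert _ hx, stab_add_of_forall_active hK hlam (fun y => ?_), ih]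
      unfold Config.addSet
      split_ifs
      · exact SiteState.arrive_numActive_pos _
      · exact zero_lt_one
  have h2 : ζ.toConfig.addSet Finset.univ =
      (fullConfig V).addSet (Finset.univ.filter fun x => ζ x = true) := by
    funext x
    by_cases hx : ζ x = true <;>
      simp [Config.addSet, StableConfig.toConfig, fullConfig, SiteState.arrive, hx]
  rw [h2, h1]

/-! ### Positivity of the stationary law -/

/-- A particle added where nobody sleeps may be the only one to move until it dies. -/
theorem stab_add_pos (hK : K.NonDegenerate) (hlam : 0 < lam) {η : Config V}
    (hη : ∀ x, η x ≠ .asleep) {ξ : StableConfig V} (h : 0 < stab K lam η ξ) (x : V) :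
    0 < stab K lam (η.add x) ξ := by
  have hpos : 0 < 1 + lam := by linarith
  refine hK.pos_of_superharmonic (w := fun x => stab K lam (η.add x) ξ) (θ := (1 + lam)⁻¹)
    (inv_pos.2 hpos) h (fun x => stab_nonneg K hlam _ ξ) (fun x => ?_) x
  have h1 := one_add_mul_stab K hlam (η.numActive_add_self_pos x) ξ
  simp only [Config.act, Config.remove_add_self η (hη x)] at h1
  rw [inv_mul_le_iff₀ hpos, h1]
  exact le_add_of_nonneg_right (mul_nonneg hlam.le (stab_nonneg K hlam _ ξ))

/-- From the full configuration every stable configuration can be reached: the particles on the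
sites to be emptied walk to their death, and then the others fall asleep. -/
theorem stab_fullConfig_pos (hK : K.NonDegenerate) (hlam : 0 < lam) (ξ : StableConfig V) :
    0 < stab K lam (fullConfig V) ξ := by
  have hpos : 0 < 1 + lam := by linarith
  -- particles falling asleep one after the other
  have h1 : ∀ B : Finset V, (∀ x ∈ B, ξ x = true) →
      0 < stab K lam (fun x => if x ∈ B then .active 1 else ξ.toConfig x) ξ := fun B => by
    induction B using Finset.induction_on with
    | empty =>
      intro _
      have : stab K lam ξ.toConfig ξ = 1 := by rw [stab_toConfig K hlam, if_pos rfl]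
      simp only [Finset.notMem_empty, if_false]
      exact this ▸ zero_lt_one
    | insert x B hx ih =>
      intro hB
      set η : Config V := fun z => if z ∈ insert x B then .active 1 else ξ.toConfig z with hη
      have hηx : η x = .active 1 := by simp [hη]
      have hone : (η x).numActive = 1 := by rw [hηx]; rfl
      have hsleep : η.topple x .sleep =
          fun z => if z ∈ B then .active 1 else ξ.toConfig z := by
        funext z
        rw [Config.topple_apply]
        by_cases hz : z = x
        · subst hz
          simp [SiteState.leave, SiteState.receive, hone, hx, StableConfig.toConfig,
            hB z (Finset.mem_insert_self z B)]
        · simp [SiteState.receive, hz, hη]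
      have h := one_add_mul_stab K hlam (η := η) (x := x) (by rw [hone]; exact one_pos) ξ
      rw [hsleep] at h
      have h2 := mul_pos hlam (ih fun y hy => hB y (Finset.mem_insert_of_mem hy))
      have h3 : 0 ≤ ∑ y, K.prob x y * stab K lam (η.act x (.jump y)) ξ :=
        Finset.sum_nonneg fun y _ => mul_nonneg (K.nonneg x y) (stab_nonneg K hlam _ ξ)
      have h4 := mul_nonneg (K.kill_nonneg x) (stab_nonneg K hlam (η.act x .die) ξ)
      refine pos_of_mul_pos_right (a := 1 + lam) ?_ hpos.le
      rw [h]
      linarith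
  -- superfluous particles dying one after the other
  have h2 : ∀ D : Finset V, 0 < stab K lam
      (fun x => if ξ x = true ∨ x ∈ D then .active 1 else .active 0) ξ := fun D => by
    induction D using Finset.induction_on with
    | empty =>
      refine (h1 (Finset.univ.filter fun x => ξ x = true) (by simp)).trans_eq ?_
      congr 1
      funext x
      by_cases hx : ξ x = true <;> simp [StableConfig.toConfig, hx]
    | insert x D hx ih =>
      by_cases hξ : ξ x = true
      · refine ih.trans_eq ?_
        congr 1
        funext z
        by_cases hz : z = x
        · subst hz; simp [hξ]
        · simp [hz]
      · refine (stab_add_pos hK hlam (fun z => ?_) ih x).trans_eq ?_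
        · split_ifs <;> simp
        · congr 1
          funext z
          refine (Config.add_apply _ x z).trans ?_
          by_cases hz : z = x
          · subst hz; simp [hξ, hx, SiteState.arrive]
          · simp [hz]
  refine (h2 Finset.univ).trans_eq ?_
  congr 1
  funext x
  simp [fullConfig]

/-! ### The number of particles -/

/-- The number of particles, asleep or active. -/
def Config.size (η : Config V) : ℤ := ∑ x, ((η x).count : ℤ)

theorem Config.size_add (η : Config V) (x : V) : (η.add x).size = η.size + 1 := by
  unfold size add
  rw [sum_update fun _ s => ((SiteState.count s : ℕ) : ℤ)]
  cases η x <;> simp only [SiteState.arrive, SiteState.count] <;> push_cast <;> ring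

theorem Config.size_remove {η : Config V} {x : V} (hx : 0 < (η x).numActive) :
    (η.remove x).size = η.size - 1 := by
  unfold size remove
  rw [sum_update fun _ s => ((SiteState.count s : ℕ) : ℤ)]
  generalize η x = s at hx ⊢
  rcases s with k | _
  · obtain ⟨k, rfl⟩ := Nat.exists_eq_succ_of_ne_zero hx.ne'
    simp only [SiteState.depart, SiteState.count, Nat.succ_sub_one]
    push_cast
    ring
  · simp [SiteState.numActive] at hx

theorem Config.size_topple_le {η : Config V} {x : V} (hx : 0 < (η x).numActive) (a : Action V) :
    (η.topple x a).size ≤ η.size := by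
  cases a with
  | jump y => simp only [topple, act, size_add, size_remove hx]; linarith
  | die => simp only [topple, act, size_remove hx]; linarith
  | sleep =>
    unfold topple
    split_ifs with h
    · unfold act size
      rw [sum_update fun _ s => ((SiteState.count s : ℕ) : ℤ)]
      generalize η x = s at h
      rcases s with k | _
      · have : k = 1 := h
        simp [SiteState.count, this]
      · simp [SiteState.numActive] at h
    · exact le_rfl

theorem stab_eq_zero_of_size_lt (hlam : 0 < lam) {η : Config V} {ξ : StableConfig V}
    (h : η.size < ξ.toConfig.size) : stab K lam η ξ = 0 := by
  have key : ∀ n, ∀ η : Config V, η.size < ξ.toConfig.size → stabWithin K lam ξ n η = 0 := by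
    intro n
    induction n with
    | zero => exact fun η h => if_neg fun h' => by simp [h'] at h
    | succ n ih =>
      intro η h
      by_cases hx : ∃ x, 0 < (η x).numActive
      · obtain ⟨x, hx⟩ := hx
        rw [stabWithin_succ_of_active K n hx]
        refine Finset.sum_eq_zero fun a _ => ?_
        rw [ih _ ((Config.size_topple_le hx a).trans_lt h), mul_zero]
      · rw [stabWithin_of_stable K (by simpa using hx), if_neg]
        exact fun h' => by simp [h'] at h
  refine tendsto_nhds_unique (tendsto_stabWithin K hlam η ξ) ?_
  simp only [key _ η h]
  exact tendsto_const_nhds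

/-- With fewer particles than sites, the configuration with all sites occupied is not reached. -/
theorem stab_addSet_eq_zero (hlam : 0 < lam) {S : Finset V} (hS : S ≠ Finset.univ) :
    stab K lam ((StableConfig.toConfig fun _ : V => false).addSet S) (fun _ => true) = 0 := by
  refine stab_eq_zero_of_size_lt hlam ?_
  have h1 : ((StableConfig.toConfig fun _ : V => false).addSet S).size = S.card := by
    have : ∀ x, ((StableConfig.toConfig fun _ : V => false).addSet S x).count =
        if x ∈ S then 1 else 0 := fun x => by
      by_cases hx : x ∈ S <;>
        simp [Config.addSet, StableConfig.toConfig, hx, SiteState.arrive, SiteState.count]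
    simp [Config.size, this]
  have h2 : (StableConfig.toConfig fun _ : V => true).size = Fintype.card V := by
    simp [Config.size, StableConfig.toConfig, SiteState.count]
  rw [h1, h2]
  exact_mod_cast (Finset.card_lt_iff_ne_univ S).2 hS

end Excess

/-! ### One step of internal DLA -/

section IDLAUpdate

variable {V : Type u}

/-- A walk alive at `x`. -/
def WalkState.alive (x : V) : WalkState V := (some x : Option V)

/-- The cemetery. -/
def WalkState.dead : WalkState V := (none : Option V)

theorem WalkState.alive_injective : Function.Injective (WalkState.alive (V := V)) :=
  Option.some_injective V

theorem WalkState.alive_ne_dead (x : V) : WalkState.alive x ≠ .dead := Option.some_ne_none x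

theorem WalkState.eq_dead_or_alive (o : WalkState V) : o = .dead ∨ ∃ x, o = .alive x := by
  rcases o with _ | x
  · exact Or.inl rfl
  · exact Or.inr ⟨x, rfl⟩

/-- The function on `WalkState V` with value `c` at the cemetery and `f x` at `x`. -/
def WalkState.extend {M : Type*} (c : M) (f : V → M) (o : WalkState V) : M :=
  Option.elim (α := V) o c f

@[simp]
theorem WalkState.extend_dead {M : Type*} (c : M) (f : V → M) :
    WalkState.extend c f .dead = c := rfl

@[simp]
theorem WalkState.extend_alive {M : Type*} (c : M) (f : V → M) (x : V) :
    WalkState.extend c f (.alive x) = f x := rfl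

theorem idlaUpdate_of_exit {S : Finset V} {w : ℕ → WalkState V} {k : ℕ} {x : V} (hk : w k = .alive x)
    (hx : x ∉ S) (hlt : ∀ j < k, ∀ y : V, w j = .alive y → y ∈ S) [DecidableEq V] :
    idlaUpdate S w = insert x S := by
  classical
  have h : ∃ k : ℕ, ∃ x : V, w k = .alive x ∧ x ∉ S := ⟨k, x, hk, hx⟩
  refine (dif_pos h).trans ?_
  have hfind : Nat.find h = k :=
    (Nat.find_eq_iff h).2 ⟨⟨x, hk, hx⟩, fun j hj ⟨y, hy, hyS⟩ => hyS (hlt j hj y hy)⟩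
  have hspec : w (Nat.find h) = .alive (Nat.find_spec h).choose := (Nat.find_spec h).choose_spec.1
  have : (Nat.find_spec h).choose = x :=
    WalkState.alive_injective (hspec.symm.trans ((congrArg w hfind).trans hk))
  ext z
  refine (@Finset.mem_insert V (fun _ _ => Classical.propDecidable _) _ _ _).trans
    (Iff.trans ?_ Finset.mem_insert.symm)
  exact or_congr ⟨fun e => e.trans this, fun e => e.trans this.symm⟩ Iff.rfl

theorem idlaUpdate_of_forall {S : Finset V} {w : ℕ → WalkState V}
    (h : ∀ k, ∀ y : V, w k = .alive y → y ∈ S) : idlaUpdate S w = S := by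
  refine dif_neg ?_
  rintro ⟨k, x, hk, hx⟩
  exact hx (h k x hk)

/-- Either the walk never leaves `S`, or it has a first exit from `S`. -/
theorem forall_mem_or_exists_exit (S : Finset V) (w : ℕ → WalkState V) :
    (∀ k, ∀ y : V, w k = .alive y → y ∈ S) ∨
      ∃ k, ∃ x : V, w k = .alive x ∧ x ∉ S ∧ ∀ j < k, ∀ y : V, w j = .alive y → y ∈ S := by
  classical
  by_cases h : ∃ k : ℕ, ∃ x : V, w k = .alive x ∧ x ∉ S
  · obtain ⟨x, hx, hxS⟩ := Nat.find_spec h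
    refine Or.inr ⟨Nat.find h, x, hx, hxS, fun j hj y hy => ?_⟩
    by_contra hyS
    exact Nat.find_min h hj ⟨y, hy, hyS⟩
  · push Not at h
    exact Or.inl h

theorem mem_idlaUpdate {S : Finset V} {w : ℕ → WalkState V} {z : V} :
    z ∈ idlaUpdate S w ↔
      z ∈ S ∨ ∃ k, w k = .alive z ∧ ∀ j < k, ∀ y : V, w j = .alive y → y ∈ S := by
  classical
  rcases forall_mem_or_exists_exit S w with h | ⟨k, x, hk, hx, hlt⟩
  · rw [idlaUpdate_of_forall h]
    exact ⟨Or.inl, fun h' => h'.elim id fun ⟨k, hk, _⟩ => h k z hk⟩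
  · rw [idlaUpdate_of_exit hk hx hlt, Finset.mem_insert]
    constructor
    · rintro (rfl | hz)
      · exact Or.inr ⟨k, hk, hlt⟩
      · exact Or.inl hz
    · rintro (hz | ⟨j, hj, hlt'⟩)
      · exact Or.inr hz
      · rcases lt_trichotomy j k with hjk | rfl | hjk
        · exact Or.inr (hlt j hjk z hj)
        · rw [hk] at hj
          exact Or.inl (WalkState.alive_injective hj).symm
        · exact absurd (hlt' k hjk x hk) hx

theorem subset_idlaUpdate (S : Finset V) (w : ℕ → WalkState V) : S ⊆ idlaUpdate S w :=
  fun _ hz => mem_idlaUpdate.2 (Or.inl hz)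

theorem measurable_idlaUpdate [Countable V] (S : Finset V) : Measurable (idlaUpdate S) := by
  have hm : ∀ (k : ℕ) (p : WalkState V → Prop), Measurable fun w : ℕ → WalkState V => p (w k) :=
    fun k p => measurable_comp_eval p k
  refine measurable_finset_iff.2 fun z => ?_
  simp only [mem_idlaUpdate]
  refine measurable_const.or (Measurable.exists fun k => (hm k fun o => o = .alive z).and ?_)
  exact Measurable.forall fun j => measurable_const.imp
    (hm j fun o => ∀ y : V, o = .alive y → y ∈ S)

variable [Fintype V]

instance : Fintype (WalkState V) := inferInstanceAs (Fintype (Option V))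

variable (K : SubstochasticMatrix V) (ν : PMF V)

instance : IsProbabilityMeasure (walkLaw K ν) := isProbabilityMeasure_markovChainLaw _ _

theorem lintegral_walkStep_alive (x : V) (W : WalkState V → ℝ≥0∞) :
    ∫⁻ o, W o ∂(walkStep K (.alive x)).toMeasure =
      ∑ y, ENNReal.ofReal (K.prob x y) * W (.alive y) + ENNReal.ofReal (K.kill x) * W .dead := by
  have h : ∀ o : WalkState V, (walkStep K (.alive x)).toMeasure {o} = stepProb K x o := fun o => by
    rw [PMF.toMeasure_apply_singleton _ _ MeasurableSet.of_discrete]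
    rfl
  rw [lintegral_fintype]
  simp only [h]
  refine (Fintype.sum_option (α := V) fun o : Option V => W o * stepProb K x o).trans ?_
  change W .dead * stepProb K x none + ∑ y, W (.alive y) * stepProb K x (some y) = _
  rw [add_comm]
  simp only [stepProb, mul_comm]

theorem lintegral_walkStep_dead (W : WalkState V → ℝ≥0∞) :
    ∫⁻ o, W o ∂(walkStep K .dead).toMeasure = W .dead := by
  have : walkStep K .dead = PMF.pure (.dead : WalkState V) := rfl
  rw [this, PMF.toMeasure_pure, lintegral_dirac]

theorem lintegral_walk_init (W : WalkState V → ℝ≥0∞) :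
    ∫⁻ o, W o ∂(ν.map WalkState.alive).toMeasure = ∑ x, ν x * W (.alive x) := by
  let _ : MeasurableSpace V := ⊤
  rw [← PMF.toMeasure_map _ _ Measurable.of_discrete,
    lintegral_map Measurable.of_discrete Measurable.of_discrete, lintegral_fintype]
  refine Finset.sum_congr rfl fun x _ => ?_
  rw [PMF.toMeasure_apply_singleton _ _ MeasurableSet.of_discrete, mul_comm]

variable {K}

/-- The walk is almost surely killed. -/
theorem ae_eventually_dead (hK : K.NonDegenerate) :
    ∀ᵐ X ∂walkLaw K ν, ∀ᶠ n in Filter.atTop, X n = .dead := by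
  obtain ⟨g, hg0, hg⟩ := hK.exists_meanLifetime
  let G : WalkState V → ℝ≥0∞ := WalkState.extend 0 fun x => ENNReal.ofReal (g x)
  have key := ae_eventually_notMem_of_lyapunov (ν.map WalkState.alive) (walkStep K)
    {o | o ≠ .dead} G (fun o => ?_) ?_
  · refine key.mono fun X hX => hX.mono fun n hn => ?_
    simpa using hn
  · rcases o.eq_dead_or_alive with rfl | ⟨x, rfl⟩
    · have h2 : (.dead : WalkState V) ∉ {o : WalkState V | o ≠ .dead} := fun h => h rfl
      rw [lintegral_walkStep_dead, Set.indicator_of_notMem h2, add_zero]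
    · have h2 : .alive x ∈ {o : WalkState V | o ≠ .dead} := WalkState.alive_ne_dead x
      rw [lintegral_walkStep_alive, Set.indicator_of_mem h2]
      simp only [G, WalkState.extend_dead, WalkState.extend_alive, mul_zero, add_zero,
        Pi.one_apply]
      rw [hg x, ENNReal.ofReal_add zero_le_one (Finset.sum_nonneg fun y _ =>
          mul_nonneg (K.nonneg x y) (hg0 y)), ENNReal.ofReal_one, add_comm,
        ENNReal.ofReal_sum_of_nonneg fun y _ => mul_nonneg (K.nonneg x y) (hg0 y)]
      simp only [ENNReal.ofReal_mul (K.nonneg x _), le_refl]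
  · rw [lintegral_walk_init]
    exact ENNReal.sum_ne_top.2 fun x _ =>
      ENNReal.mul_ne_top (ν.apply_ne_top x) ENNReal.ofReal_ne_top

/-- Optional stopping at the first exit from `S`: if `W` is harmonic for the walk inside `S`, then
its mean under the initial law is the mean of its value at the exit or at the death. -/
theorem lintegral_idlaUpdate (hK : K.NonDegenerate) [DecidableEq V] (S : Finset V)
    (φ : Finset V → ℝ≥0∞) (W : WalkState V → ℝ≥0∞) (hφ : ∀ S, φ S ≠ ∞) (hW : ∀ o, W o ≠ ∞)
    (hout : ∀ x ∉ S, W (.alive x) = φ (insert x S)) (hnone : W .dead = φ S)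
    (hin : ∀ x ∈ S, W (.alive x) =
      ∑ y, ENNReal.ofReal (K.prob x y) * W (.alive y) + ENNReal.ofReal (K.kill x) * W .dead) :
    ∫⁻ X, φ (idlaUpdate S X) ∂walkLaw K ν = ∑ x, ν x * W (.alive x) := by
  set μ := walkLaw K ν
  -- the event that the walk has not left `S` up to time `n`
  let A : (n : ℕ) → Set (Finset.Iic n → WalkState V) := fun n =>
    {u | ∀ i, ∀ y : V, u i = .alive y → y ∈ S}
  have hA : ∀ (n : ℕ) (X : ℕ → WalkState V), Preorder.frestrictLe n X ∈ A n ↔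
      ∀ j ≤ n, ∀ y : V, X j = .alive y → y ∈ S := fun n X =>
    ⟨fun h j hj => h ⟨j, Finset.mem_Iic.2 hj⟩, fun h i => h i (Finset.mem_Iic.1 i.2)⟩
  -- `M n m` is `W (X m)` before the exit, and the value at the exit afterwards
  let M : ℕ → ℕ → (ℕ → WalkState V) → ℝ≥0∞ := fun n m X =>
    (A n)ᶜ.indicator 1 (Preorder.frestrictLe n X) * φ (idlaUpdate S X) +
      (A n).indicator 1 (Preorder.frestrictLe n X) * W (X m)
  have hM1 : ∀ n m X, (∀ j ≤ n, ∀ y : V, X j = .alive y → y ∈ S) → M n m X = W (X m) :=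
    fun n m X h => by simp [M, (hA n X).2 h]
  have hM2 : ∀ n m X, ¬ (∀ j ≤ n, ∀ y : V, X j = .alive y → y ∈ S) →
      M n m X = φ (idlaUpdate S X) := fun n m X h => by
    have h' := mt (hA n X).1 h
    simp [M, h']
  have hφm : Measurable fun X => φ (idlaUpdate S X) :=
    (Measurable.of_discrete (f := φ)).comp (measurable_idlaUpdate S)
  have hind : ∀ (n : ℕ) (B : Set (Finset.Iic n → WalkState V)),
      Measurable fun u => B.indicator (1 : (Finset.Iic n → WalkState V) → ℝ≥0∞) u :=
    fun n B => Measurable.of_discrete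
  have hfr : ∀ n : ℕ, Measurable (Preorder.frestrictLe (π := fun _ => WalkState V) n) := fun n =>
    Preorder.measurable_frestrictLe n
  have hfirst : ∀ n, Measurable fun X : ℕ → WalkState V =>
      (A n)ᶜ.indicator (1 : (Finset.Iic n → WalkState V) → ℝ≥0∞) (Preorder.frestrictLe n X) *
        φ (idlaUpdate S X) := fun n =>
    ((hind n (A n)ᶜ).comp (hfr n)).mul hφm
  have hMm : ∀ n m, Measurable (M n m) := fun n m =>
    (hfirst n).add (((hind n (A n)).comp (hfr n)).mul (measurable_comp_eval W m))
  have hone : ∀ n, ∫⁻ X, M n (n + 1) X ∂μ = ∫⁻ X, M n n X ∂μ := fun n => by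
    rw [lintegral_add_left (hfirst n), lintegral_add_left (hfirst n)]
    congr 1
    refine (lintegral_markovChainLaw_succ _ _ n (hind n (A n)) W).trans
      (lintegral_congr fun X => ?_)
    by_cases h : Preorder.frestrictLe n X ∈ A n
    · congr 1
      have hX := (hA n X).1 h n le_rfl
      generalize X n = o at hX
      rcases o.eq_dead_or_alive with rfl | ⟨x, rfl⟩
      · exact lintegral_walkStep_dead K W
      · refine (lintegral_walkStep_alive K x W).trans (hin x (hX x rfl)).symm
    · simp [h]
  have htwo : ∀ n X, M n (n + 1) X = M (n + 1) (n + 1) X := fun n X => by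
    by_cases h1 : ∀ j ≤ n + 1, ∀ y : V, X j = .alive y → y ∈ S
    · rw [hM1 _ _ _ h1, hM1 _ _ _ fun j hj => h1 j (hj.trans n.le_succ)]
    · rw [hM2 _ _ _ h1]
      by_cases h2 : ∀ j ≤ n, ∀ y : V, X j = .alive y → y ∈ S
      · rw [hM1 _ _ _ h2]
        push Not at h1
        obtain ⟨j, hj, y, hy, hyS⟩ := h1
        obtain rfl : j = n + 1 := hj.antisymm (Nat.lt_of_not_le fun h => hyS (h2 j h y hy))
        rw [idlaUpdate_of_exit hy hyS fun i hi => h2 i (Nat.lt_succ_iff.1 hi), hy, hout y hyS]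
      · rw [hM2 _ _ _ h2]
  have hconst : ∀ n, ∫⁻ X, M n n X ∂μ = ∑ x, ν x * W (.alive x) := fun n => by
    induction n with
    | zero =>
      refine Eq.trans ?_ ((lintegral_markovChainLaw_zero (ν.map WalkState.alive)
        (walkStep K) W).trans (lintegral_walk_init ν W))
      refine lintegral_congr fun X => ?_
      by_cases h : ∀ j ≤ 0, ∀ y : V, X j = .alive y → y ∈ S
      · exact hM1 0 0 X h
      · rw [hM2 0 0 X h]
        push Not at h
        obtain ⟨j, hj, y, hy, hyS⟩ := h
        obtain rfl : j = 0 := Nat.le_zero.1 hj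
        rw [idlaUpdate_of_exit hy hyS fun i hi => absurd hi (Nat.not_lt_zero i), hy, hout y hyS]
    | succ n ih =>
      rw [← ih, ← hone n]
      exact lintegral_congr fun X => (htwo n X).symm
  have hlim := tendsto_lintegral_of_dominated_convergence (μ := μ) (F := fun n X => M n n X)
    (f := fun X => φ (idlaUpdate S X)) (fun _ => ∑ S, φ S + ∑ o, W o) (fun n => hMm n n)
    (fun n => Filter.Eventually.of_forall fun X => ?_) ?_ ?_
  · simp only [hconst] at hlim
    exact (tendsto_nhds_unique hlim tendsto_const_nhds)
  · change M n n X ≤ _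
    by_cases h : ∀ j ≤ n, ∀ y : V, X j = .alive y → y ∈ S
    · rw [hM1 _ _ _ h]
      exact (Finset.single_le_sum (f := W) (fun _ _ => zero_le) (Finset.mem_univ _)).trans
        le_add_self
    · rw [hM2 _ _ _ h]
      exact (Finset.single_le_sum (f := φ) (fun _ _ => zero_le) (Finset.mem_univ _)).trans
        le_self_add
  · rw [lintegral_const, measure_univ, mul_one]
    exact ENNReal.add_ne_top.2 ⟨ENNReal.sum_ne_top.2 fun S _ => hφ S,
      ENNReal.sum_ne_top.2 fun o _ => hW o⟩
  · filter_upwards [ae_eventually_dead ν hK] with X hX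
    refine tendsto_const_nhds.congr' ?_
    rcases forall_mem_or_exists_exit S X with h | ⟨k, x, hk, hx, -⟩
    · refine hX.mono fun n hn => ?_
      change φ (idlaUpdate S X) = M n n X
      rw [hM1 n n X fun j _ => h j, hn, hnone, idlaUpdate_of_forall h]
    · refine Filter.eventually_atTop.2 ⟨k, fun n hn => ?_⟩
      exact (hM2 n n X fun h => hx (h k hn x hk)).symm

/-- The transition probabilities of the IDLA process. -/
noncomputable def idlaMatrix (K : SubstochasticMatrix V) (ν : PMF V) (S S' : Finset V) : ℝ :=
  (walkLaw K ν).real {w | idlaUpdate S w = S'}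

/-- `lintegral_idlaUpdate` for real-valued functions. -/
theorem sum_idlaMatrix_mul (hK : K.NonDegenerate) [DecidableEq V] (S : Finset V)
    (φ : Finset V → ℝ) (w : V → ℝ) (hφ : ∀ S, 0 ≤ φ S) (hw : ∀ x, 0 ≤ w x)
    (hout : ∀ x ∉ S, w x = φ (insert x S))
    (hin : ∀ x ∈ S, w x = ∑ y, K.prob x y * w y + K.kill x * φ S) :
    ∑ S', idlaMatrix K ν S S' * φ S' = ∑ x, (ν x).toReal * w x := by
  let W : WalkState V → ℝ≥0∞ :=
    WalkState.extend (ENNReal.ofReal (φ S)) fun x => ENNReal.ofReal (w x)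
  have hWtop : ∀ o, W o ≠ ∞ := fun o => by
    rcases o.eq_dead_or_alive with rfl | ⟨x, rfl⟩ <;> exact ENNReal.ofReal_ne_top
  have key := lintegral_idlaUpdate ν hK S (fun S => ENNReal.ofReal (φ S)) W
    (fun _ => ENNReal.ofReal_ne_top) hWtop
    (fun x hx => congrArg ENNReal.ofReal (hout x hx)) rfl (fun x hx => ?_)
  · rw [← lintegral_map (f := fun S => ENNReal.ofReal (φ S)) (g := idlaUpdate S)
      Measurable.of_discrete (measurable_idlaUpdate S), lintegral_fintype] at key
    have h := congrArg ENNReal.toReal key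
    rw [ENNReal.toReal_sum fun S' _ => ENNReal.mul_ne_top ENNReal.ofReal_ne_top
        ((measure_lt_top _ _).ne),
      ENNReal.toReal_sum fun x _ => ENNReal.mul_ne_top (ν.apply_ne_top x)
        (hWtop _)] at h
    refine Eq.trans (Finset.sum_congr rfl fun S' _ => ?_) (h.trans
      (Finset.sum_congr rfl fun x _ => ?_))
    · rw [ENNReal.toReal_mul, ENNReal.toReal_ofReal (hφ S'),
        Measure.map_apply (measurable_idlaUpdate S) (MeasurableSet.singleton S'), mul_comm]
      rfl
    · rw [ENNReal.toReal_mul]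
      exact congrArg _ (ENNReal.toReal_ofReal (hw x))
  · change ENNReal.ofReal (w x) = ∑ y, _ * ENNReal.ofReal (w y) + _ * ENNReal.ofReal (φ S)
    rw [hin x hx, ENNReal.ofReal_add (Finset.sum_nonneg fun y _ =>
        mul_nonneg (K.nonneg x y) (hw y)) (mul_nonneg (K.kill_nonneg x) (hφ S)),
      ENNReal.ofReal_mul (K.kill_nonneg x),
      ENNReal.ofReal_sum_of_nonneg fun y _ => mul_nonneg (K.nonneg x y) (hw y)]
    simp only [ENNReal.ofReal_mul (K.nonneg x _)]

/-- Every site is visited with positive probability. -/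
theorem exists_walkLaw_pos {ν : PMF V} (hν : K.Reaches ν) (x : V) :
    ∃ n, 0 < walkLaw K ν {X | X n = .alive x} := by
  classical
  have hm : ∀ n (o : WalkState V), MeasurableSet {X : ℕ → WalkState V | X n = o} :=
    fun n o => measurableSet_eval_eq o n
  have hlin : ∀ n (o : WalkState V), walkLaw K ν {X | X n = o} =
      ∫⁻ X, ({o} : Set (WalkState V)).indicator 1 (X n) ∂walkLaw K ν := fun n o => by
    rw [← lintegral_indicator_one (hm n o)]
    rfl
  obtain ⟨y, hy, hyx⟩ := hν x
  induction hyx with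
  | refl =>
    refine ⟨0, ?_⟩
    rw [hlin]
    refine lt_of_lt_of_eq ?_ ((lintegral_markovChainLaw_zero (ν.map WalkState.alive)
        (walkStep K) _).trans (lintegral_walk_init ν _)).symm
    refine lt_of_lt_of_le (pos_iff_ne_zero.2 ((PMF.mem_support_iff ν y).1 hy))
      (le_trans ?_ (Finset.single_le_sum (fun _ _ => zero_le) (Finset.mem_univ y)))
    simp
  | @tail a b _ hab ih =>
    obtain ⟨n, hn⟩ := ih
    refine ⟨n + 1, ?_⟩
    rw [hlin]
    refine lt_of_lt_of_eq ?_ (lintegral_markovChainLaw_eval_succ (ν.map WalkState.alive)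
        (walkStep K) n _).symm
    have hstep : ENNReal.ofReal (K.prob a b) ≤
        ∫⁻ o, ({(.alive b)} : Set (WalkState V)).indicator 1 o
          ∂(walkStep K (.alive a)).toMeasure := by
      rw [lintegral_walkStep_alive]
      refine le_trans ?_ le_self_add
      refine le_trans ?_ (Finset.single_le_sum (fun _ _ => zero_le) (Finset.mem_univ b))
      simp
    refine lt_of_lt_of_le (ENNReal.mul_pos (ENNReal.ofReal_pos.2 hab).ne' hn.ne') ?_
    rw [← lintegral_indicator_const (hm n (.alive a))]
    refine lintegral_mono fun X => ?_
    by_cases hX : X n = .alive a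
    · rw [Set.indicator_of_mem (by exact hX), hX]
      exact hstep
    · rw [Set.indicator_of_notMem (by exact hX)]
      exact zero_le

end IDLAUpdate

/-! ### The IDLA process and its filling time -/

section IDLAProcess

variable {V : Type u}

theorem idla_mono (w : ℕ → ℕ → WalkState V) : Monotone (idla w) :=
  monotone_nat_of_le_succ fun t => subset_idlaUpdate (idla w t) (w t)

theorem idla_congr {w w' : ℕ → ℕ → WalkState V} {t : ℕ} (h : ∀ i < t, w i = w' i) :
    idla w t = idla w' t := by
  induction t with
  | zero => rfl
  | succ t ih =>
    rw [idla, idla, ih fun i hi => h i (hi.trans t.lt_succ_self), h t t.lt_succ_self]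

theorem measurable_idla [Finite V] (t : ℕ) :
    Measurable fun w : ℕ → ℕ → WalkState V => idla w t := by
  induction t with
  | zero => exact measurable_const
  | succ t ih =>
    have h : Measurable fun q : Finset V × (ℕ → WalkState V) => idlaUpdate q.1 q.2 :=
      measurable_from_prod_countable_right fun S => measurable_idlaUpdate S
    exact h.comp (ih.prodMk (measurable_pi_apply t))

variable [Fintype V]

theorem fillingTime_le_iff {w : ℕ → ℕ → WalkState V} {t : ℕ} :
    fillingTime w ≤ t ↔ idla w t = Finset.univ := by
  constructor
  · intro h
    have hlt : fillingTime w < ((t + 1 : ℕ) : ℕ∞) := h.trans_lt (by exact_mod_cast t.lt_succ_self)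
    obtain ⟨_, ⟨s, hs, rfl⟩, hst⟩ := sInf_lt_iff.1 hlt
    have hst : s ≤ t := Nat.lt_succ_iff.1 (ENat.natCast_lt_natCast.1 hst)
    exact Finset.eq_univ_of_forall fun x => idla_mono w hst (by
      have : idla w s = Finset.univ := hs
      rw [this]
      exact Finset.mem_univ x)
  · exact fun h => sInf_le ⟨t, h, rfl⟩

theorem measurable_fillingTime :
    Measurable fun w : ℕ → ℕ → WalkState V => fillingTime w := by
  have hle : ∀ t : ℕ, MeasurableSet {w : ℕ → ℕ → WalkState V | fillingTime w ≤ t} := fun t => by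
    simp only [fillingTime_le_iff]
    exact measurable_idla t (MeasurableSet.singleton Finset.univ)
  refine measurable_to_countable' fun t => ?_
  induction t using ENat.recTopCoe with
  | top =>
    have : (fun w : ℕ → ℕ → WalkState V => fillingTime w) ⁻¹' {⊤} =
        (⋃ t : ℕ, {w | fillingTime w ≤ t})ᶜ := by
      ext w
      simp only [Set.mem_preimage, Set.mem_singleton_iff, Set.mem_compl_iff, Set.mem_iUnion,
        Set.mem_ofPred_eq, not_exists]
      constructor
      · intro h t ht
        rw [h] at ht
        exact ENat.natCast_ne_top t (top_le_iff.1 ht)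
      · intro h
        by_contra hne
        exact h (fillingTime w).toNat (ENat.natCast_toNat hne).ge
    rw [this]
    exact (MeasurableSet.iUnion hle).compl
  | coe t =>
    have : (fun w : ℕ → ℕ → WalkState V => fillingTime w) ⁻¹' {(t : ℕ∞)} =
        {w | fillingTime w ≤ t} \ ⋃ s : Fin t, {w | fillingTime w ≤ (s : ℕ)} := by
      ext w
      simp only [Set.mem_preimage, Set.mem_singleton_iff, Set.mem_sdiff, Set.mem_iUnion,
        Set.mem_ofPred_eq, not_exists, not_le]
      constructor
      · intro h
        rw [h]
        exact ⟨le_rfl, fun s => by exact_mod_cast s.2⟩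
      · rintro ⟨h1, h2⟩
        refine h1.antisymm (not_lt.1 fun hlt => ?_)
        obtain ⟨s, hs⟩ := ENat.ne_top_iff_exists.1 hlt.ne_top
        rw [← hs] at hlt
        have := h2 ⟨s, by exact_mod_cast hlt⟩
        rw [← hs] at this
        exact this.false
    rw [this]
    exact (hle t).diff (MeasurableSet.iUnion fun s => hle s)

variable (K : SubstochasticMatrix V) (ν : PMF V)

/-- The joint law of i.i.d. `(K, ν)`-walks. -/
noncomputable def iidWalkLaw : Measure (ℕ → ℕ → WalkState V) :=
  Measure.infinitePi fun _ => walkLaw K ν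

instance : IsProbabilityMeasure (iidWalkLaw K ν) :=
  inferInstanceAs (IsProbabilityMeasure (Measure.infinitePi fun _ => walkLaw K ν))

variable {K ν}

theorem IsIIDWalks.map_eq {Ω : Type v} [MeasurableSpace Ω] {P : Measure Ω}
    [IsProbabilityMeasure P] {W : ℕ → Ω → ℕ → WalkState V} (hW : IsIIDWalks K ν P W) :
    P.map (fun ω n => W n ω) = iidWalkLaw K ν := by
  rw [(iIndepFun_iff_map_fun_eq_infinitePi_map hW.measurable).1 hW.indep, iidWalkLaw]
  simp only [hW.law]

/-- The coordinates of a sequence with law `iidWalkLaw` are i.i.d. walks. -/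
theorem isIIDWalks_of_map_eq {Ω : Type v} [MeasurableSpace Ω] {P : Measure Ω}
    [IsProbabilityMeasure P] {W : Ω → ℕ → ℕ → WalkState V} (hm : Measurable W)
    (hW : P.map W = iidWalkLaw K ν) : IsIIDWalks K ν P fun n ω => W ω n := by
  have hmn : ∀ n, Measurable fun ω => W ω n := fun n => (measurable_pi_apply n).comp hm
  have hlaw : ∀ n, P.map (fun ω => W ω n) = walkLaw K ν := fun n => by
    have : (fun ω => W ω n) = (fun w : ℕ → ℕ → WalkState V => w n) ∘ W := rfl
    rw [this, ← Measure.map_map (measurable_pi_apply n) hm, hW, iidWalkLaw,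
      Measure.infinitePi_map_eval]
  refine ⟨hmn, ?_, hlaw⟩
  rw [iIndepFun_iff_map_fun_eq_infinitePi_map hmn]
  simp only [hlaw]
  exact hW

variable (K ν)

theorem iIndepFun_iidWalkLaw :
    iIndepFun (fun (i : ℕ) (w : ℕ → ℕ → WalkState V) => w i) (iidWalkLaw K ν) :=
  iIndepFun_infinitePi (P := fun _ : ℕ => walkLaw K ν) (X := fun _ x => x)
    fun _ => measurable_id

/-- The law of IDLA at time `t`. -/
noncomputable def idlaProb (t : ℕ) (S : Finset V) : ℝ :=
  (iidWalkLaw K ν).real {w | idla w t = S}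

theorem idlaProb_zero (S : Finset V) [Decidable (∅ = S)] :
    idlaProb K ν 0 S = if ∅ = S then 1 else 0 := by
  unfold idlaProb
  simp only [idla]
  split_ifs with h <;> simp [h]

theorem indepFun_idla (t : ℕ) :
    IndepFun (fun w : ℕ → ℕ → WalkState V => idla w t) (fun w => w t) (iidWalkLaw K ν) := by
  have h := (iIndepFun_iidWalkLaw K ν).indepFun_finset (Finset.range t) {t} (by simp)
    fun i => measurable_pi_apply i
  let E : (Finset.range t → ℕ → WalkState V) → ℕ → ℕ → WalkState V := fun u i =>
    if hi : i ∈ Finset.range t then u ⟨i, hi⟩ else fun _ => .dead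
  have hE : Measurable E := measurable_pi_lambda _ fun i => by
    by_cases hi : i ∈ Finset.range t
    · simp only [E, hi, dif_pos]
      exact measurable_pi_apply _
    · simp only [E, hi, dif_neg, not_false_iff]
      exact measurable_const
  have h2 := h.comp ((measurable_idla t).comp hE)
    (measurable_pi_apply (X := fun _ : ({t} : Finset ℕ) => ℕ → WalkState V)
      ⟨t, Finset.mem_singleton_self t⟩)
  refine h2.congr (Filter.EventuallyEq.of_eq (funext fun w => ?_)) (Filter.EventuallyEq.refl _ _)
  refine idla_congr fun i hi => ?_
  have : i ∈ Finset.range t := Finset.mem_range.2 hi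
  simp only [E, this, dif_pos]

/-- IDLA is a Markov chain with transition matrix `idlaMatrix`. -/
theorem idlaProb_succ (t : ℕ) (S' : Finset V) :
    idlaProb K ν (t + 1) S' = ∑ S, idlaProb K ν t S * idlaMatrix K ν S S' := by
  have hsplit : {w : ℕ → ℕ → WalkState V | idla w (t + 1) = S'} =
      ⋃ S : Finset V, {w | idla w t = S} ∩ {w | idlaUpdate S (w t) = S'} := by
    ext w
    simp [idla]
  have hm1 : ∀ S, MeasurableSet {w : ℕ → ℕ → WalkState V | idla w t = S} := fun S =>
    measurable_idla t (MeasurableSet.singleton S)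
  have hm2 : ∀ S, MeasurableSet {x : ℕ → WalkState V | idlaUpdate S x = S'} := fun S =>
    measurable_idlaUpdate S (MeasurableSet.singleton S')
  unfold idlaProb
  rw [hsplit, measureReal_iUnion_fintype]
  · refine Finset.sum_congr rfl fun S _ => ?_
    have h := (indepFun_idla K ν t).measure_inter_preimage_eq_mul {S}
      {x | idlaUpdate S x = S'} (MeasurableSet.singleton S) (hm2 S)
    have hmap : (iidWalkLaw K ν).map (fun w => w t) = walkLaw K ν :=
      Measure.infinitePi_map_eval _ t
    have h2 : iidWalkLaw K ν ((fun w => w t) ⁻¹' {x | idlaUpdate S x = S'}) =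
        walkLaw K ν {x | idlaUpdate S x = S'} := by
      rw [← hmap, Measure.map_apply (measurable_pi_apply t) (hm2 S)]
    rw [h2] at h
    have h3 := congrArg ENNReal.toReal h
    rw [ENNReal.toReal_mul] at h3
    exact h3
  · intro S₁ S₂ hne
    refine Set.disjoint_left.2 fun w h1 h2 => hne ?_
    exact h1.1.symm.trans h2.1
  · exact fun S => (hm1 S).inter (measurable_pi_apply (X := fun _ => ℕ → WalkState V) t (hm2 S))

variable {K} in
/-- Each site is almost surely visited by infinitely many walks. -/
theorem ae_frequently_visit (hν : K.Reaches ν) (x : V) :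
    ∀ᵐ w ∂iidWalkLaw K ν, ∃ᶠ t in Filter.atTop, ∃ k, w t k = .alive x := by
  obtain ⟨n, hn⟩ := exists_walkLaw_pos hν x
  have hm : MeasurableSet {X : ℕ → WalkState V | X n = .alive x} :=
    measurableSet_eval_eq _ n
  let s : ℕ → Set (ℕ → ℕ → WalkState V) := fun t => (fun w => w t) ⁻¹' {X | X n = .alive x}
  have hs : ∀ t, MeasurableSet (s t) := fun t => measurable_pi_apply t hm
  have hμ : ∀ t, iidWalkLaw K ν (s t) = walkLaw K ν {X | X n = .alive x} := fun t => by
    rw [← Measure.map_apply (measurable_pi_apply t) hm]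
    exact congrArg (fun μ : Measure (ℕ → WalkState V) => μ {X | X n = .alive x})
      (Measure.infinitePi_map_eval (fun _ : ℕ => walkLaw K ν) t)
  have hind : iIndepSet s (iidWalkLaw K ν) :=
    (iIndepSet_iff_meas_biInter hs).2 fun F =>
      (iIndepFun_iidWalkLaw K ν).measure_inter_preimage_eq_mul F
        (sets := fun _ => {X | X n = .alive x}) fun _ _ => hm
  have h1 := measure_limsup_eq_one hs hind (by
    simp only [hμ]
    exact ENNReal.tsum_const_eq_top_of_ne_zero hn.ne')
  have h2 : ∀ᵐ w ∂iidWalkLaw K ν, w ∈ Filter.limsup s Filter.atTop := by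
    rw [← prob_compl_eq_zero_iff (MeasurableSet.measurableSet_limsup hs)] at h1
    exact h1
  filter_upwards [h2] with w hw
  rw [Filter.mem_limsup_iff_frequently_mem] at hw
  exact hw.mono fun t ht => ⟨n, ht⟩

/-- If each site is visited by infinitely many walks, then IDLA fills `V`. -/
theorem exists_idla_eq_univ {w : ℕ → ℕ → WalkState V}
    (hw : ∀ x, ∃ᶠ t in Filter.atTop, ∃ k, w t k = .alive x) : ∃ t, idla w t = Finset.univ := by
  by_contra! hne
  have key : ∀ n, ∃ t, n ≤ (idla w t).card := fun n => by
    induction n with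
    | zero => exact ⟨0, Nat.zero_le _⟩
    | succ n ih =>
      obtain ⟨t, ht⟩ := ih
      obtain ⟨x, hx⟩ : ∃ x, x ∉ idla w t := by
        by_contra! h
        exact hne t (Finset.eq_univ_of_forall h)
      obtain ⟨s, hs, k, hk⟩ := (Filter.frequently_atTop.1 (hw x)) t
      refine ⟨s + 1, Nat.succ_le_of_lt (ht.trans_lt (Finset.card_lt_card ?_))⟩
      refine Finset.ssubset_iff_subset_ne.2 ⟨idla_mono w (hs.trans s.le_succ), fun heq => ?_⟩
      -- otherwise the walk number `s` does not leave `idla w s`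
      have hsub : idla w s ⊆ idla w t := heq ▸ idla_mono w s.le_succ
      rcases forall_mem_or_exists_exit (idla w s) (w s) with h | ⟨j, y, hj, hy, hlt⟩
      · exact hx (hsub (h k x hk))
      · have hy' : y ∈ idla w (s + 1) := mem_idlaUpdate.2 (Or.inr ⟨j, hj, hlt⟩)
        rw [← heq] at hy'
        exact hy (idla_mono w hs hy')
  obtain ⟨t, ht⟩ := key (Fintype.card V + 1)
  exact absurd (Finset.card_le_univ (idla w t)) (by omega)

variable {K} in
theorem ae_fillingTime_ne_top (hν : K.Reaches ν) :
    ∀ᵐ w ∂iidWalkLaw K ν, fillingTime w ≠ ⊤ := by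
  filter_upwards [ae_all_iff.2 (ae_frequently_visit ν hν)] with w hw
  obtain ⟨t, ht⟩ := exists_idla_eq_univ hw
  exact ne_top_of_le_ne_top (ENat.natCast_ne_top t) (fillingTime_le_iff.2 ht)

end IDLAProcess

/-! ### Duality between activated random walks and IDLA -/

section Duality

variable {V : Type u} [Fintype V] [DecidableEq V] {K : SubstochasticMatrix V} {lam : ℝ}
  (ν : PMF V)

omit [DecidableEq V] in
theorem sum_toReal_pmf : ∑ x, (ν x).toReal = 1 := by
  rw [← ENNReal.toReal_sum fun x _ => ν.apply_ne_top x, ← tsum_fintype (L := .unconditional V),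
    ν.tsum_coe, ENNReal.toReal_one]

theorem transitionMatrix_apply (hK : K.NonDegenerate) (hlam : 0 < lam) (η ξ : StableConfig V) :
    transitionMatrix K lam ν η ξ = ∑ x, (ν x).toReal * stab K lam (η.toConfig.add x) ξ := by
  simp only [transitionMatrix, stabilizationProb_eq_stab hK hlam]

theorem transitionMatrix_nonneg (hK : K.NonDegenerate) (hlam : 0 < lam) (η ξ : StableConfig V) :
    0 ≤ transitionMatrix K lam ν η ξ := by
  rw [transitionMatrix_apply ν hK hlam]
  exact Finset.sum_nonneg fun x _ => mul_nonneg ENNReal.toReal_nonneg (stab_nonneg K hlam _ _)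

theorem sum_transitionMatrix (hK : K.NonDegenerate) (hlam : 0 < lam) (η : StableConfig V) :
    ∑ ξ, transitionMatrix K lam ν η ξ = 1 := by
  simp only [transitionMatrix_apply ν hK hlam]
  rw [Finset.sum_comm]
  simp only [← Finset.mul_sum, sum_stab hK hlam, mul_one, sum_toReal_pmf]

theorem sum_stab_mul_transitionMatrix (hK : K.NonDegenerate) (hlam : 0 < lam) (η : Config V)
    (ξ : StableConfig V) :
    ∑ ζ, stab K lam η ζ * transitionMatrix K lam ν ζ ξ =
      ∑ x, (ν x).toReal * stab K lam (η.add x) ξ := by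
  simp only [transitionMatrix_apply ν hK hlam, Finset.mul_sum]
  rw [Finset.sum_comm]
  refine Finset.sum_congr rfl fun x _ => ?_
  rw [← sum_stab_mul_stab_add hK hlam, Finset.mul_sum]
  exact Finset.sum_congr rfl fun ζ _ => mul_left_comm _ _ _

/-- The intertwining relation: the stabilization of `η.addSet S` turns the transitions of IDLA
into those of the ARW chain, since a particle added to `η.addSet S` may first follow the killed walk
until it leaves `S`. -/
theorem sum_stab_addSet_mul_transitionMatrix (hK : K.NonDegenerate) (hlam : 0 < lam) (η : Config V)
    (S : Finset V) (ξ : StableConfig V) :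
    ∑ ζ, stab K lam (η.addSet S) ζ * transitionMatrix K lam ν ζ ξ =
      ∑ S', idlaMatrix K ν S S' * stab K lam (η.addSet S') ξ := by
  rw [sum_stab_mul_transitionMatrix ν hK hlam]
  refine (sum_idlaMatrix_mul ν hK S (fun S' => stab K lam (η.addSet S') ξ)
    (fun x => stab K lam ((η.addSet S).add x) ξ) (fun S' => stab_nonneg K hlam _ ξ)
    (fun x => stab_nonneg K hlam _ ξ) (fun x hx => ?_) (fun x hx => ?_)).symm
  · rw [Config.addSet_insert η hx]
  · refine stab_add_of_active hlam ?_ ξ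
    simp only [Config.addSet, hx, if_true]
    exact SiteState.arrive_numActive_pos _

/-- The law of the ARW chain at time `t` is the law of the stabilization of the initial
configuration to which the particles of IDLA at time `t` are added. -/
theorem transitionMatrix_pow_apply (hK : K.NonDegenerate) (hlam : 0 < lam) (t : ℕ)
    (η ξ : StableConfig V) :
    (transitionMatrix K lam ν ^ t) η ξ =
      ∑ S, idlaProb K ν t S * stab K lam (η.toConfig.addSet S) ξ := by
  induction t generalizing ξ with
  | zero =>
    simp [idlaProb_zero, Config.addSet_empty, stab_toConfig K hlam, Matrix.one_apply]
  | succ t ih =>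
    rw [pow_succ, Matrix.mul_apply]
    simp only [ih, Finset.sum_mul, mul_assoc]
    rw [Finset.sum_comm]
    simp only [← Finset.mul_sum, sum_stab_addSet_mul_transitionMatrix ν hK hlam, idlaProb_succ,
      Finset.sum_mul]
    simp only [Finset.mul_sum, mul_assoc]
    exact Finset.sum_comm

/-- The stationary law: the law of the stabilization of the full configuration. -/
noncomputable def statLaw (K : SubstochasticMatrix V) (lam : ℝ) (ξ : StableConfig V) : ℝ :=
  stab K lam (fullConfig V) ξ

omit [DecidableEq V] in
theorem idlaProb_nonneg (t : ℕ) (S : Finset V) : 0 ≤ idlaProb K ν t S := measureReal_nonneg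

/-- The contribution of the event that IDLA has filled `V` bounds the transition probabilities from
below, uniformly in the starting point. -/
theorem idlaProb_mul_statLaw_le (hK : K.NonDegenerate) (hlam : 0 < lam) (t : ℕ)
    (η ξ : StableConfig V) :
    idlaProb K ν t Finset.univ * statLaw K lam ξ ≤ (transitionMatrix K lam ν ^ t) η ξ := by
  rw [transitionMatrix_pow_apply ν hK hlam, statLaw, ← stab_addSet_univ hK hlam η]
  exact Finset.single_le_sum
    (f := fun S => idlaProb K ν t S * stab K lam (η.toConfig.addSet S) ξ)
    (fun S _ => mul_nonneg (idlaProb_nonneg ν t S) (stab_nonneg K hlam _ ξ)) (Finset.mem_univ _)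

/-- From the empty configuration, all sites are occupied only if IDLA has filled `V`. -/
theorem transitionMatrix_pow_empty_full (hK : K.NonDegenerate) (hlam : 0 < lam) (t : ℕ) :
    (transitionMatrix K lam ν ^ t) (fun _ => false) (fun _ => true) =
      idlaProb K ν t Finset.univ * statLaw K lam fun _ => true := by
  rw [transitionMatrix_pow_apply ν hK hlam, statLaw,
    ← stab_addSet_univ hK hlam (fun _ => false)]
  refine Finset.sum_eq_single _ (fun S _ hS => ?_) (by simp)
  rw [stab_addSet_eq_zero hlam hS, mul_zero]

/-- A particle added to the full configuration walks to its death without any effect. -/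
theorem isInvariantLaw_statLaw (hK : K.NonDegenerate) (hlam : 0 < lam) :
    IsInvariantLaw (transitionMatrix K lam ν) (statLaw K lam) := by
  refine ⟨fun ξ => stab_nonneg K hlam _ ξ, sum_stab hK hlam _, funext fun ξ => ?_⟩
  change ∑ ζ, stab K lam (fullConfig V) ζ * transitionMatrix K lam ν ζ ξ = statLaw K lam ξ
  rw [sum_stab_mul_transitionMatrix ν hK hlam]
  simp only [stab_add_of_forall_active hK hlam (η := fullConfig V) fun _ => zero_lt_one]
  rw [← Finset.sum_mul, sum_toReal_pmf, one_mul, statLaw]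

omit [DecidableEq V] in
theorem idlaProb_univ (t : ℕ) :
    idlaProb K ν t Finset.univ = (iidWalkLaw K ν).real {w | fillingTime w ≤ t} := by
  simp only [fillingTime_le_iff]
  rfl

omit [DecidableEq V] in
theorem tendsto_idlaProb_univ (hν : K.Reaches ν) :
    Filter.Tendsto (fun t => idlaProb K ν t Finset.univ) Filter.atTop (nhds 1) := by
  have h : Filter.Tendsto (fun t : ℕ => iidWalkLaw K ν {w | fillingTime w ≤ t}) Filter.atTop
      (nhds (iidWalkLaw K ν (⋃ t : ℕ, {w | fillingTime w ≤ t}))) :=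
    tendsto_measure_iUnion_atTop fun s t hst w (hw : fillingTime w ≤ s) =>
      hw.trans (Nat.mono_cast hst)
  have hm : MeasurableSet (⋃ t : ℕ, {w : ℕ → ℕ → WalkState V | fillingTime w ≤ t}) :=
    MeasurableSet.iUnion fun t =>
      measurable_fillingTime (MeasurableSet.of_discrete (s := Set.Iic (t : ℕ∞)))
  have h1 : iidWalkLaw K ν (⋃ t : ℕ, {w | fillingTime w ≤ t}) = 1 := by
    refine (mem_ae_iff_prob_eq_one hm).1 ?_
    filter_upwards [ae_fillingTime_ne_top ν hν] with w hw
    exact Set.mem_iUnion.2 ⟨(fillingTime w).toNat, (ENat.natCast_toNat hw).ge⟩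
  rw [h1] at h
  have h2 := (ENNReal.tendsto_toReal ENNReal.one_ne_top).comp h
  rw [ENNReal.toReal_one] at h2
  simp only [idlaProb_univ]
  exact h2

/-- An invariant law dominates `ℙ(T ≤ t) π` for all `t`, hence equals `π`. -/
theorem eq_statLaw_of_isInvariantLaw (hK : K.NonDegenerate) (hlam : 0 < lam) {ν : PMF V}
    (hν : K.Reaches ν) {π : StableConfig V → ℝ} (hπ : IsInvariantLaw (transitionMatrix K lam ν) π) :
    π = statLaw K lam := by
  obtain ⟨h0, h1, hinv⟩ := hπ
  have hpow : ∀ t, Matrix.vecMul π (transitionMatrix K lam ν ^ t) = π := fun t => by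
    induction t with
    | zero => simp
    | succ t ih => rw [pow_succ, ← Matrix.vecMul_vecMul, ih, hinv]
  have hle : ∀ ξ, statLaw K lam ξ ≤ π ξ := fun ξ => by
    refine le_of_tendsto' ((tendsto_idlaProb_univ ν hν).mul_const (statLaw K lam ξ) |>.trans
      (by rw [one_mul])) fun t => ?_
    calc idlaProb K ν t Finset.univ * statLaw K lam ξ
        = ∑ η, π η * (idlaProb K ν t Finset.univ * statLaw K lam ξ) := by
          rw [← Finset.sum_mul, h1, one_mul]
      _ ≤ ∑ η, π η * (transitionMatrix K lam ν ^ t) η ξ :=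
          Finset.sum_le_sum fun η _ =>
            mul_le_mul_of_nonneg_left (idlaProb_mul_statLaw_le ν hK hlam t η ξ) (h0 η)
      _ = π ξ := congrFun (hpow t) ξ
  have hsum : ∑ ξ, statLaw K lam ξ = ∑ ξ, π ξ := by
    rw [h1]
    exact sum_stab hK hlam _
  funext ξ
  exact ((Finset.sum_eq_sum_iff_of_le fun ξ _ => hle ξ).1 hsum ξ (Finset.mem_univ ξ)).symm

/-- The lower bound on the transition probabilities is attained from the empty to the fully occupied
configuration, so it determines the separation distance. -/
theorem separationDistance_eq (hK : K.NonDegenerate) (hlam : 0 < lam) (t : ℕ) :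
    separationDistance (transitionMatrix K lam ν) (statLaw K lam) t =
      1 - idlaProb K ν t Finset.univ := by
  have hpos : ∀ ξ, 0 < statLaw K lam ξ := stab_fullConfig_pos hK hlam
  have hle : ∀ p : StableConfig V × StableConfig V,
      1 - (transitionMatrix K lam ν ^ t) p.1 p.2 / statLaw K lam p.2 ≤
        1 - idlaProb K ν t Finset.univ := fun p =>
    sub_le_sub_left ((le_div_iff₀ (hpos p.2)).2 (idlaProb_mul_statLaw_le ν hK hlam t p.1 p.2)) 1
  refine le_antisymm (ciSup_le hle) ?_
  refine le_ciSup_of_le ⟨_, by rintro _ ⟨p, rfl⟩; exact hle p⟩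
    ((fun _ => false), (fun _ => true)) ?_
  rw [transitionMatrix_pow_empty_full ν hK hlam, mul_div_cancel_right₀ _ (hpos _).ne']

end Duality

/-! ### A strong stationary time with a prescribed law -/

theorem sum_measure_eq_natCast {Ω : Type v} [MeasurableSpace Ω] (P : Measure Ω) {T : Ω → ℕ∞}
    (hT : Measurable T) (n : ℕ) :
    ∑ s ∈ Finset.range (n + 1), P {ω | T ω = s} = P {ω | T ω ≤ n} := by
  rw [← measure_biUnion_finset]
  · congr 1
    ext ω
    simp only [Set.mem_iUnion, Set.mem_ofPred_eq, Finset.mem_range, exists_prop]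
    constructor
    · rintro ⟨s, hs, h⟩
      rw [h]
      exact_mod_cast Nat.lt_succ_iff.1 hs
    · intro h
      obtain ⟨s, hs⟩ := ENat.ne_top_iff_exists.1 (ne_top_of_le_ne_top (ENat.natCast_ne_top n) h)
      rw [← hs] at h ⊢
      exact ⟨s, Nat.lt_succ_iff.2 (by exact_mod_cast h), rfl⟩
  · intro s _ s' _ hne
    refine Set.disjoint_left.2 fun ω h1 h2 => hne ?_
    have h3 : (s : ℕ∞) = s' := h1.symm.trans h2
    exact_mod_cast h3
  · exact fun s _ => hT (MeasurableSet.singleton (s : ℕ∞))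

section StrongStationaryTime

variable {X : Type u} [Fintype X] [DecidableEq X]

/-- The row `x` of a stochastic matrix, as a probability mass function. -/
noncomputable def rowPMF (M : Matrix X X ℝ) (h0 : ∀ x y, 0 ≤ M x y) (h1 : ∀ x, ∑ y, M x y = 1)
    (x : X) : PMF X :=
  PMF.ofFintype (fun y => ENNReal.ofReal (M x y)) (by
    rw [← ENNReal.ofReal_sum_of_nonneg fun y _ => h0 x y, h1, ENNReal.ofReal_one])

/-- The data of the construction: a stochastic matrix `M` with an invariant law `π`, a starting
point `a`, and the law `c` of a random time whose distribution function bounds the separation from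
below, so that `ℙ(τ ≤ t) π(x) ≤ M^t(a, x)`. -/
structure StoppingData (X : Type u) [Fintype X] [DecidableEq X] where
  M : Matrix X X ℝ
  nonneg : ∀ x y, 0 ≤ M x y
  sum_row : ∀ x, ∑ y, M x y = 1
  π : X → ℝ
  inv : IsInvariantLaw M π
  a : X
  c : ℕ → ℝ
  c_nonneg : ∀ t, 0 ≤ c t
  le_pow : ∀ t x, (∑ s ∈ Finset.range (t + 1), c s) * π x ≤ (M ^ t) a x

namespace StoppingData

variable (D : StoppingData X)

/-- The probability that the chain is at `x` at time `t` and has not been stopped before. -/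
noncomputable def alive (t : ℕ) (x : X) : ℝ :=
  (D.M ^ t) D.a x - (∑ s ∈ Finset.range t, D.c s) * D.π x

/-- The probability of stopping at time `t`, given that the chain is then at `x` and has not been
stopped before. -/
noncomputable def stopProb (t : ℕ) (x : X) : ℝ := D.c t * D.π x / D.alive t x

theorem mul_le_alive (t : ℕ) (x : X) : D.c t * D.π x ≤ D.alive t x := by
  have h := D.le_pow t x
  rw [Finset.sum_range_succ, add_mul] at h
  rw [alive]
  linarith

theorem c_mul_nonneg (t : ℕ) (x : X) : 0 ≤ D.c t * D.π x :=
  mul_nonneg (D.c_nonneg t) (D.inv.1 x)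

theorem alive_nonneg (t : ℕ) (x : X) : 0 ≤ D.alive t x :=
  (D.c_mul_nonneg t x).trans (D.mul_le_alive t x)

theorem stopProb_nonneg (t : ℕ) (x : X) : 0 ≤ D.stopProb t x :=
  div_nonneg (D.c_mul_nonneg t x) (D.alive_nonneg t x)

theorem stopProb_le_one (t : ℕ) (x : X) : D.stopProb t x ≤ 1 :=
  div_le_one_of_le₀ (D.mul_le_alive t x) (D.alive_nonneg t x)

/-- This holds also where `alive` vanishes and `stopProb` has the junk value zero. -/
theorem alive_mul_stopProb (t : ℕ) (x : X) : D.alive t x * D.stopProb t x = D.c t * D.π x := by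
  rcases (D.alive_nonneg t x).eq_or_lt with h | h
  · have h1 := D.mul_le_alive t x
    rw [← h] at h1
    rw [← h, zero_mul]
    exact (h1.antisymm (D.c_mul_nonneg t x)).symm
  · exact mul_div_cancel₀ _ h.ne'

theorem alive_succ (t : ℕ) (x : X) :
    D.alive (t + 1) x = ∑ y, D.alive t y * (1 - D.stopProb t y) * D.M y x := by
  have h1 : ∀ y, D.alive t y * (1 - D.stopProb t y) =
      (D.M ^ t) D.a y - (∑ s ∈ Finset.range (t + 1), D.c s) * D.π y := fun y => by
    rw [mul_sub, mul_one, alive_mul_stopProb, alive, Finset.sum_range_succ]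
    ring
  have h2 : ∑ y, D.π y * D.M y x = D.π x := congrFun D.inv.2.2 x
  simp only [h1, sub_mul, Finset.sum_sub_distrib, mul_assoc, ← Finset.mul_sum, h2]
  rw [alive, pow_succ, Matrix.mul_apply]

variable [MeasurableSpace X] [DiscreteMeasurableSpace X]

/-- The law of the chain. -/
noncomputable def chainLaw : Measure (ℕ → X) :=
  markovChainLaw (PMF.pure D.a) (rowPMF D.M D.nonneg D.sum_row)

instance : IsProbabilityMeasure D.chainLaw := isProbabilityMeasure_markovChainLaw _ _

/-- The conditional probability, given its path `x`, that the chain is not stopped before `t`. -/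
noncomputable def survival (t : ℕ) (x : ℕ → X) : ℝ≥0∞ :=
  ∏ s ∈ Finset.range t, ENNReal.ofReal (1 - D.stopProb s (x s))

/-- The conditional probability, given its path `x`, that the chain is stopped at time `t`. -/
noncomputable def stopDensity (t : ℕ) (x : ℕ → X) : ℝ≥0∞ :=
  D.survival t x * ENNReal.ofReal (D.stopProb t (x t))

omit [DiscreteMeasurableSpace X] [MeasurableSpace X] in
theorem stopDensity_add_survival (t : ℕ) (x : ℕ → X) :
    D.stopDensity t x + D.survival (t + 1) x = D.survival t x := by
  rw [stopDensity, survival, survival, Finset.prod_range_succ, ← mul_add,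
    ← ENNReal.ofReal_add (D.stopProb_nonneg _ _) (sub_nonneg.2 (D.stopProb_le_one _ _)),
    add_sub_cancel, ENNReal.ofReal_one, mul_one]

theorem measurable_survival (t : ℕ) : Measurable (D.survival t) :=
  Finset.measurable_prod _ fun s _ =>
    measurable_comp_eval (fun y => ENNReal.ofReal (1 - D.stopProb s y)) s

theorem measurable_stopDensity (t : ℕ) : Measurable (D.stopDensity t) :=
  (D.measurable_survival t).mul (measurable_comp_eval (fun y => ENNReal.ofReal (D.stopProb t y)) t)

/-- The path `u` up to time `t`, continued by a constant. -/
def extendPath (t : ℕ) (u : Finset.Iic t → X) (i : ℕ) : X :=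
  u ⟨min i t, Finset.mem_Iic.2 (min_le_right i t)⟩

omit [Fintype X] [DecidableEq X] [MeasurableSpace X] [DiscreteMeasurableSpace X] in
theorem extendPath_frestrictLe {t i : ℕ} (hi : i ≤ t) (x : ℕ → X) :
    extendPath t (Preorder.frestrictLe t x) i = x i := by
  simp [extendPath, hi]

omit [DiscreteMeasurableSpace X] [MeasurableSpace X] in
theorem survival_congr {t : ℕ} {x y : ℕ → X} (h : ∀ i < t, x i = y i) :
    D.survival t x = D.survival t y :=
  Finset.prod_congr rfl fun s hs => by rw [h s (Finset.mem_range.1 hs)]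

omit [DiscreteMeasurableSpace X] [MeasurableSpace X] in
theorem stopDensity_congr {t : ℕ} {x y : ℕ → X} (h : ∀ i ≤ t, x i = y i) :
    D.stopDensity t x = D.stopDensity t y := by
  rw [stopDensity, stopDensity, D.survival_congr fun i hi => h i hi.le, h t le_rfl]

/-- The Markov property of the chain, tested against a function of the past. -/
theorem lintegral_chainLaw_succ {t : ℕ} {F : (ℕ → X) → ℝ≥0∞}
    (hF : ∀ x, F (extendPath t (Preorder.frestrictLe t x)) = F x) (g : X → ℝ≥0∞) :
    ∫⁻ x, F x * g (x (t + 1)) ∂D.chainLaw =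
      ∫⁻ x, F x * ∑ y, ENNReal.ofReal (D.M (x t) y) * g y ∂D.chainLaw := by
  have h := lintegral_markovChainLaw_succ (PMF.pure D.a) (rowPMF D.M D.nonneg D.sum_row) t
    (F := fun u => F (extendPath t u)) Measurable.of_discrete g
  simp only [hF] at h
  refine h.trans (lintegral_congr fun x => ?_)
  rw [lintegral_fintype]
  congr 1
  refine Finset.sum_congr rfl fun y _ => ?_
  rw [PMF.toMeasure_apply_singleton _ _ MeasurableSet.of_discrete, mul_comm]
  rfl

theorem lintegral_survival_mul (t : ℕ) (g : X → ℝ≥0∞) :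
    ∫⁻ x, D.survival t x * g (x t) ∂D.chainLaw = ∑ x, ENNReal.ofReal (D.alive t x) * g x := by
  induction t generalizing g with
  | zero =>
    simp only [survival, Finset.range_zero, Finset.prod_empty, one_mul]
    rw [chainLaw, lintegral_markovChainLaw_zero _ _ g, PMF.toMeasure_pure, lintegral_dirac,
      Finset.sum_eq_single D.a]
    · simp [alive]
    · intro y _ hy
      simp [alive, Matrix.one_apply_ne hy.symm]
    · simp
  | succ t ih =>
    rw [D.lintegral_chainLaw_succ (F := D.survival (t + 1)) (fun x => D.survival_congr fun i hi =>
      extendPath_frestrictLe (Nat.lt_succ_iff.1 hi) x) g]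
    simp only [survival, Finset.prod_range_succ, mul_assoc]
    refine (ih fun y => ENNReal.ofReal (1 - D.stopProb t y) *
      ∑ z, ENNReal.ofReal (D.M y z) * g z).trans ?_
    simp only [Finset.mul_sum]
    rw [Finset.sum_comm]
    refine Finset.sum_congr rfl fun z _ => ?_
    rw [alive_succ, ENNReal.ofReal_sum_of_nonneg fun y _ => mul_nonneg
      (mul_nonneg (D.alive_nonneg t y) (sub_nonneg.2 (D.stopProb_le_one t y)))
      (D.nonneg y z), Finset.sum_mul]
    refine Finset.sum_congr rfl fun y _ => ?_
    rw [ENNReal.ofReal_mul (mul_nonneg (D.alive_nonneg t y)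
      (sub_nonneg.2 (D.stopProb_le_one t y))), ENNReal.ofReal_mul (D.alive_nonneg t y)]
    ring

/-- At the time when the chain is stopped, its law is `π`. -/
theorem lintegral_stopDensity_mul (t : ℕ) (g : X → ℝ≥0∞) :
    ∫⁻ x, D.stopDensity t x * g (x t) ∂D.chainLaw =
      ENNReal.ofReal (D.c t) * ∑ x, ENNReal.ofReal (D.π x) * g x := by
  simp only [stopDensity, mul_assoc]
  refine (D.lintegral_survival_mul t fun y => ENNReal.ofReal (D.stopProb t y) * g y).trans ?_
  rw [Finset.mul_sum]
  refine Finset.sum_congr rfl fun x _ => ?_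
  rw [← mul_assoc, ← mul_assoc, ← ENNReal.ofReal_mul (D.alive_nonneg t x), alive_mul_stopProb,
    ENNReal.ofReal_mul (D.c_nonneg t)]

omit [DecidableEq X] [MeasurableSpace X] [DiscreteMeasurableSpace X] in
theorem sum_ofReal_law {π : X → ℝ} (h0 : ∀ x, 0 ≤ π x) (h1 : ∑ x, π x = 1) :
    ∑ x, ENNReal.ofReal (π x) = 1 := by
  rw [← ENNReal.ofReal_sum_of_nonneg fun x _ => h0 x, h1, ENNReal.ofReal_one]

theorem lintegral_stopDensity (t : ℕ) :
    ∫⁻ x, D.stopDensity t x ∂D.chainLaw = ENNReal.ofReal (D.c t) := by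
  have h := D.lintegral_stopDensity_mul t fun _ => 1
  simpa only [mul_one, sum_ofReal_law D.inv.1 D.inv.2.1] using h

omit [MeasurableSpace X] [DiscreteMeasurableSpace X] in
theorem sum_pow_apply (t : ℕ) (x : X) : ∑ y, (D.M ^ t) x y = 1 := by
  induction t with
  | zero => simp [Matrix.one_apply]
  | succ t ih =>
    simp only [pow_succ, Matrix.mul_apply]
    rw [Finset.sum_comm]
    simp only [← Finset.mul_sum, D.sum_row, mul_one, ih]

theorem lintegral_survival (t : ℕ) :
    ∫⁻ x, D.survival t x ∂D.chainLaw = ENNReal.ofReal (1 - ∑ s ∈ Finset.range t, D.c s) := by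
  have h := D.lintegral_survival_mul t fun _ => 1
  simp only [mul_one] at h
  rw [h, ← ENNReal.ofReal_sum_of_nonneg fun x _ => D.alive_nonneg t x]
  simp only [alive, Finset.sum_sub_distrib, ← Finset.mul_sum, D.sum_pow_apply, D.inv.2.1, mul_one]

/-- The conditional law of the chain, given that it is stopped at time `t`. The law of the chain
itself is used as a default value for the times `t` of probability zero. -/
noncomputable def condLaw (t : ℕ∞) : Measure (ℕ → X) :=
  if D.c t.toNat = 0 ∨ t = ⊤ then D.chainLaw
  else (ENNReal.ofReal (D.c t.toNat))⁻¹ • D.chainLaw.withDensity (D.stopDensity t.toNat)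

instance (t : ℕ∞) : IsProbabilityMeasure (D.condLaw t) := by
  unfold condLaw
  split_ifs with h
  · infer_instance
  · have hc : 0 < D.c t.toNat := (D.c_nonneg _).lt_of_ne fun h' => h (Or.inl h'.symm)
    refine ⟨?_⟩
    rw [Measure.smul_apply, withDensity_apply _ MeasurableSet.univ, Measure.restrict_univ,
      lintegral_stopDensity, smul_eq_mul,
      ENNReal.inv_mul_cancel (ENNReal.ofReal_pos.2 hc).ne' ENNReal.ofReal_ne_top]

theorem ofReal_mul_condLaw (t : ℕ) {B : Set (ℕ → X)} (hB : MeasurableSet B) :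
    ENNReal.ofReal (D.c t) * D.condLaw t B = ∫⁻ x in B, D.stopDensity t x ∂D.chainLaw := by
  by_cases h : D.c t = 0
  · have h0 : ∫⁻ x in B, D.stopDensity t x ∂D.chainLaw ≤ 0 := by
      refine (setLIntegral_le_lintegral B _).trans ?_
      rw [lintegral_stopDensity, h, ENNReal.ofReal_zero]
    rw [h, ENNReal.ofReal_zero, zero_mul, le_zero_iff.1 h0]
  · have hc : 0 < D.c t := (D.c_nonneg t).lt_of_ne (Ne.symm h)
    rw [condLaw, if_neg (by simpa using h), Measure.smul_apply, withDensity_apply _ hB,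
      smul_eq_mul, ENat.toNat_natCast, ← mul_assoc,
      ENNReal.mul_inv_cancel (ENNReal.ofReal_pos.2 hc).ne' ENNReal.ofReal_ne_top, one_mul]

variable {Ω₀ : Type v} [MeasurableSpace Ω₀]

/-- The kernel that samples the path of the chain given the time at which it is to be stopped. -/
noncomputable def pathKernel {T : Ω₀ → ℕ∞} (hT : Measurable T) : Kernel Ω₀ (ℕ → X) where
  toFun ω := D.condLaw (T ω)
  measurable' := (Measurable.of_discrete (f := D.condLaw)).comp hT

instance {T : Ω₀ → ℕ∞} (hT : Measurable T) : IsMarkovKernel (D.pathKernel hT) :=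
  ⟨fun ω => inferInstanceAs (IsProbabilityMeasure (D.condLaw (T ω)))⟩

/-- The joint law of the randomness that determines the time `T` and of the chain. -/
noncomputable def jointLaw (P₀ : Measure Ω₀) {T : Ω₀ → ℕ∞} (hT : Measurable T) :
    Measure (Ω₀ × (ℕ → X)) :=
  P₀ ⊗ₘ D.pathKernel hT

variable (P₀ : Measure Ω₀) [IsProbabilityMeasure P₀] {T : Ω₀ → ℕ∞} (hT : Measurable T)

instance : IsProbabilityMeasure (D.jointLaw P₀ hT) :=
  inferInstanceAs (IsProbabilityMeasure (P₀ ⊗ₘ D.pathKernel hT))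

theorem jointLaw_map_fst : (D.jointLaw P₀ hT).map Prod.fst = P₀ :=
  Measure.fst_compProd P₀ (D.pathKernel hT)

variable {P₀}

/-- The joint law agrees with that of the chain and its randomized stopping time: the chain and the
event that it is stopped at time `t`. -/
theorem jointLaw_eq (hc : ∀ t : ℕ, P₀ {ω | T ω = t} = ENNReal.ofReal (D.c t)) (t : ℕ)
    {B : Set (ℕ → X)} (hB : MeasurableSet B) :
    D.jointLaw P₀ hT {ω | T ω.1 = t ∧ ω.2 ∈ B} = ∫⁻ x in B, D.stopDensity t x ∂D.chainLaw := by
  have hm : MeasurableSet {ω | T ω = t} := hT (MeasurableSet.singleton (t : ℕ∞))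
  rw [← D.ofReal_mul_condLaw t hB, ← hc t]
  change (P₀ ⊗ₘ D.pathKernel hT) ({ω | T ω = t} ×ˢ B) = _
  rw [Measure.compProd_apply_prod hm hB, mul_comm, ← setLIntegral_const]
  refine setLIntegral_congr_fun hm fun ω hω => ?_
  change D.condLaw (T ω) B = D.condLaw t B
  rw [show T ω = t from hω]

/-- The chain and the event that it has not been stopped up to time `t`. -/
theorem jointLaw_lt (hfin : ∀ᵐ ω ∂P₀, T ω ≠ ⊤)
    (hc : ∀ t : ℕ, P₀ {ω | T ω = t} = ENNReal.ofReal (D.c t)) (t : ℕ)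
    {B : Set (ℕ → X)} (hB : MeasurableSet B) :
    D.jointLaw P₀ hT {ω | (t : ℕ∞) < T ω.1 ∧ ω.2 ∈ B} =
      ∫⁻ x in B, D.survival (t + 1) x ∂D.chainLaw := by
  set P := D.jointLaw P₀ hT
  have hmT : ∀ A : Set ℕ∞, MeasurableSet {ω : Ω₀ × (ℕ → X) | T ω.1 ∈ A ∧ ω.2 ∈ B} := fun A =>
    ((hT.comp measurable_fst) (MeasurableSet.of_discrete (s := A))).inter (measurable_snd hB)
  -- stopping at time `n + 1` splits off from both sides
  have hstep1 : ∀ n : ℕ, P {ω | (n : ℕ∞) < T ω.1 ∧ ω.2 ∈ B} =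
      P {ω | T ω.1 = (n + 1 : ℕ) ∧ ω.2 ∈ B} + P {ω | ((n + 1 : ℕ) : ℕ∞) < T ω.1 ∧ ω.2 ∈ B} :=
    fun n => by
      have hm : MeasurableSet {ω : Ω₀ × (ℕ → X) | ((n + 1 : ℕ) : ℕ∞) < T ω.1 ∧ ω.2 ∈ B} :=
        hmT (Set.Ioi ((n + 1 : ℕ) : ℕ∞))
      rw [← measure_union _ hm]
      · congr 1
        ext ω
        have : (n : ℕ∞) < T ω.1 ↔ T ω.1 = (n + 1 : ℕ) ∨ ((n + 1 : ℕ) : ℕ∞) < T ω.1 := by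
          rw [eq_comm, ← le_iff_eq_or_lt, Nat.cast_succ, ENat.add_one_le_iff (ENat.natCast_ne_top n)]
        simp only [Set.mem_ofPred_eq, Set.mem_union, this]
        tauto
      · refine Set.disjoint_left.2 fun ω h1 h2 => ?_
        have h3 : ((n + 1 : ℕ) : ℕ∞) < T ω.1 := h2.1
        rw [h1.1] at h3
        exact h3.false
  have hstep2 : ∀ n : ℕ, ∫⁻ x in B, D.survival (n + 1) x ∂D.chainLaw =
      P {ω | T ω.1 = (n + 1 : ℕ) ∧ ω.2 ∈ B} + ∫⁻ x in B, D.survival (n + 1 + 1) x ∂D.chainLaw :=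
    fun n => by
      rw [D.jointLaw_eq hT hc (n + 1) hB, ← lintegral_add_left (D.measurable_stopDensity (n + 1))]
      simp only [D.stopDensity_add_survival]
  have htail : ∀ n : ℕ, P₀ {ω | (n : ℕ∞) < T ω} = ENNReal.ofReal
      (1 - ∑ s ∈ Finset.range (n + 1), D.c s) := fun n => by
    have h1 := sum_measure_eq_natCast P₀ hT n
    have h2 : {ω | (n : ℕ∞) < T ω} = {ω | T ω ≤ n}ᶜ := by
      ext ω
      simp
    have hm : MeasurableSet {ω | T ω ≤ n} := hT (MeasurableSet.of_discrete (s := Set.Iic (n : ℕ∞)))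
    rw [h2, prob_compl_eq_one_sub hm, ← h1]
    simp only [hc]
    rw [← ENNReal.ofReal_sum_of_nonneg fun s _ => D.c_nonneg s,
      ENNReal.ofReal_sub _ (Finset.sum_nonneg fun s _ => D.c_nonneg s), ENNReal.ofReal_one]
  have hlim : Filter.Tendsto (fun n : ℕ => P₀ {ω | (n : ℕ∞) < T ω}) Filter.atTop (nhds 0) := by
    have h0 : P₀ (⋂ n : ℕ, {ω | (n : ℕ∞) < T ω}) = 0 := by
      refine measure_mono_null (fun ω hω => ?_) hfin
      intro hne
      have := Set.mem_iInter.1 hω (T ω).toNat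
      rw [Set.mem_ofPred_eq, ENat.natCast_toNat hne] at this
      exact this.false
    rw [← h0]
    exact tendsto_measure_iInter_atTop
      (fun n => (hT (MeasurableSet.of_discrete (s := Set.Ioi (n : ℕ∞)))).nullMeasurableSet)
      (fun m n hmn ω (hω : (n : ℕ∞) < T ω) => lt_of_le_of_lt (Nat.mono_cast hmn) hω)
      ⟨0, measure_ne_top _ _⟩
  have hle1 : ∀ n : ℕ, P {ω | (n : ℕ∞) < T ω.1 ∧ ω.2 ∈ B} ≤ P₀ {ω | (n : ℕ∞) < T ω} := fun n => by
    have hmap := D.jointLaw_map_fst P₀ hT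
    conv_rhs => rw [← hmap]
    have hm : MeasurableSet {ω | (n : ℕ∞) < T ω} :=
      hT (MeasurableSet.of_discrete (s := Set.Ioi (n : ℕ∞)))
    rw [Measure.map_apply measurable_fst hm]
    exact measure_mono fun ω hω => hω.1
  have hle2 : ∀ n : ℕ, ∫⁻ x in B, D.survival (n + 1) x ∂D.chainLaw ≤ P₀ {ω | (n : ℕ∞) < T ω} :=
    fun n => by
      rw [htail n, ← D.lintegral_survival (n + 1)]
      exact setLIntegral_le_lintegral B _
  -- both sides have lost the same amount `e` at time `n`, and what remains tends to zero
  have hdiff : ∀ n ≥ t, ∃ e : ℝ≥0∞,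
      P {ω | (t : ℕ∞) < T ω.1 ∧ ω.2 ∈ B} = e + P {ω | (n : ℕ∞) < T ω.1 ∧ ω.2 ∈ B} ∧
      ∫⁻ x in B, D.survival (t + 1) x ∂D.chainLaw =
        e + ∫⁻ x in B, D.survival (n + 1) x ∂D.chainLaw := fun n hn => by
    induction n, hn using Nat.le_induction with
    | base => exact ⟨0, by simp, by simp⟩
    | succ n hn ih =>
      obtain ⟨e, h1, h2⟩ := ih
      exact ⟨e + P {ω | T ω.1 = (n + 1 : ℕ) ∧ ω.2 ∈ B}, by rw [h1, hstep1 n, add_assoc],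
        by rw [h2, hstep2 n, ← add_assoc]⟩
  have hlim' : ∀ y : ℝ≥0∞, Filter.Tendsto (fun n : ℕ => y + P₀ {ω | (n : ℕ∞) < T ω}) Filter.atTop
      (nhds y) := fun y => by simpa using hlim.const_add y
  refine le_antisymm (ge_of_tendsto (hlim' _) ?_) (ge_of_tendsto (hlim' _) ?_)
  · filter_upwards [Filter.eventually_ge_atTop t] with n hn
    obtain ⟨e, h1, h2⟩ := hdiff n hn
    rw [h1, h2]
    exact add_le_add le_self_add (hle1 n)
  · filter_upwards [Filter.eventually_ge_atTop t] with n hn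
    obtain ⟨e, h1, h2⟩ := hdiff n hn
    rw [h1, h2]
    exact add_le_add le_self_add (hle2 n)

end StoppingData

end StrongStationaryTime

/-! ### The filtration of the stopped chain -/

section Filtration

variable {X : Type u} [Fintype X] [MeasurableSpace X] [DiscreteMeasurableSpace X]
variable {Ω₀ : Type v} [MeasurableSpace Ω₀] {T : Ω₀ → ℕ∞}

/-- What is observed up to time `t`: the path of the chain up to time `t`, and the time `T` if it
is at most `t`. Later values of `T` are recorded as `t + 1`. -/
noncomputable def observation (T : Ω₀ → ℕ∞) (t : ℕ) (ω : Ω₀ × (ℕ → X)) :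
    ℕ∞ × (Finset.Iic t → X) :=
  (min (T ω.1) ((t + 1 : ℕ) : ℕ∞), Preorder.frestrictLe t ω.2)

omit [Fintype X] [DiscreteMeasurableSpace X] in
theorem measurable_observation (hT : Measurable T) (t : ℕ) :
    Measurable (observation (X := X) T t) :=
  (((Measurable.of_discrete (f := fun s : ℕ∞ => min s ((t + 1 : ℕ) : ℕ∞))).comp hT).comp
    measurable_fst).prodMk ((Preorder.measurable_frestrictLe t).comp measurable_snd)

/-- The filtration generated by the observations: the smallest one for which the chain is adapted and
`T` is a stopping time. -/
noncomputable def observationFiltration (hT : Measurable T) :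
    Filtration ℕ (inferInstance : MeasurableSpace (Ω₀ × (ℕ → X))) where
  seq t := MeasurableSpace.comap (observation T t) inferInstance
  mono' s t hst := by
    have h : observation (X := X) T s = (fun q : ℕ∞ × (Finset.Iic t → X) =>
        (min q.1 ((s + 1 : ℕ) : ℕ∞), Preorder.frestrictLe₂ (π := fun _ => X) hst q.2)) ∘
          observation T t := by
      funext ω
      refine Prod.ext ?_ rfl
      change min (T ω.1) _ = min (min (T ω.1) _) _
      rw [min_assoc, min_eq_right (a := ((t + 1 : ℕ) : ℕ∞)) (by exact_mod_cast Nat.succ_le_succ hst)]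
    change MeasurableSpace.comap _ _ ≤ MeasurableSpace.comap _ _
    rw [h, ← MeasurableSpace.comap_comp]
    exact MeasurableSpace.comap_mono (Measurable.of_discrete).comap_le
  le' t := (measurable_observation hT t).comap_le

end Filtration

namespace StoppingData

variable {X : Type u} [Fintype X] [DecidableEq X] [MeasurableSpace X] [DiscreteMeasurableSpace X]
variable (D : StoppingData X)

/-- The paths whose observation up to time `t` is in `C` if the stopping time is recorded as `n`. -/
def slice (t : ℕ) (C : Set (ℕ∞ × (Finset.Iic t → X))) (n : ℕ∞) : Set (ℕ → X) :=
  {x | (n, Preorder.frestrictLe (π := fun _ => X) t x) ∈ C}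

/-- The conditional probability, given the path `x` of the chain, that the observation up to
time `t` belongs to `C`. -/
noncomputable def observationDensity (t : ℕ) (C : Set (ℕ∞ × (Finset.Iic t → X))) (x : ℕ → X) :
    ℝ≥0∞ :=
  ∑ s ∈ Finset.range (t + 1),
      (slice t C s).indicator (D.stopDensity s) x +
    (slice t C (t + 1 : ℕ)).indicator (D.survival (t + 1)) x

omit [DecidableEq X] in
theorem measurableSet_slice (t : ℕ) (C : Set (ℕ∞ × (Finset.Iic t → X))) (n : ℕ∞) :
    MeasurableSet (slice t C n) :=
  (measurable_const.prodMk (Preorder.measurable_frestrictLe t)) (MeasurableSet.of_discrete (s := C))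

theorem measurable_observationDensity (t : ℕ) (C : Set (ℕ∞ × (Finset.Iic t → X))) :
    Measurable (D.observationDensity t C) := by
  refine Measurable.add (Finset.measurable_sum _ fun s _ =>
    (D.measurable_stopDensity s).indicator (measurableSet_slice t C s))
      ((D.measurable_survival (t + 1)).indicator (measurableSet_slice t C _))

omit [MeasurableSpace X] [DiscreteMeasurableSpace X] in
theorem observationDensity_extendPath (t : ℕ) (C : Set (ℕ∞ × (Finset.Iic t → X))) (x : ℕ → X) :
    D.observationDensity t C (extendPath t (Preorder.frestrictLe t x)) =
      D.observationDensity t C x := by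
  have h : Preorder.frestrictLe t (extendPath t (Preorder.frestrictLe t x)) =
      Preorder.frestrictLe (π := fun _ => X) t x :=
    funext fun i => extendPath_frestrictLe (Finset.mem_Iic.1 i.2) x
  have hsurv := D.survival_congr (t := t + 1) fun i hi =>
    extendPath_frestrictLe (Nat.lt_succ_iff.1 hi) x
  have hdens : ∀ s ∈ Finset.range (t + 1), D.stopDensity s
      (extendPath t (Preorder.frestrictLe t x)) = D.stopDensity s x := fun s hs =>
    D.stopDensity_congr fun i hi =>
      extendPath_frestrictLe (hi.trans (Nat.lt_succ_iff.1 (Finset.mem_range.1 hs))) x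
  classical
  simp only [observationDensity, Set.indicator_apply, slice, Set.mem_ofPred_eq, h, hsurv]
  congr 1
  exact Finset.sum_congr rfl fun s hs => by rw [hdens s hs]

variable {Ω₀ : Type v} [MeasurableSpace Ω₀] {P₀ : Measure Ω₀} [IsProbabilityMeasure P₀]
variable {T : Ω₀ → ℕ∞} (hT : Measurable T) (hfin : ∀ᵐ ω ∂P₀, T ω ≠ ⊤)
variable (hc : ∀ t : ℕ, P₀ {ω | T ω = t} = ENNReal.ofReal (D.c t))

include hfin hc

/-- The joint law of the observation up to time `t` and of the path of the chain. Since the density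
is a function of the path up to time `t`, the chain keeps its Markov property. -/
theorem jointLaw_observation (t : ℕ) (C : Set (ℕ∞ × (Finset.Iic t → X))) {B : Set (ℕ → X)}
    (hB : MeasurableSet B) :
    D.jointLaw P₀ hT (observation T t ⁻¹' C ∩ {ω | ω.2 ∈ B}) =
      ∫⁻ x in B, D.observationDensity t C x ∂D.chainLaw := by
  have hset : ∀ (A : Set ℕ∞) (n : ℕ∞), MeasurableSet {ω : Ω₀ × (ℕ → X) | T ω.1 ∈ A ∧
      ω.2 ∈ slice t C n ∩ B} := fun A n =>
    ((hT.comp measurable_fst) (MeasurableSet.of_discrete (s := A))).inter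
      (measurable_snd ((measurableSet_slice t C n).inter hB))
  have hsplit : observation T t ⁻¹' C ∩ {ω | ω.2 ∈ B} =
      (⋃ s ∈ Finset.range (t + 1), {ω : Ω₀ × (ℕ → X) | T ω.1 = s ∧
        ω.2 ∈ slice t C s ∩ B}) ∪
      {ω | (t : ℕ∞) < T ω.1 ∧
        ω.2 ∈ slice t C (t + 1 : ℕ) ∩ B} := by
    ext ω
    simp only [Set.mem_inter_iff, Set.mem_preimage, Set.mem_ofPred_eq, Set.mem_union,
      Set.mem_iUnion, Finset.mem_range, exists_prop, observation, slice]
    rcases le_or_gt (T ω.1) t with h | h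
    · obtain ⟨s, hs⟩ := ENat.ne_top_iff_exists.1 (ne_top_of_le_ne_top (ENat.natCast_ne_top t) h)
      have hst : s ≤ t := by
        rw [← hs] at h
        exact_mod_cast h
      rw [← hs, min_eq_left (by exact_mod_cast hst.trans (Nat.le_succ t))]
      constructor
      · rintro ⟨h1, h2⟩
        exact Or.inl ⟨s, Nat.lt_succ_iff.2 hst, rfl, h1, h2⟩
      · rintro (⟨s', _, h1, h2⟩ | ⟨h1, _⟩)
        · rw [h1]
          exact h2
        · exact absurd h1 (not_lt.2 (by exact_mod_cast hst))
    · rw [min_eq_right (by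
        rw [Nat.cast_succ]
        exact (ENat.add_one_le_iff (ENat.natCast_ne_top t)).2 h)]
      constructor
      · rintro ⟨h1, h2⟩
        exact Or.inr ⟨h, h1, h2⟩
      · rintro (⟨s, hs, h1, _⟩ | ⟨_, h1, h2⟩)
        · rw [h1] at h
          exact absurd hs (not_lt.2 (by exact_mod_cast h))
        · exact ⟨h1, h2⟩
  have hfirst : ∀ s : ℕ, MeasurableSet {ω : Ω₀ × (ℕ → X) | T ω.1 = s ∧
      ω.2 ∈ slice t C s ∩ B} := fun s => hset {(s : ℕ∞)} s
  have hlast : MeasurableSet {ω : Ω₀ × (ℕ → X) | (t : ℕ∞) < T ω.1 ∧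
      ω.2 ∈ slice t C (t + 1 : ℕ) ∩ B} := hset (Set.Ioi (t : ℕ∞)) _
  rw [hsplit, measure_union ?_ hlast, measure_biUnion_finset ?_ fun s _ =>
    hfirst s, D.jointLaw_lt hT hfin hc t ((measurableSet_slice t C _).inter hB)]
  · simp only [D.jointLaw_eq hT hc _ ((measurableSet_slice t C _).inter hB)]
    simp only [observationDensity]
    rw [lintegral_add_left (Finset.measurable_sum _ fun s _ =>
      (D.measurable_stopDensity s).indicator (measurableSet_slice t C s)),
      lintegral_finsetSum _ fun s _ =>
      (D.measurable_stopDensity s).indicator (measurableSet_slice t C s)]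
    simp only [setLIntegral_indicator (measurableSet_slice t C _)]
  · intro s _ s' _ hne
    refine Set.disjoint_left.2 fun ω h1 h2 => hne ?_
    have h3 : (s : ℕ∞) = s' := h1.1.symm.trans h2.1
    exact_mod_cast h3
  · refine Set.disjoint_left.2 fun ω h1 h2 => ?_
    simp only [Set.mem_iUnion, Finset.mem_range, exists_prop] at h1
    obtain ⟨s, hs, h3, _⟩ := h1
    have h4 : (t : ℕ∞) < T ω.1 := h2.1
    rw [h3] at h4
    exact absurd hs (not_lt.2 (by exact_mod_cast h4))

/-- Under the joint law, the second coordinate is a chain with transition matrix `M` from `a`. -/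
theorem isMarkovChainFrom_jointLaw :
    IsMarkovChainFrom (D.jointLaw P₀ hT) (observationFiltration hT) D.M D.a
      (fun t ω => ω.2 t) := by
  have hjoint := fun t C {B} => D.jointLaw_observation hT hfin hc t C (B := B)
  refine ⟨?_, fun t b => ?_, ?_⟩
  · have h := hjoint 0 Set.univ (measurableSet_eval_eq D.a 0).compl
    have h1 : ∫⁻ x in {x : ℕ → X | x 0 = D.a}ᶜ, D.observationDensity 0 Set.univ x ∂D.chainLaw
        = 0 := by
      refine setLIntegral_measure_zero _ _ ?_
      rw [← lintegral_indicator_one (measurableSet_eval_eq D.a 0).compl]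
      have h2 := lintegral_markovChainLaw_zero (PMF.pure D.a) (rowPMF D.M D.nonneg D.sum_row)
        (fun y => ({D.a}ᶜ : Set X).indicator (fun _ => (1 : ℝ≥0∞)) y)
      rw [PMF.toMeasure_pure, lintegral_dirac] at h2
      refine Eq.trans ?_ (h2.trans (by simp))
      rfl
    rw [h1] at h
    rw [ae_iff]
    refine measure_mono_null (Set.subset_inter (Set.subset_univ _) fun ω hω => hω) h
  · exact ⟨{q | q.2 ⟨t, Finset.mem_Iic.2 le_rfl⟩ = b}, MeasurableSet.of_discrete, rfl⟩
  · rintro t _ ⟨C, -, rfl⟩ b c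
    have hbc : MeasurableSet {x : ℕ → X | x t = b ∧ x (t + 1) = c} :=
      (measurableSet_eval_eq b t).inter (measurableSet_eval_eq c (t + 1))
    rw [measureReal_def, measureReal_def, ← ENNReal.toReal_ofReal (D.nonneg b c),
      ← ENNReal.toReal_mul]
    congr 1
    have h1 := hjoint t C (hbc)
    have h2 := hjoint t C (measurableSet_eval_eq b t)
    refine h1.trans (Eq.trans ?_ (congrArg (· * ENNReal.ofReal (D.M b c)) h2.symm))
    have hF : ∀ x : ℕ → X, (fun x : ℕ → X => D.observationDensity t C x *
        ({b} : Set X).indicator (fun _ => 1) (x t)) (extendPath t (Preorder.frestrictLe t x)) =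
        D.observationDensity t C x * ({b} : Set X).indicator (fun _ => 1) (x t) := fun x => by
      simp only [D.observationDensity_extendPath, extendPath_frestrictLe le_rfl]
    have h3 := D.lintegral_chainLaw_succ (F := fun x => D.observationDensity t C x *
      ({b} : Set X).indicator (fun _ => 1) (x t)) hF (({c} : Set X).indicator fun _ => 1)
    rw [← lintegral_indicator (hbc),
      ← lintegral_indicator (measurableSet_eval_eq b t),
      ← lintegral_mul_const _ ((D.measurable_observationDensity t C).indicator
        (measurableSet_eval_eq b t))]
    refine Eq.trans (lintegral_congr fun x => ?_) (h3.trans (lintegral_congr fun x => ?_))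
    · by_cases hb : x t = b <;> by_cases hc' : x (t + 1) = c <;>
        simp [hb, hc']
    · by_cases hb : x t = b <;> simp [Set.indicator_apply, hb]

/-- Under the joint law, `T` is a strong stationary time for the second coordinate. -/
theorem isStrongStationaryTime_jointLaw :
    IsStrongStationaryTime (D.jointLaw P₀ hT) (observationFiltration hT) D.π
      (fun t ω => ω.2 t) (fun ω => T ω.1) := by
  refine ⟨fun t => ?_, ?_, fun t b => ?_⟩
  · refine ⟨{q | q.1 ≤ t}, MeasurableSet.of_discrete, ?_⟩
    ext ω
    simp only [observation, Set.mem_preimage, Set.mem_ofPred_eq, min_le_iff]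
    refine or_iff_left (not_le.2 ?_)
    exact_mod_cast Nat.lt_succ_self t
  · have h := D.jointLaw_map_fst P₀ hT
    rw [← h] at hfin
    exact ae_of_ae_map measurable_fst.aemeasurable hfin
  · have h1 := D.jointLaw_eq hT hc t (measurableSet_eval_eq b t)
    have h2 := D.jointLaw_eq hT hc t MeasurableSet.univ
    simp only [Set.mem_univ, and_true, Measure.restrict_univ, D.lintegral_stopDensity] at h2
    have h3 := D.lintegral_stopDensity_mul t (({b} : Set X).indicator fun _ => 1)
    rw [measureReal_def, measureReal_def, h2, ← ENNReal.toReal_ofReal (D.inv.1 b),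
      ← ENNReal.toReal_mul]
    congr 1
    refine h1.trans ?_
    rw [← lintegral_indicator (measurableSet_eval_eq b t)]
    refine Eq.trans (lintegral_congr fun x => ?_) (h3.trans ?_)
    · by_cases hb : x t = b <;> simp [hb]
    · simp [Set.indicator_apply]

end StoppingData

/-! ### The filling time as a strong stationary time -/

section Coupling

variable {V : Type u} [Fintype V] [DecidableEq V] {K : SubstochasticMatrix V} {lam : ℝ}

variable (K) in
omit [DecidableEq V] in
theorem sum_real_fillingTime_eq (ν : PMF V) (t : ℕ) :
    ∑ s ∈ Finset.range (t + 1), (iidWalkLaw K ν).real {w | fillingTime w = s} =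
      idlaProb K ν t Finset.univ := by
  rw [idlaProb_univ]
  simp only [measureReal_def]
  rw [← ENNReal.toReal_sum fun _ _ => measure_ne_top _ _]
  exact congrArg _ (sum_measure_eq_natCast _ measurable_fillingTime t)

/-- The chain from `η`, to be stopped at a time with the law of the filling time. -/
noncomputable def arwStoppingData (hK : K.NonDegenerate) (hlam : 0 < lam) (ν : PMF V)
    (η : StableConfig V) : StoppingData (StableConfig V) where
  M := transitionMatrix K lam ν
  nonneg := transitionMatrix_nonneg ν hK hlam
  sum_row := sum_transitionMatrix ν hK hlam
  π := statLaw K lam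
  inv := isInvariantLaw_statLaw ν hK hlam
  a := η
  c t := (iidWalkLaw K ν).real {w | fillingTime w = t}
  c_nonneg _ := measureReal_nonneg
  le_pow t ξ := by
    rw [sum_real_fillingTime_eq]
    exact idlaProb_mul_statLaw_le ν hK hlam t η ξ

end Coupling

end ARW

theorem mainTheorem4 {V : Type u} [Fintype V] [DecidableEq V]
    (K : ARW.SubstochasticMatrix V) (hK : K.NonDegenerate)
    (lam : ℝ) (hlam : 0 < lam)
    (ν : PMF V) (hν : K.Reaches ν) :
    ∃ π : ARW.StableConfig V → ℝ,
      -- `π` is the unique invariant law of the chain, and it charges every stable configuration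
      ARW.IsInvariantLaw (ARW.transitionMatrix K lam ν) π ∧
      (∀ π', ARW.IsInvariantLaw (ARW.transitionMatrix K lam ν) π' → π' = π) ∧
      (∀ η, 0 < π η) ∧
      -- the separation distance is the tail of the filling time
      (∀ (Ω : Type v) (mΩ : MeasurableSpace Ω) (P : Measure Ω), IsProbabilityMeasure P →
        ∀ W : ℕ → Ω → ℕ → ARW.WalkState V, ARW.IsIIDWalks K ν P W →
          ∀ t : ℕ, ARW.separationDistance (ARW.transitionMatrix K lam ν) π t =
            P.real {ω | (t : ℕ∞) < ARW.fillingTime (fun n => W n ω)}) ∧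
      -- from every starting point, the chain can be coupled with the walks so that the
      -- filling time is a strong stationary time
      (∀ η : ARW.StableConfig V,
        ∃ (Ω : Type u) (mΩ : MeasurableSpace Ω) (P : Measure Ω) (ℱ : Filtration ℕ mΩ)
          (W : ℕ → Ω → ℕ → ARW.WalkState V) (ξ : ℕ → Ω → ARW.StableConfig V),
          IsProbabilityMeasure P ∧
          ARW.IsIIDWalks K ν P W ∧
          ARW.IsMarkovChainFrom P ℱ (ARW.transitionMatrix K lam ν) η ξ ∧
          ARW.IsStrongStationaryTime P ℱ π ξ (fun ω => ARW.fillingTime (fun n => W n ω))) := by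
  refine ⟨ARW.statLaw K lam, ARW.isInvariantLaw_statLaw ν hK hlam,
    fun π' => ARW.eq_statLaw_of_isInvariantLaw hK hlam hν, ARW.stab_fullConfig_pos hK hlam,
    fun Ω mΩ P hP W hW t => ?_, fun η => ?_⟩
  · have hmeas : Measurable fun ω n => W n ω := measurable_pi_lambda _ hW.measurable
    have hle : MeasurableSet {w : ℕ → ℕ → ARW.WalkState V | ARW.fillingTime w ≤ t} :=
      ARW.measurable_fillingTime (MeasurableSet.of_discrete (s := Set.Iic (t : ℕ∞)))
    have hcompl : {w : ℕ → ℕ → ARW.WalkState V | (t : ℕ∞) < ARW.fillingTime w} =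
        {w | ARW.fillingTime w ≤ t}ᶜ := by
      ext w
      simp
    rw [ARW.separationDistance_eq ν hK hlam, ARW.idlaProb_univ, ← probReal_compl_eq_one_sub hle,
      ← hcompl, ← hW.map_eq, map_measureReal_apply hmeas (hcompl ▸ hle.compl)]
    rfl
  · have hc : ∀ t : ℕ, ARW.iidWalkLaw K ν {w | ARW.fillingTime w = t} =
        ENNReal.ofReal ((ARW.arwStoppingData hK hlam ν η).c t) := fun t =>
      (ofReal_measureReal (measure_ne_top _ _)).symm
    have hfin := ARW.ae_fillingTime_ne_top ν hν
    set D := ARW.arwStoppingData hK hlam ν η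
    exact ⟨(ℕ → ℕ → ARW.WalkState V) × (ℕ → ARW.StableConfig V), inferInstance,
      D.jointLaw (ARW.iidWalkLaw K ν) ARW.measurable_fillingTime,
      ARW.observationFiltration ARW.measurable_fillingTime, fun n ω => ω.1 n, fun n ω => ω.2 n,
      inferInstance, ARW.isIIDWalks_of_map_eq measurable_fst (D.jointLaw_map_fst _ _),
      D.isMarkovChainFrom_jointLaw ARW.measurable_fillingTime hfin hc,
      D.isStrongStationaryTime_jointLaw ARW.measurable_fillingTime hfin hc⟩
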